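/- Fix a dimension $d\ge 1$ and a smoothness $\beta_\mu>0$. Let $\ell$ be the greatest integer strictly less than $\beta_\mu$, and let $\Sigma(\beta_\mu,L)$ be the class of functions $f$ on $[-1,1]^d$ whose partial derivatives $D^\alpha f$ of order $\ell$ satisfy $|D^\alpha f(x)-D^\alpha f(x')|\le L\|x-x'\|^{\beta_\mu-\ell}$. One observes $n$ i.i.d. copies of $(X,D,Y)\sim P$, where $X\sim\mathrm{Unif}([-1,1]^d)$, $D\in\{0,1\}$ with $P(D=1\mid X)=e(X)$, and $Y\mid X,D\sim\mathcal N(D\mu_P(X)+(1-D)\mu_P'(X),\sigma_{\min}^2)$. For constants $q>3$ and $M,\sigma_{\min},C,L>0$ and $\gamma_0>1$, call a nonempty family $\mathscr P$ of such distributions *admissible* if: 1. for all $P\in\mathscr P$: $E_P[|Y-\mu_P(X)|^q\mid X,D=1]\le M^q$ almost surely, $\mathrm{Var}_P(\mu_P(X))\le M$, $\mathrm{Var}_P(Y\mid X,D)\ge\sigma_{\min}^2$, and $P(e(X)\le\pi)\le C\pi^{\gamma_0-1}$ for all $\pi\in[0,1]$; 2. (nondegenerate overlap) there is $\rho>0$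 such that $P(e(X)\le\pi/2)\le(1-\rho)P(e(X)\le\pi)$ for all $P\in\mathscr P$ and $\pi\in[0,1]$; 3. $\mu_P,\mu_P'\in\Sigma(\beta_\mu,L)$ for all $P\in\mathscr P$; 4. (non-trivial concentration) there are $\rho,\gamma>0$ such that for all sufficiently small $h>0$, all $P\in\mathscr P$ and all $x_0\in[-1,1]^d$, $$P\Big(e(X)\ge\rho\sup_{x\in[-1,1]^d,\ \|x-x_0\|\le h}e(x)\ \Big|\ D=1,\ \|X-x_0\|\le h\Big)>\gamma .$$ Let $\beta^*=\beta_\mu(1-1/\gamma_0)$ and $\psi_n=n^{-\beta^*/(2\beta^*+d)}$, and write $\|f\|_\infty=\sup_{x\in[-1,1]^d}|f(x)|$. (i) (Lower bound.) For all constants $q>3$, $M,\sigma_{\min},L>0$, $C\ge1$, $\gamma_0>1$ with $E|N(0,\sigma_{\min}^2)|^q\le M^q$ (the conditions $C\ge 1$ and $E|N(0,\sigma_{\min}^2)|^q\le M^q$ are necessary for an admissible family to exist), there exist $c>0$ and an admissible family $\mathscr P$ such that $$\liminf_{n\to\infty}\inf_{\hat\mu}\sup_{P\in\mathscr P}P\big(|\hat\mu(0)-\mu_P(0)|>c\,\psi_n\big)>0,\qquad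 \liminf_{n\to\infty}\inf_{\hat\mu}\sup_{P\in\mathscr P}P\big(\|\hat\mu-\mu_P\|_\infty>c\,\psi_n\big)>0,$$ where the infima are over all estimators (measurable functions of the $n$ observations and the evaluation point). (ii) (Achievability.) There is a sequence of estimators $\hat\mu=\hat\mu_n$ depending only on $d$ and $\beta_\mu$, in particular not on $\gamma_0$, such that for all constants as above (with any $C>0$), every admissible family $\mathscr P$ and every $\epsilon>0$ there is a finite $c(\epsilon)$ with $$\limsup_{n\to\infty}\sup_{P\in\mathscr P}P\big(\|\hat\mu-\mu_P\|_\infty>c(\epsilon)\,\psi_n\big)\le\epsilon,$$ and hence also $\limsup_{n\to\infty}\sup_{P\in\mathscr P}P(|\hat\mu(x)-\mu_P(x)|>c(\epsilon)\psi_n)\le\epsilon$ for every $x\in[-1,1]^d$. -/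

import Mathlib

open MeasureTheory ProbabilityTheory Filter Topology
open scoped ENNReal NNReal

noncomputable section

namespace WeakOverlap

/-- The ambient covariate space `ℝ^d` with its Euclidean norm. -/
abbrev Cov (d : ℕ) : Type := EuclideanSpace ℝ (Fin d)

/-- The covariate domain `[-1, 1]^d`. -/
def cube (d : ℕ) : Set (Cov d) := {x | ∀ i, x i ∈ Set.Icc (-1 : ℝ) 1}

/-- The uniform distribution on `[-1, 1]^d`. -/
def unifCube (d : ℕ) : Measure (Cov d) := ProbabilityTheory.cond volume (cube d)

/-- One observation `((X, D), Y)`; `D = true` means treated. -/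
abbrev Obs (d : ℕ) : Type := (Cov d × Bool) × ℝ

/-- The regression functions of a distribution of `((X, D), Y)` with `X` uniform on the cube:
the propensity `e(x) = P(D = 1 | X = x)` and the outcome regressions
`mu x = E[Y | X = x, D = 1]`, `mu0 x = E[Y | X = x, D = 0]`. Only their values on the cube matter. -/
structure Model (d : ℕ) where
  e : Cov d → unitInterval
  mu : Cov d → ℝ
  mu0 : Cov d → ℝ
  measurable_e : Measurable e
  measurable_mu : Measurable mu
  measurable_mu0 : Measurable mu0

theorem measurableSet_cube (d : ℕ) : MeasurableSet (cube d) := by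
  have h : cube d = ⋂ i, (fun x : Cov d => x i) ⁻¹' Set.Icc (-1 : ℝ) 1 := by
    ext x; simp [cube]
  rw [h]
  exact MeasurableSet.iInter fun i => (by fun_prop : Measurable fun x : Cov d => x i)
    measurableSet_Icc

theorem volume_cube (d : ℕ) : volume (cube d) = 2 ^ d := by
  have h : cube d = (MeasurableEquiv.toLp 2 (Fin d → ℝ)).symm ⁻¹'
      (Set.univ.pi fun _ => Set.Icc (-1 : ℝ) 1) := by
    ext x; simp [cube, Pi.le_def, forall_and]
  rw [h, (EuclideanSpace.volume_preserving_symm_measurableEquiv_toLp (Fin d)).measure_preimage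
    (MeasurableSet.univ_pi fun _ => measurableSet_Icc).nullMeasurableSet, volume_pi_pi]
  norm_num [Real.volume_Icc]

instance (d : ℕ) : IsProbabilityMeasure (unifCube d) :=
  cond_isProbabilityMeasure_of_finite (by rw [volume_cube]; positivity)
    (by rw [volume_cube]; exact ENNReal.pow_ne_top (by norm_num))

/-- The conditional law of `D` given `X = x`: Bernoulli with success probability `e x`. -/
def Model.treatment {d : ℕ} (P : Model d) : Kernel (Cov d) Bool where
  toFun x := bernoulliMeasure true false (P.e x)
  measurable' := by
    have he := P.measurable_e
    refine Measure.measurable_of_measurable_coe _ fun s _ => ?_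
    simp only [bernoulliMeasure_def, Measure.add_apply, Measure.smul_apply]
    have hc : Continuous unitInterval.toNNReal := by fun_prop
    have h1 : Measurable fun x => unitInterval.toNNReal (P.e x) := hc.measurable.comp he
    have h2 : Measurable fun x => unitInterval.toNNReal (unitInterval.symm (P.e x)) :=
      (hc.comp unitInterval.continuous_symm).measurable.comp he
    exact (h1.coe_nnreal_ennreal.mul_const _).add (h2.coe_nnreal_ennreal.mul_const _)

instance {d : ℕ} (P : Model d) : IsMarkovKernel P.treatment :=
  ⟨fun x => by
    change IsProbabilityMeasure (bernoulliMeasure true false (P.e x))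
    infer_instance⟩

/-- The conditional mean of `Y` given `(X, D)`. -/
def Model.mean {d : ℕ} (P : Model d) (w : Cov d × Bool) : ℝ :=
  if w.2 = true then P.mu w.1 else P.mu0 w.1

theorem Model.measurable_mean {d : ℕ} (P : Model d) : Measurable P.mean :=
  Measurable.ite (measurable_snd (measurableSet_singleton true))
    (P.measurable_mu.comp measurable_fst) (P.measurable_mu0.comp measurable_fst)

/-- The conditional law of `Y` given `(X, D)`: normal with variance `σ ^ 2` about the mean. -/
def Model.outcome {d : ℕ} (P : Model d) (σ : ℝ) : Kernel (Cov d × Bool) ℝ where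
  toFun w := gaussianReal (P.mean w) (σ ^ 2).toNNReal
  measurable' :=
    measurable_gaussianReal.comp (P.measurable_mean.prodMk measurable_const)

instance {d : ℕ} (P : Model d) (σ : ℝ) : IsMarkovKernel (P.outcome σ) :=
  ⟨fun w => by
    change IsProbabilityMeasure (gaussianReal (P.mean w) (σ ^ 2).toNNReal)
    infer_instance⟩

/-- The joint law of one observation `((X, D), Y)`. -/
def Model.law {d : ℕ} (P : Model d) (σ : ℝ) : Measure (Obs d) :=
  (unifCube d ⊗ₘ P.treatment) ⊗ₘ P.outcome σ

instance {d : ℕ} (P : Model d) (σ : ℝ) : IsProbabilityMeasure (P.law σ) := by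
  unfold Model.law; infer_instance

/-- The law of `n` independent observations. -/
def Model.sample {d : ℕ} (P : Model d) (σ : ℝ) (n : ℕ) : Measure (Fin n → Obs d) :=
  Measure.pi fun _ => P.law σ

/-- The greatest integer strictly less than `β`, for `β > 0`. -/
def strictFloor (β : ℝ) : ℕ := ⌈β⌉₊ - 1

/-- The Hölder class `Σ(β, L)` on `[-1, 1]^d`: all partial derivatives of order `strictFloor β` are
Hölder continuous with exponent `β - strictFloor β` and constant `L`. -/
def HolderClass (d : ℕ) (β L : ℝ) : Set (Cov d → ℝ) :=
  {f | ContDiffOn ℝ (strictFloor β) f (cube d) ∧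
    ∀ s : Fin (strictFloor β) → Fin d, ∀ x ∈ cube d, ∀ y ∈ cube d,
      |iteratedFDerivWithin ℝ (strictFloor β) f (cube d) x
            (fun i => EuclideanSpace.single (s i) 1) -
          iteratedFDerivWithin ℝ (strictFloor β) f (cube d) y
            (fun i => EuclideanSpace.single (s i) 1)|
        ≤ L * ‖x - y‖ ^ (β - strictFloor β)}

/-- The basic regularity conditions and the propensity tail bound, uniformly over a nonempty
family `F`. -/
structure BasicConditions {d : ℕ} (q M σ C γ₀ : ℝ) (F : Set (Model d)) : Prop where
  nonempty : F.Nonempty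
  /-- `E[|Y - μ(X)|^q | X, D = 1] ≤ M^q` almost surely. -/
  conditional_moment : ∀ P ∈ F, ∀ᵐ x ∂unifCube d,
    ∫⁻ y, ENNReal.ofReal (|y - P.mu x| ^ q) ∂(P.outcome σ (x, true)) ≤ ENNReal.ofReal (M ^ q)
  /-- `Var(μ(X)) ≤ M`. -/
  unconditional_moment : ∀ P ∈ F, evariance P.mu (unifCube d) ≤ ENNReal.ofReal M
  /-- `Var(Y | X, D) ≥ σ^2` almost surely. -/
  residual : ∀ P ∈ F, ∀ᵐ w ∂(unifCube d ⊗ₘ P.treatment),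
    ENNReal.ofReal (σ ^ 2) ≤ evariance id (P.outcome σ w)
  /-- `P(e(X) ≤ π) ≤ C π^(γ₀ - 1)`. -/
  propensity_tail : ∀ P ∈ F, ∀ π ∈ Set.Icc (0 : ℝ) 1,
    (unifCube d).real {x | (P.e x : ℝ) ≤ π} ≤ C * π ^ (γ₀ - 1)

/-- Nondegenerate overlap, uniformly over `F`. -/
def NondegenerateOverlap {d : ℕ} (F : Set (Model d)) : Prop :=
  ∃ ρ > (0 : ℝ), ∀ P ∈ F, ∀ π ∈ Set.Icc (0 : ℝ) 1,
    (unifCube d).real {x | (P.e x : ℝ) ≤ π / 2} ≤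
      (1 - ρ) * (unifCube d).real {x | (P.e x : ℝ) ≤ π}

/-- The Hölder-smooth Gaussian model with uniform covariates: uniformity of `X` and normality of `Y`
are built into `Model.law`. -/
structure HolderModel {d : ℕ} (β L q M σ C γ₀ : ℝ) (F : Set (Model d)) : Prop where
  basic : BasicConditions q M σ C γ₀ F
  nondegenerate : NondegenerateOverlap F
  smooth : ∀ P ∈ F, P.mu ∈ HolderClass d β L
  smooth0 : ∀ P ∈ F, P.mu0 ∈ HolderClass d β L

/-- Non-trivial concentration: for some `ρ, γ > 0`, for all small `h` and all `P` and `x₀`,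
`P(e(X) ≥ ρ sup_{‖x - x₀‖ ≤ h} e(x) | D = 1, ‖X - x₀‖ ≤ h) > γ`. -/
def NontrivialConcentration {d : ℕ} (σ : ℝ) (F : Set (Model d)) : Prop :=
  ∃ ρ > (0 : ℝ), ∃ γ > (0 : ℝ), ∃ h₀ > (0 : ℝ), ∀ h ∈ Set.Ioc 0 h₀, ∀ P ∈ F, ∀ x₀ ∈ cube d,
    ENNReal.ofReal γ <
      ProbabilityTheory.cond (P.law σ) {z | z.1.2 = true ∧ ‖z.1.1 - x₀‖ ≤ h}
        {z | ρ * sSup ((fun x => (P.e x : ℝ)) '' {x | x ∈ cube d ∧ ‖x - x₀‖ ≤ h})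
          ≤ (P.e z.1.1 : ℝ)}

/-- A function-valued estimator based on `n` observations (jointly measurable in the sample and the
evaluation point). -/
def Estimator (d n : ℕ) : Type :=
  {f : (Fin n → Obs d) → Cov d → ℝ // Measurable (Function.uncurry f)}

/-- The sup-norm distance `sup_{x ∈ [-1, 1]^d} |f x - g x|`. -/
def supDist {d : ℕ} (f g : Cov d → ℝ) : ℝ≥0∞ := ⨆ x ∈ cube d, ENNReal.ofReal |f x - g x|

/-- The effective smoothness `β* = β (1 - 1 / γ₀)`. -/
def effSmoothness (β γ₀ : ℝ) : ℝ := β * (1 - 1 / γ₀)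

/-- The rate `ψ_n = n^(-β* / (2 β* + d))`. -/
def rate (d : ℕ) (β γ₀ : ℝ) (n : ℕ) : ℝ :=
  (n : ℝ) ^ (-effSmoothness β γ₀ / (2 * effSmoothness β γ₀ + d))

end WeakOverlap

end

open WeakOverlap

namespace WeakOverlap

/-! Upper bound. Cut the cube into `N ^ d` cells and, in each cell, choose the polynomial whose
averages over small windows around the nodes of a tensor grid match those of the treated outcomes.
The matrix of averaged monomials is close to an invertible interpolation matrix wherever the points
fall inside the windows, so the fit is stable: its error is at most a constant times `N ^ (-β)`
(Taylor) plus the largest window average of the noise (`exists_stable_fit`,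
`exists_fit_error_bound`).

The resolution is chosen by `criterion`, the sum over windows of `exp (-count * N ^ (-2β))`; `level`
is the largest `N ≤ n` where it is at most `exp (-1)`. This one inequality does two jobs: every
window holds at least `N ^ (2β)` points, and the Gaussian union bound keeps all noise averages below
`c σ N ^ (-β)` except with probability `2 exp (-c² / 2)`, with no logarithm lost
(`gaussian_noise_bound`). Since the level depends on the design alone, this holds conditionally on
the design at the random level itself (`sample_badEvent_le`).

It remains to see that the level is large. Put `g = γ₀ - 1` and `s = 2β + d + d/g`. By Jensen the
expected criterion is at most a constant times `N ^ d * E exp (-b e(X))` with `b` of order `n N ^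
(-(2β + d))`, and the propensity tail turns this into `N ^ d * b ^ (-g)`, which is of order `(n N ^
(-s)) ^ (-g)` (`exists_laplace_bound`, `lintegral_criterion_le`). So with high probability the level
is at least of order `n ^ (1/s)`, and `n ^ (-β/s)` is the rate (`rate_eq`). The exponent `γ₀` enters
the analysis but not the estimator.

Lower bound. The propensity equal to the sup norm of `x` to the power `d/g` has the tail `π ^ g`
exactly. Compare treated mean zero with a bump of width `h` and height of order `h ^ β` at the
origin. On the support, the propensity is at most `h ^ (d/g)` and the volume is of order `h ^ d`, so
the likelihood ratio of one observation has second moment `1 + O(h ^ s)`. With `h = n ^ (-1/s)` the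
two samples cannot be told apart reliably, while the means differ at `0` by a multiple of the rate
(`pointwise_lower_bound`). -/

/-! ### Taylor's formula on convex sets -/

/-- The segment has constant velocity `v`, so each derivative in `t` only inserts one more argument
`v`; evaluation at a constant tuple is linear and commutes with differentiation. Derivatives within
the set are used so that segments touching the boundary of the cube are allowed. -/
theorem iteratedDerivWithin_comp_segment {E : Type*} [NormedAddCommGroup E] [NormedSpace ℝ E]
    {s : Set E} (hs : Convex ℝ s) (hu : UniqueDiffOn ℝ s) {n : ℕ} {f : E → ℝ}
    (hf : ContDiffOn ℝ n f s) {x v : E} (hx : x ∈ s) (hv : x + v ∈ s) {k : ℕ} (hk : k ≤ n)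
    {t : ℝ} (ht : t ∈ Set.Icc (0 : ℝ) 1) :
    iteratedDerivWithin k (fun t : ℝ => f (x + t • v)) (Set.Icc 0 1) t =
      iteratedFDerivWithin ℝ k f s (x + t • v) (fun _ => v) := by
  have hmem : ∀ t ∈ Set.Icc (0 : ℝ) 1, x + t • v ∈ s := fun t ht => by
    have := hs.add_smul_mem hx hv ht
    exact this
  induction k generalizing t with
  | zero => simp
  | succ k ih =>
    have hk' : k ≤ n := (Nat.le_succ k).trans hk
    rw [iteratedDerivWithin_succ, derivWithin_congr (fun t ht => ih hk' ht) (ih hk' ht)]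
    have hd : HasFDerivWithinAt (iteratedFDerivWithin ℝ k f s)
        (fderivWithin ℝ (iteratedFDerivWithin ℝ k f s) s (x + t • v)) s (x + t • v) :=
      (hf.differentiableOn_iteratedFDerivWithin (by exact_mod_cast hk) hu _
        (hmem t ht)).hasFDerivWithinAt
    have hl : HasDerivWithinAt (fun t : ℝ => x + t • v) v (Set.Icc 0 1) t := by
      simpa using ((hasDerivWithinAt_id t (Set.Icc (0 : ℝ) 1)).smul_const v).const_add x
    have h1 := HasFDerivWithinAt.comp_hasDerivWithinAt t hd hl hmem
    have h2 := (ContinuousMultilinearMap.apply ℝ (fun _ : Fin k => E) ℝ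
      (fun _ => v)).hasFDerivAt.comp_hasDerivWithinAt t h1
    have h3 := h2.derivWithin (uniqueDiffOn_Icc (zero_lt_one' ℝ) t ht)
    rw [iteratedFDerivWithin_succ_apply_left]
    exact h3

/-- Taylor's formula at one endpoint of a segment, with the top-order derivative evaluated at an
intermediate point. -/
theorem exists_eq_taylor_sum {E : Type*} [NormedAddCommGroup E] [NormedSpace ℝ E]
    {s : Set E} (hs : Convex ℝ s) (hu : UniqueDiffOn ℝ s) {n : ℕ} {f : E → ℝ}
    (hf : ContDiffOn ℝ n f s) {x v : E} (hx : x ∈ s) (hv : x + v ∈ s) :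
    ∃ t ∈ Set.Icc (0 : ℝ) 1, f (x + v) =
      ∑ k ∈ Finset.range n, ((k.factorial : ℝ)⁻¹) * iteratedFDerivWithin ℝ k f s x (fun _ => v) +
        ((n.factorial : ℝ)⁻¹) * iteratedFDerivWithin ℝ n f s (x + t • v) (fun _ => v) := by
  cases n with
  | zero => exact ⟨1, by simp, by simp⟩
  | succ n =>
    have hmem : ∀ t ∈ Set.Icc (0 : ℝ) 1, x + t • v ∈ s := fun t ht => hs.add_smul_mem hx hv ht
    have hg : ContDiffOn ℝ (n + 1 : ℕ) (fun t : ℝ => f (x + t • v)) (Set.Icc 0 1) :=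
      hf.comp (by fun_prop) hmem
    have hI : Set.uIcc (0 : ℝ) 1 = Set.Icc 0 1 := Set.uIcc_of_le zero_le_one
    obtain ⟨t, ht, h⟩ := taylor_mean_remainder_lagrange (n := n) (zero_ne_one' ℝ)
      (f := fun t : ℝ => f (x + t • v))
      (by rw [hI]; exact hg.of_le (by exact_mod_cast Nat.le_succ n))
      (by
        rw [hI]
        refine (hg.differentiableOn_iteratedDerivWithin (by exact_mod_cast Nat.lt_succ_self n)
          (uniqueDiffOn_Icc zero_lt_one)).mono ?_
        rw [Set.uIoo_of_le zero_le_one]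
        exact Set.Ioo_subset_Icc_self)
    rw [Set.uIoo_of_le zero_le_one] at ht
    have ht' := Set.Ioo_subset_Icc_self ht
    refine ⟨t, ht', ?_⟩
    rw [hI, iteratedDerivWithin_comp_segment hs hu hf hx hv le_rfl ht', taylor_within_apply] at h
    have h0 : ∀ k ∈ Finset.range (n + 1),
        ((k.factorial : ℝ)⁻¹ * (1 - 0) ^ k) •
          iteratedDerivWithin k (fun t : ℝ => f (x + t • v)) (Set.Icc 0 1) 0 =
        ((k.factorial : ℝ)⁻¹) * iteratedFDerivWithin ℝ k f s x (fun _ => v) := fun k hk => by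
      rw [iteratedDerivWithin_comp_segment hs hu hf hx hv
        (by have := Finset.mem_range.mp hk; omega) (by simp)]
      simp
    rw [Finset.sum_congr rfl h0] at h
    simp only [one_smul, sub_zero, one_pow, mul_one] at h
    rw [div_eq_inv_mul] at h
    linarith

/-! ### Local polynomial approximation of Hölder functions on the cube -/

theorem convex_cube (d : ℕ) : Convex ℝ (cube d) := by
  have h : cube d = ⋂ i, (EuclideanSpace.proj (𝕜 := ℝ) i : Cov d →L[ℝ] ℝ) ⁻¹' Set.Icc (-1) 1 := by
    ext x; simp [cube]
  rw [h]
  exact convex_iInter fun i => (convex_Icc _ _).linear_preimage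
    (EuclideanSpace.proj (𝕜 := ℝ) i : Cov d →L[ℝ] ℝ).toLinearMap

theorem ball_subset_cube (d : ℕ) : Metric.ball (0 : Cov d) 1 ⊆ cube d := fun x hx i => by
  have h := (EuclideanSpace.norm_eq x) ▸ (mem_ball_zero_iff.mp hx)
  have : ‖x i‖ ≤ ‖x‖ := PiLp.norm_apply_le x i
  rw [Real.norm_eq_abs] at this
  have h' := mem_ball_zero_iff.mp hx
  exact abs_le.mp (this.trans h'.le)

theorem uniqueDiffOn_cube (d : ℕ) : UniqueDiffOn ℝ (cube d) :=
  uniqueDiffOn_convex (convex_cube d)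
    ⟨0, mem_interior.mpr ⟨_, ball_subset_cube d, Metric.isOpen_ball, by simp⟩⟩

theorem strictFloor_lt {β : ℝ} (hβ : 0 < β) : (strictFloor β : ℝ) < β := by
  have h1 : 0 < ⌈β⌉₊ := Nat.ceil_pos.mpr hβ
  have h2 := Nat.ceil_lt_add_one hβ.le
  rw [strictFloor, Nat.cast_sub h1]
  push_cast; linarith

theorem le_strictFloor_add_one (β : ℝ) : β ≤ strictFloor β + 1 := by
  have h2 := Nat.le_ceil β
  have h3 : ⌈β⌉₊ ≤ strictFloor β + 1 := by unfold strictFloor; omega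
  have : (⌈β⌉₊ : ℝ) ≤ strictFloor β + 1 := by exact_mod_cast h3
  linarith

/-- The Hölder class controls only the partial derivatives along coordinate vectors, whereas
Taylor's formula along a segment involves the direction `v`. Multilinear expansion of `v` links the
two. -/
theorem multilinear_apply_const {d k : ℕ} (g : Cov d [×k]→L[ℝ] ℝ) (v : Cov d) :
    g (fun _ => v) =
      ∑ s : Fin k → Fin d, (∏ i, v (s i)) * g (fun i => EuclideanSpace.single (s i) 1) := by
  have hv : v = ∑ i, v i • EuclideanSpace.single i (1 : ℝ) := by
    ext j
    simp [Finset.sum_apply, Pi.single_apply]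
  conv_lhs => rw [hv]
  have := g.toMultilinearMap.map_sum (fun (_ : Fin k) (j : Fin d) =>
    v j • (EuclideanSpace.single j (1 : ℝ) : Cov d))
  refine this.trans (Finset.sum_congr rfl fun s _ => ?_)
  exact g.toMultilinearMap.map_smul_univ _ _

/-- The monomial of multidegree `α`. -/
noncomputable def monom {d m : ℕ} (α : Fin d → Fin m) (u : Fin d → ℝ) : ℝ :=
  ∏ i, u i ^ (α i : ℕ)

/-- The exponent of coordinate `j` is the size of the fibre of `s` over `j`, at most `k ≤ l`. Thus
total degree at most `l` embeds in degree at most `l` in each coordinate, the space in which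
interpolation on a tensor grid is uniquely solvable. -/
theorem prod_mem_span_monom {d l k : ℕ} (hk : k ≤ l) (s : Fin k → Fin d) :
    (fun u : Fin d → ℝ => ∏ i, u (s i)) ∈
      Submodule.span ℝ (Set.range (monom : (Fin d → Fin (l + 1)) → (Fin d → ℝ) → ℝ)) := by
  refine Submodule.subset_span ⟨fun j => ⟨({i | s i = j} : Finset (Fin k)).card, ?_⟩, ?_⟩
  · have := Finset.card_le_univ ({i | s i = j} : Finset (Fin k))
    simp only [Fintype.card_fin] at this
    omega
  · funext u
    rw [monom, ← Finset.prod_fiberwise Finset.univ s]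
    refine Finset.prod_congr rfl fun j _ => ?_
    rw [Finset.prod_congr rfl (g := fun _ => u j) (fun i hi => by
      rw [(Finset.mem_filter.mp hi).2]), Finset.prod_const]

/-- A function of the Hölder class is locally polynomial up to an error of order `h ^ β`, in the
coordinates rescaled by `h`. -/
theorem exists_monom_approx {d : ℕ} {β L : ℝ} (hβ : 0 < β) (hL : 0 ≤ L) {f : Cov d → ℝ}
    (hf : f ∈ HolderClass d β L) {a : Cov d} (ha : a ∈ cube d) {h : ℝ} (hh : 0 < h) :
    ∃ θ : (Fin d → Fin (strictFloor β + 1)) → ℝ, ∀ x ∈ cube d, (∀ i, |x i - a i| ≤ h) →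
      |f x - ∑ α, θ α * monom α (fun i => (x i - a i) / h)| ≤
        (d : ℝ) ^ strictFloor β * (d : ℝ) ^ (β - strictFloor β) * L * h ^ β := by
  set l := strictFloor β with hl
  set V := Submodule.span ℝ
    (Set.range (monom : (Fin d → Fin (l + 1)) → (Fin d → ℝ) → ℝ)) with hV
  have hγ : 0 < β - l := sub_pos.mpr (strictFloor_lt hβ)
  let D : (k : ℕ) → (Fin k → Fin d) → ℝ := fun k s =>
    iteratedFDerivWithin ℝ k f (cube d) a (fun i => EuclideanSpace.single (s i) 1)
  have hp : (fun u : Fin d → ℝ => ∑ k ∈ Finset.range (l + 1), ((k.factorial : ℝ)⁻¹) *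
      ∑ s : Fin k → Fin d, (∏ i, h * u (s i)) * D k s) ∈ V := by
    have : (fun u : Fin d → ℝ => ∑ k ∈ Finset.range (l + 1), ((k.factorial : ℝ)⁻¹) *
        ∑ s : Fin k → Fin d, (∏ i, h * u (s i)) * D k s) =
        ∑ k ∈ Finset.range (l + 1), ∑ s : Fin k → Fin d,
          ((k.factorial : ℝ)⁻¹ * (h ^ k * D k s)) • (fun u : Fin d → ℝ => ∏ i, u (s i)) := by
      funext u
      simp only [Finset.sum_apply, Pi.smul_apply, smul_eq_mul, Finset.mul_sum]
      refine Finset.sum_congr rfl fun k _ => Finset.sum_congr rfl fun s _ => ?_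
      rw [Finset.prod_mul_distrib]
      simp only [Finset.prod_const, Finset.card_univ, Fintype.card_fin]
      ring
    rw [this]
    refine Submodule.sum_mem _ fun k hk => Submodule.sum_mem _ fun s _ =>
      Submodule.smul_mem _ _ (prod_mem_span_monom ?_ s)
    have := Finset.mem_range.mp hk; omega
  obtain ⟨θ, hθ⟩ := (Submodule.mem_span_range_iff_exists_fun ℝ).mp hp
  refine ⟨θ, fun x hx hxa => ?_⟩
  obtain ⟨t, ht, hT⟩ := exists_eq_taylor_sum (convex_cube d) (uniqueDiffOn_cube d) hf.1 ha
    (v := x - a) (by simpa using hx)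
  have hev := congrFun hθ (fun i => (x i - a i) / h)
  simp only [Finset.sum_apply, Pi.smul_apply, smul_eq_mul] at hev
  rw [hev]
  rw [show a + (x - a) = x by abel] at hT
  rw [← hl] at hT
  rw [hT, Finset.sum_range_succ]
  have hcan : ∀ j, h * ((x j - a j) / h) = (x - a) j := fun j => by
    simp; field_simp
  simp only [hcan]
  have hexp : ∀ (k : ℕ) (y : Cov d), iteratedFDerivWithin ℝ k f (cube d) y (fun _ => x - a) =
      ∑ s : Fin k → Fin d, (∏ i, (x - a) (s i)) *
        iteratedFDerivWithin ℝ k f (cube d) y (fun i => EuclideanSpace.single (s i) 1) :=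
    fun k y => multilinear_apply_const _ _
  simp only [hexp, D]
  -- The terms of order below `l` cancel. What remains compares the order `l` derivatives at an
  -- intermediate point and at `a`, which is where the Hölder condition applies.
  rw [add_sub_add_left_eq_sub, ← mul_sub, ← Finset.sum_sub_distrib, abs_mul]
  have hfac : |((l.factorial : ℝ)⁻¹)| ≤ 1 := by
    rw [abs_of_nonneg (by positivity)]
    exact inv_le_one_of_one_le₀ (by exact_mod_cast l.factorial_pos)
  have hmem : a + t • (x - a) ∈ cube d := (convex_cube d).add_smul_mem ha (by simpa using hx) ht
  -- A crude comparison of the Euclidean and sup norms; it is the source of `d ^ (β - l)` in the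
  -- constant, while `d ^ l` counts the partial derivatives.
  have hnorm : ‖a + t • (x - a) - a‖ ≤ d * h := by
    rw [add_sub_cancel_left, norm_smul, Real.norm_eq_abs, abs_of_nonneg ht.1]
    have h1 : ‖x - a‖ ≤ d * h := by
      have : x - a = ∑ i, (x - a) i • EuclideanSpace.single i (1 : ℝ) := by
        ext j
        simp [Finset.sum_apply, Pi.single_apply]
      rw [this]
      refine (norm_sum_le _ _).trans ?_
      refine (Finset.sum_le_sum (g := fun _ => h) fun i _ => ?_).trans (by simp)
      rw [norm_smul]
      simpa using hxa i
    calc t * ‖x - a‖ ≤ 1 * ‖x - a‖ := by gcongr; exact ht.2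
      _ ≤ _ := by rw [one_mul]; exact h1
  have hterm : ∀ s : Fin l → Fin d,
      |(∏ i, (x - a) (s i)) * iteratedFDerivWithin ℝ l f (cube d) (a + t • (x - a))
          (fun i => EuclideanSpace.single (s i) 1) -
        (∏ i, (x - a) (s i)) * iteratedFDerivWithin ℝ l f (cube d) a
          (fun i => EuclideanSpace.single (s i) 1)| ≤ h ^ l * (L * (d * h) ^ (β - l)) := by
    intro s
    rw [← mul_sub, abs_mul]
    have h1 : |∏ i, (x - a) (s i)| ≤ h ^ l := by
      rw [Finset.abs_prod]
      refine (Finset.prod_le_prod (fun _ _ => abs_nonneg _)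
        (g := fun _ => h) fun i _ => hxa _).trans (by simp)
    gcongr
    exact (hf.2 s _ hmem _ ha).trans (by gcongr)
  calc _ ≤ 1 * ∑ s : Fin l → Fin d, h ^ l * (L * (d * h) ^ (β - l)) := by
        refine mul_le_mul hfac ((Finset.abs_sum_le_sum_abs _ _).trans
          (Finset.sum_le_sum fun s _ => hterm s)) (abs_nonneg _) zero_le_one
    _ = _ := by
        rw [Real.mul_rpow (by positivity) hh.le]
        have : h ^ β = h ^ l * h ^ (β - l) := by
          rw [← Real.rpow_natCast h l, ← Real.rpow_add hh]; congr 1; ring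
        rw [this]
        simp
        ring

/-! ### Stability of interpolation from window averages -/

/-- The interpolation nodes in `[0, 1)`. -/
noncomputable def node (m : ℕ) (r : Fin m) : ℝ := (r : ℝ) / m

theorem node_injective (m : ℕ) : Function.Injective (node m) := fun r s h => by
  have hm : (m : ℝ) ≠ 0 := by exact_mod_cast (Fin.pos r).ne'
  unfold node at h
  field_simp at h
  exact Fin.ext (by exact_mod_cast h)

/-- Evaluation of the monomials at the tensor product of the interpolation nodes. -/
noncomputable def nodeMatrix (d m : ℕ) : Matrix (Fin d → Fin m) (Fin d → Fin m) ℝ :=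
  fun α κ => monom κ (fun i => node m (α i))

/-- The matrix is the `d`-fold tensor power of a Vandermonde matrix with distinct nodes, so the
tensor power of the one-dimensional inverse inverts it. -/
theorem det_nodeMatrix_ne_zero (d m : ℕ) : (nodeMatrix d m).det ≠ 0 := by
  have hV : IsUnit (Matrix.vandermonde (node m)).det :=
    (Matrix.det_vandermonde_ne_zero_iff.mpr (node_injective m)).isUnit
  set W := (Matrix.vandermonde (node m))⁻¹
  have hVW : Matrix.vandermonde (node m) * W = 1 := Matrix.mul_nonsing_inv _ hV
  have hmul : nodeMatrix d m * (Matrix.of fun κ α : Fin d → Fin m => ∏ i, W (κ i) (α i)) = 1 := by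
    ext α α'
    have h1 : ∀ i, ∑ r : Fin m, node m (α i) ^ (r : ℕ) * W r (α' i) =
        (1 : Matrix (Fin m) (Fin m) ℝ) (α i) (α' i) := fun i => by
      rw [← hVW]; rfl
    rw [Matrix.mul_apply]
    simp only [nodeMatrix, monom, Matrix.of_apply, ← Finset.prod_mul_distrib]
    have h2 := Finset.prod_univ_sum (fun _ : Fin d => (Finset.univ : Finset (Fin m)))
      (fun i r => node m (α i) ^ (r : ℕ) * W r (α' i))
    rw [Fintype.piFinset_univ] at h2
    rw [← h2, Finset.prod_congr rfl fun i _ => h1 i]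
    by_cases h : α = α'
    · subst h
      simp only [Matrix.one_apply_eq, Finset.prod_const_one]
    · obtain ⟨i, hi⟩ := Function.ne_iff.mp h
      rw [Matrix.one_apply_ne h]
      exact Finset.prod_eq_zero (Finset.mem_univ i) (Matrix.one_apply_ne hi)
  exact Matrix.det_ne_zero_of_right_inverse hmul

/-- Invertibility is an open condition, and the inverse is the adjugate divided by the determinant,
hence continuous near `A₀`. -/
theorem exists_inverse_bound {ι : Type*} [Fintype ι] [DecidableEq ι] (A₀ : Matrix ι ι ℝ)
    (h₀ : A₀.det ≠ 0) :
    ∃ η > (0 : ℝ), ∃ K > (0 : ℝ), ∀ A : Matrix ι ι ℝ, (∀ i j, |A i j - A₀ i j| ≤ η) →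
      A.det ≠ 0 ∧ ∀ i j, |A⁻¹ i j| ≤ K := by
  obtain ⟨a₀, ha₀⟩ : ∃ a : ι → ι → ℝ, A₀ = Matrix.of a := ⟨A₀, rfl⟩
  rw [ha₀] at h₀ ⊢
  have hof : Continuous fun a : ι → ι → ℝ => Matrix.of a := continuous_id
  have hdet : Continuous fun a : ι → ι → ℝ => (Matrix.of a).det := hof.matrix_det
  have h1 : ∀ᶠ a : ι → ι → ℝ in 𝓝 a₀, (Matrix.of a).det ≠ 0 :=
    hdet.continuousAt.eventually_ne h₀
  have hK : ∃ K > (0 : ℝ), ∀ i j, |(Matrix.of a₀)⁻¹ i j| < K := by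
    refine ⟨1 + ∑ i, ∑ j, |(Matrix.of a₀)⁻¹ i j|, by positivity, fun i j => ?_⟩
    have h1 := Finset.single_le_sum (f := fun j => |(Matrix.of a₀)⁻¹ i j|)
      (fun _ _ => abs_nonneg _) (Finset.mem_univ j)
    have h2 := Finset.single_le_sum (f := fun i => ∑ j, |(Matrix.of a₀)⁻¹ i j|)
      (fun _ _ => Finset.sum_nonneg fun _ _ => abs_nonneg _) (Finset.mem_univ i)
    linarith
  obtain ⟨K, hK, hlt⟩ := hK
  have h2 : ∀ᶠ a : ι → ι → ℝ in 𝓝 a₀, ∀ i j, |(Matrix.of a)⁻¹ i j| < K := by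
    refine eventually_all.mpr fun i => eventually_all.mpr fun j => ?_
    have hform : ∀ A : Matrix ι ι ℝ, A⁻¹ i j = A.det⁻¹ * A.adjugate i j := fun A => by
      rw [Matrix.inv_def, Ring.inverse_eq_inv', Matrix.smul_apply, smul_eq_mul]
    have hc : ContinuousAt (fun a : ι → ι → ℝ =>
        |(Matrix.of a).det⁻¹ * (Matrix.of a).adjugate i j|) a₀ :=
      ((hdet.continuousAt.inv₀ h₀).mul (hof.matrix_adjugate.matrix_elem i j).continuousAt).abs
    simp only [hform]
    refine hc.eventually_lt continuousAt_const ?_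
    have := hlt i j
    rwa [hform] at this
  obtain ⟨η, hη, hsub⟩ := Metric.mem_nhds_iff.mp (h1.and h2)
  refine ⟨η / 2, half_pos hη, K, hK, fun A hA => ?_⟩
  obtain ⟨a, ha⟩ : ∃ a : ι → ι → ℝ, A = Matrix.of a := ⟨A, rfl⟩
  rw [ha] at hA ⊢
  have hmem : a ∈ Metric.ball a₀ η := by
    refine Metric.mem_ball.mpr (lt_of_le_of_lt ?_ (half_lt_self hη))
    exact (dist_pi_le_iff (half_pos hη).le).mpr fun i =>
      (dist_pi_le_iff (half_pos hη).le).mpr fun j => by rw [Real.dist_eq]; exact hA i j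
  obtain ⟨ha, hb⟩ := hsub hmem
  exact ⟨ha, fun i j => (hb i j).le⟩

theorem continuous_monom {d m : ℕ} (α : Fin d → Fin m) : Continuous (monom α) := by
  unfold monom; fun_prop

theorem exists_monom_modulus (d m : ℕ) {η : ℝ} (hη : 0 < η) :
    ∃ δ > (0 : ℝ), ∀ α κ : Fin d → Fin m, ∀ u : Fin d → ℝ, (∀ i, |u i - node m (α i)| ≤ δ) →
      |monom κ u - nodeMatrix d m α κ| ≤ η := by
  have h : ∀ᶠ δ : ℝ in 𝓝[>] 0, ∀ α κ : Fin d → Fin m, ∀ u : Fin d → ℝ,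
      (∀ i, |u i - node m (α i)| ≤ δ) → |monom κ u - nodeMatrix d m α κ| ≤ η := by
    refine eventually_all.mpr fun α => eventually_all.mpr fun κ => ?_
    obtain ⟨ε, hε, hc⟩ := Metric.continuousAt_iff.mp
      ((continuous_monom κ).continuousAt (x := fun i => node m (α i))) η hη
    filter_upwards [Ioo_mem_nhdsGT hε] with δ hδ u hu
    refine (hc (lt_of_le_of_lt ?_ hδ.2)).le
    exact (dist_pi_le_iff hδ.1.le).mpr fun i => by rw [Real.dist_eq]; exact hu i
  obtain ⟨δ, h1, h2⟩ := (h.and self_mem_nhdsWithin).exists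
  exact ⟨δ, h2, h1⟩

/-- The mean of `y` over a finite index set. -/
noncomputable def avg {ι : Type*} (I : Finset ι) (y : ι → ℝ) : ℝ := (∑ i ∈ I, y i) / I.card

theorem avg_add {ι : Type*} (I : Finset ι) (y z : ι → ℝ) :
    avg I (fun i => y i + z i) = avg I y + avg I z := by
  simp [avg, Finset.sum_add_distrib, add_div]

theorem abs_avg_sub_le {ι : Type*} {I : Finset ι} (hI : I.Nonempty) {y : ι → ℝ} {c r : ℝ}
    (h : ∀ i ∈ I, |y i - c| ≤ r) : |avg I y - c| ≤ r := by
  have hc : (0 : ℝ) < I.card := by exact_mod_cast hI.card_pos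
  have : avg I y - c = (∑ i ∈ I, (y i - c)) / I.card := by
    rw [avg, Finset.sum_sub_distrib, Finset.sum_const, nsmul_eq_mul]
    field_simp
  rw [this, abs_div, abs_of_pos hc, div_le_iff₀ hc]
  refine (Finset.abs_sum_le_sum_abs _ _).trans ((Finset.sum_le_sum h).trans ?_)
  simp [mul_comm]

/-- The design matrix: averages of the monomials over groups of design points. -/
noncomputable def designMatrix {d m : ℕ} {ι : Type*} (I : (Fin d → Fin m) → Finset ι)
    (u : ι → Fin d → ℝ) : Matrix (Fin d → Fin m) (Fin d → Fin m) ℝ :=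
  fun α κ => avg (I α) fun i => monom κ (u i)

/-- The coefficients of the polynomial whose group averages agree with those of `y`. -/
noncomputable def localFit {d m : ℕ} {ι : Type*} (I : (Fin d → Fin m) → Finset ι)
    (u : ι → Fin d → ℝ) (y : ι → ℝ) : (Fin d → Fin m) → ℝ :=
  (designMatrix I u)⁻¹.mulVec fun α => avg (I α) y

theorem abs_monom_le_one {d m : ℕ} (α : Fin d → Fin m) {v : Fin d → ℝ} (hv : ∀ i, |v i| ≤ 1) :
    |monom α v| ≤ 1 := by
  rw [monom, Finset.abs_prod]
  refine Finset.prod_le_one (fun _ _ => abs_nonneg _) fun i _ => ?_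
  rw [abs_pow]
  exact pow_le_one₀ (abs_nonneg _) (hv i)

/-- When each group lies near its node, the local fit is stable: its error is at most a constant
times the approximation error plus the largest group average of the noise. -/
theorem exists_stable_fit (d : ℕ) {m : ℕ} (hm : 0 < m) :
    ∃ δ > (0 : ℝ), δ ≤ 1 / (2 * m) ∧ ∃ K > (0 : ℝ), ∀ {ι : Type} (I : (Fin d → Fin m) → Finset ι)
      (u : ι → Fin d → ℝ) (y ξ : ι → ℝ) (θ : (Fin d → Fin m) → ℝ) (R T : ℝ),
      (∀ α, (I α).Nonempty) → (∀ α, ∀ i ∈ I α, ∀ k, |u i k - node m (α k)| ≤ δ) →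
      (∀ α, ∀ i ∈ I α, |y i - ξ i - ∑ κ, θ κ * monom κ (u i)| ≤ R) →
      (∀ α, |avg (I α) ξ| ≤ T) → ∀ v : Fin d → ℝ, (∀ k, |v k| ≤ 1) →
      |∑ κ, localFit I u y κ * monom κ v - ∑ κ, θ κ * monom κ v| ≤ K * (R + T) := by
  obtain ⟨η, hη, K, hK, hinv⟩ := exists_inverse_bound _ (det_nodeMatrix_ne_zero d m)
  obtain ⟨δ, hδ, hmod⟩ := exists_monom_modulus d m hη
  set M : ℝ := ((Fintype.card (Fin d → Fin m) : ℕ) : ℝ) with hM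
  -- The cap `1 / (2 * m)` keeps each window inside its cell. In the constant, one factor `M` is the
  -- row sum of the inverse matrix and the other the sum over monomials.
  refine ⟨min δ (1 / (2 * m)), by positivity, min_le_right _ _, M * (M * K) + 1, by positivity, ?_⟩
  intro ι I u y ξ θ R T hne hu hy hξ v hv
  -- An average of values within `η` of a node value is itself within `η` of it, so only proximity
  -- to the node matters, not how the points are spread in the window.
  obtain ⟨hdet, hbd⟩ := hinv (designMatrix I u) fun α κ =>
    abs_avg_sub_le (hne α) fun i hi => hmod α κ (u i) fun k => (hu α i hi k).trans (min_le_left _ _)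
  have hR : 0 ≤ R + T := by
    obtain ⟨i, hi⟩ := hne fun _ => ⟨0, hm⟩
    exact add_nonneg ((abs_nonneg _).trans (hy _ i hi)) ((abs_nonneg _).trans (hξ fun _ => ⟨0, hm⟩))
  set w : (Fin d → Fin m) → ℝ := fun α =>
    avg (I α) (fun i => y i - ξ i - ∑ κ, θ κ * monom κ (u i)) + avg (I α) ξ with hw
  have hwle : ∀ α, |w α| ≤ R + T := fun α => by
    refine (abs_add_le _ _).trans (add_le_add ?_ (hξ α))
    have := abs_avg_sub_le (hne α) (y := fun i => y i - ξ i - ∑ κ, θ κ * monom κ (u i)) (c := 0)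
      (r := R) fun i hi => by simpa using hy α i hi
    simpa using this
  -- The averages of `y` are the design matrix applied to `θ` plus `w`, the averaged approximation
  -- error and noise. Solving reproduces `θ` exactly and amplifies `w` by the inverse only.
  have hdecomp : (fun α => avg (I α) y) = (designMatrix I u).mulVec θ + w := by
    funext α
    have h1 : (designMatrix I u).mulVec θ α = avg (I α) fun i => ∑ κ, θ κ * monom κ (u i) := by
      simp only [Matrix.mulVec, dotProduct, designMatrix, avg]
      rw [Finset.sum_comm, Finset.sum_div]
      refine Finset.sum_congr rfl fun κ _ => ?_
      rw [← Finset.mul_sum]; ring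
    rw [Pi.add_apply, h1]
    change avg (I α) y = _ + (_ + _)
    rw [← avg_add, ← avg_add]
    congr 1; funext i; ring
  have hfit : localFit I u y = θ + (designMatrix I u)⁻¹.mulVec w := by
    rw [localFit, hdecomp, Matrix.mulVec_add, Matrix.mulVec_mulVec,
      Matrix.nonsing_inv_mul _ hdet.isUnit, Matrix.one_mulVec]
  have hcoef : ∀ κ, |(designMatrix I u)⁻¹.mulVec w κ| ≤ M * (K * (R + T)) := fun κ => by
    refine (Finset.abs_sum_le_sum_abs _ _).trans ?_
    refine (Finset.sum_le_sum (g := fun _ => K * (R + T)) fun α _ => ?_).trans (by simp [M])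
    rw [abs_mul]
    exact mul_le_mul (hbd _ _) (hwle α) (abs_nonneg _) hK.le
  rw [← Finset.sum_sub_distrib]
  have : ∀ κ ∈ Finset.univ, |localFit I u y κ * monom κ v - θ κ * monom κ v| ≤
      M * (K * (R + T)) := fun κ _ => by
    rw [← sub_mul, hfit, Pi.add_apply, add_sub_cancel_left, abs_mul]
    exact (mul_le_of_le_one_right (abs_nonneg _) (abs_monom_le_one κ hv)).trans (hcoef κ)
  refine (Finset.abs_sum_le_sum_abs _ _).trans ((Finset.sum_le_sum this).trans ?_)
  simp only [Finset.sum_const, Finset.card_univ, nsmul_eq_mul]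
  have : M * (M * (K * (R + T))) = M * (M * K) * (R + T) := by ring
  change M * (M * (K * (R + T))) ≤ _
  rw [this]
  gcongr
  linarith

/-! ### Design, noise, and Gaussian tails -/

theorem lintegral_pi_prod {ι : Type*} [Fintype ι] {Ω : Type*} [MeasurableSpace Ω]
    (μ : Measure Ω) [IsProbabilityMeasure μ] {f : ι → Ω → ℝ≥0∞} (hf : ∀ i, Measurable (f i)) :
    ∫⁻ x : ι → Ω, ∏ i, f i (x i) ∂(Measure.pi fun _ => μ) = ∏ i, ∫⁻ x, f i x ∂μ := by
  rw [lintegral_prod_eq_prod_lintegral_of_indepFun (X := fun i (x : ι → Ω) => f i (x i)) Finset.univ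
    (iIndepFun_pi fun i => (hf i).aemeasurable) fun i => (hf i).comp (measurable_pi_apply i)]
  refine Finset.prod_congr rfl fun i _ => ?_
  exact (measurePreserving_eval (fun _ : ι => μ) i).lintegral_comp (hf i)

/-- The law of `(X, D)`. -/
noncomputable def Model.design {d : ℕ} (P : Model d) : Measure (Cov d × Bool) :=
  unifCube d ⊗ₘ P.treatment

instance {d : ℕ} (P : Model d) : IsProbabilityMeasure P.design := by
  unfold Model.design; infer_instance

theorem lintegral_treatment {d : ℕ} (P : Model d) (x : Cov d) (f : Bool → ℝ≥0∞) :
    ∫⁻ b, f b ∂(P.treatment x) =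
      ENNReal.ofReal (P.e x) * f true + ENNReal.ofReal (1 - P.e x) * f false := by
  change ∫⁻ b, f b ∂(bernoulliMeasure true false (P.e x)) = _
  rw [bernoulliMeasure_def, lintegral_add_measure, lintegral_smul_measure, lintegral_smul_measure,
    lintegral_dirac, lintegral_dirac]
  have h : ∀ t : unitInterval, ((unitInterval.toNNReal t : ℝ≥0) : ℝ≥0∞) = ENNReal.ofReal t :=
    fun t => by
      rw [ENNReal.ofReal]; congr 1; ext; simp [Real.coe_toNNReal _ t.2.1]
  simp only [ENNReal.smul_def, smul_eq_mul, h, unitInterval.coe_symm_eq]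

theorem lintegral_design {d : ℕ} (P : Model d) {f : Cov d × Bool → ℝ≥0∞} (hf : Measurable f) :
    ∫⁻ w, f w ∂P.design = ∫⁻ x, (ENNReal.ofReal (P.e x) * f (x, true) +
      ENNReal.ofReal (1 - P.e x) * f (x, false)) ∂(unifCube d) := by
  rw [Model.design, Measure.lintegral_compProd hf]
  exact lintegral_congr fun x => lintegral_treatment P x fun b => f (x, b)

theorem map_gaussianReal_affine (m σ : ℝ) :
    (gaussianReal 0 1).map (fun z => m + σ * z) = gaussianReal m (σ ^ 2).toNNReal := by
  have h : (fun z : ℝ => m + σ * z) = (fun z => m + z) ∘ fun z => σ * z := rfl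
  rw [h, ← Measure.map_map (by fun_prop) (by fun_prop), gaussianReal_map_const_mul,
    gaussianReal_map_const_add]
  congr 1
  · simp
  · rw [mul_one]; ext; simp [Real.coe_toNNReal _ (sq_nonneg σ)]

/-- The observation determined by its design point and its standardized noise. -/
noncomputable def Model.observe {d : ℕ} (P : Model d) (σ : ℝ) (w : (Cov d × Bool) × ℝ) : Obs d :=
  (w.1, P.mean w.1 + σ * w.2)

theorem Model.measurable_observe {d : ℕ} (P : Model d) (σ : ℝ) : Measurable (P.observe σ) :=
  measurable_fst.prodMk ((P.measurable_mean.comp measurable_fst).add (measurable_snd.const_mul σ))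

theorem map_observe {d : ℕ} (P : Model d) (σ : ℝ) :
    (P.design.prod (gaussianReal 0 1)).map (P.observe σ) = P.law σ := by
  ext s hs
  rw [Measure.map_apply (P.measurable_observe σ) hs,
    Measure.prod_apply (P.measurable_observe σ hs), Model.law, Measure.compProd_apply hs]
  refine lintegral_congr fun w => ?_
  change _ = gaussianReal (P.mean w) (σ ^ 2).toNNReal _
  rw [← map_gaussianReal_affine, Measure.map_apply (by fun_prop) (measurable_prodMk_left hs)]
  rfl

/-- The sample is disintegrated into its design and independent standard normal noise, so quantities
computed from the design, in particular the level and the windows, can be frozen when noise is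
estimated. -/
theorem sample_apply {d : ℕ} (P : Model d) (σ : ℝ) (n : ℕ) {s : Set (Fin n → Obs d)}
    (hs : MeasurableSet s) :
    P.sample σ n s = ∫⁻ w, (Measure.pi fun _ : Fin n => gaussianReal 0 1)
      {z | (fun i => P.observe σ (w i, z i)) ∈ s} ∂(Measure.pi fun _ : Fin n => P.design) := by
  have h1 : P.sample σ n = (Measure.pi fun _ : Fin n => P.design.prod (gaussianReal 0 1)).map
      (fun x i => P.observe σ (x i)) := by
    rw [Measure.pi_map_pi fun _ => (P.measurable_observe σ).aemeasurable, map_observe]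
    rfl
  have hm : Measurable fun (x : Fin n → (Cov d × Bool) × ℝ) i => P.observe σ (x i) :=
    measurable_pi_lambda _ fun i => (P.measurable_observe σ).comp (measurable_pi_apply i)
  have hmp := (measurePreserving_arrowProdEquivProdArrow (Cov d × Bool) ℝ (Fin n)
    (fun _ => P.design) (fun _ => gaussianReal 0 1)).symm
  rw [h1, Measure.map_apply hm hs, ← hmp.measure_preimage (hm hs).nullMeasurableSet,
    Measure.prod_apply (hmp.measurable (hm hs))]
  rfl

/-- A sum of `I.card` independent standard normals is sub-Gaussian with variance proxy `I.card`; the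
factor 2 accounts for the two signs. -/
theorem gaussian_sum_tail {n : ℕ} (I : Finset (Fin n)) {t : ℝ} (ht : 0 ≤ t) :
    (Measure.pi fun _ : Fin n => gaussianReal 0 1) {z | t ≤ |∑ i ∈ I, z i|} ≤
      ENNReal.ofReal (2 * Real.exp (-t ^ 2 / (2 * I.card))) := by
  set G := Measure.pi fun _ : Fin n => gaussianReal 0 1
  have hsub : ∀ i : Fin n, HasSubgaussianMGF (fun z : Fin n → ℝ => z i) 1 G := fun i => by
    refine ⟨fun t => ?_, fun t => ?_⟩
    · exact (measurePreserving_eval (fun _ : Fin n => gaussianReal 0 1) i).integrable_comp_of_integrable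
        (integrable_exp_mul_gaussianReal t)
    · have h1 : G.map (fun z : Fin n → ℝ => z i) = gaussianReal 0 1 :=
        (measurePreserving_eval (fun _ : Fin n => gaussianReal 0 1) i).map_eq
      rw [mgf_gaussianReal h1]; simp
  have hind : iIndepFun (fun (i : Fin n) (z : Fin n → ℝ) => z i) G :=
    iIndepFun_pi (X := fun _ => id) fun _ => aemeasurable_id
  have hindn : iIndepFun (fun (i : Fin n) (z : Fin n → ℝ) => -z i) G :=
    iIndepFun_pi (X := fun _ x => -x) fun _ => measurable_neg.aemeasurable
  have h1 := HasSubgaussianMGF.measure_sum_ge_le_of_iIndepFun hind (s := I) (c := fun _ => 1)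
    (fun i _ => hsub i) ht
  have h2 := HasSubgaussianMGF.measure_sum_ge_le_of_iIndepFun hindn (s := I) (c := fun _ => 1)
    (fun i _ => (hsub i).neg) ht
  simp only [Finset.sum_const, nsmul_eq_mul, mul_one, NNReal.coe_natCast,
    Finset.sum_neg_distrib] at h1 h2
  have hsplit : {z : Fin n → ℝ | t ≤ |∑ i ∈ I, z i|} ⊆
      {z | t ≤ ∑ i ∈ I, z i} ∪ {z | t ≤ -∑ i ∈ I, z i} := fun z hz => by
    rcases le_abs.mp (show t ≤ |∑ i ∈ I, z i| from hz) with h | h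
    · exact Or.inl h
    · exact Or.inr h
  have hr := (measureReal_mono (μ := G) hsplit).trans (measureReal_union_le _ _)
  rw [← ofReal_measureReal]
  exact ENNReal.ofReal_le_ofReal (by linarith)

theorem gaussian_avg_tail {n : ℕ} {I : Finset (Fin n)} (hI : I.Nonempty) {t : ℝ} (ht : 0 ≤ t) :
    (Measure.pi fun _ : Fin n => gaussianReal 0 1) {z | t < |avg I z|} ≤
      ENNReal.ofReal (2 * Real.exp (-(I.card * t ^ 2) / 2)) := by
  have hc : (0 : ℝ) < I.card := by exact_mod_cast hI.card_pos
  refine (measure_mono fun z hz => ?_).trans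
    ((gaussian_sum_tail I (t := I.card * t) (by positivity)).trans_eq ?_)
  · have h : t < |avg I z| := hz
    rw [avg, abs_div, abs_of_pos hc, lt_div_iff₀ hc] at h
    change (I.card : ℝ) * t ≤ |∑ i ∈ I, z i|
    linarith
  · congr 3
    field_simp

/-! ### The estimator -/

/-- Coordinates on the cell `j` of the regular partition of the cube into `N ^ d` cells, scaled so
that the cell becomes `[-1, 1]^d`. -/
noncomputable def scaled {d : ℕ} (N : ℕ) (j : Fin d → ℕ) (x : Cov d) : Fin d → ℝ :=
  fun k => N * (x k + 1) - (2 * j k + 1)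

/-- The treated observations whose covariate is near the node `α` of the cell `j`. -/
noncomputable def treatedNear {d m n : ℕ} (δ : ℝ) (N : ℕ) (j : Fin d → ℕ) (α : Fin d → Fin m)
    (w : Fin n → Cov d × Bool) : Finset (Fin n) :=
  open Classical in
  Finset.univ.filter fun i => (w i).2 = true ∧ ∀ k, |scaled N j (w i).1 k - node m (α k)| ≤ δ

/-- A union bound for the noise at level `N`, computable from the design. -/
noncomputable def criterion {d n : ℕ} (m : ℕ) (δ β : ℝ) (N : ℕ) (w : Fin n → Cov d × Bool) : ℝ :=
  ∑ j : Fin d → Fin N, ∑ α : Fin d → Fin m,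
    Real.exp (-((treatedNear δ N (fun k => j k) α w).card * (N : ℝ) ^ (-(2 * β))))

/-- The finest admissible level. -/
noncomputable def level {d n : ℕ} (m : ℕ) (δ β : ℝ) (w : Fin n → Cov d × Bool) : ℕ :=
  open Classical in
  Nat.findGreatest (fun N => 0 < N ∧ criterion m δ β N w ≤ Real.exp (-1)) n

/-- The cell of the level `N` partition containing a point of the cube. -/
noncomputable def cellIndex {d : ℕ} (N : ℕ) (x : Cov d) : Fin d → ℕ :=
  fun k => min ⌊(x k + 1) * N / 2⌋₊ (N - 1)

/-- The polynomial fit on the cell `j` at level `N`. -/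
noncomputable def cellFit {d n : ℕ} (m : ℕ) (δ : ℝ) (N : ℕ) (j : Fin d → ℕ) (ω : Fin n → Obs d)
    (x : Cov d) : ℝ :=
  ∑ κ : Fin d → Fin m, localFit (fun α => treatedNear δ N j α fun i => (ω i).1)
    (fun i => scaled N j (ω i).1.1) (fun i => (ω i).2) κ * monom κ (scaled N j x)

/-- The piecewise polynomial estimator with data-driven level. -/
noncomputable def piecewiseFit {d n : ℕ} (m : ℕ) (δ β : ℝ) (ω : Fin n → Obs d) (x : Cov d) : ℝ :=
  cellFit m δ (level m δ β fun i => (ω i).1) (cellIndex (level m δ β fun i => (ω i).1) x) ω x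

/-! ### Measurability of the estimator -/

theorem measurable_scaled {d : ℕ} (N : ℕ) (j : Fin d → ℕ) (k : Fin d) :
    Measurable fun x : Cov d => scaled N j x k := by
  unfold scaled; fun_prop

theorem measurableSet_near {d m : ℕ} (δ : ℝ) (N : ℕ) (j : Fin d → ℕ) (α : Fin d → Fin m) :
    MeasurableSet {x : Cov d | ∀ k, |scaled N j x k - node m (α k)| ≤ δ} := by
  simp only [Set.ofPred_forall]
  exact MeasurableSet.iInter fun k => measurableSet_le
    (((measurable_scaled N j k).sub_const _).abs) measurable_const

theorem measurableSet_mem_treatedNear {d m n : ℕ} (δ : ℝ) (N : ℕ) (j : Fin d → ℕ)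
    (α : Fin d → Fin m) (i : Fin n) :
    MeasurableSet {w : Fin n → Cov d × Bool | i ∈ treatedNear δ N j α w} := by
  have h : {w : Fin n → Cov d × Bool | i ∈ treatedNear δ N j α w} =
      (fun w => w i) ⁻¹' ((Prod.snd ⁻¹' {true}) ∩
        (Prod.fst ⁻¹' {x : Cov d | ∀ k, |scaled N j x k - node m (α k)| ≤ δ})) := by
    ext w; simp [treatedNear]
  rw [h]
  exact measurable_pi_apply i ((measurable_snd (measurableSet_singleton true)).inter
    (measurable_fst (measurableSet_near δ N j α)))

theorem card_treatedNear {d m n : ℕ} (δ : ℝ) (N : ℕ) (j : Fin d → ℕ) (α : Fin d → Fin m)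
    (w : Fin n → Cov d × Bool) : ((treatedNear δ N j α w).card : ℝ) =
      ∑ i, Set.indicator {w : Cov d × Bool | w.2 = true ∧
        ∀ k, |scaled N j w.1 k - node m (α k)| ≤ δ} (fun _ => (1 : ℝ)) (w i) := by
  classical
  simp only [treatedNear, Finset.card_filter, Nat.cast_sum, Set.indicator_apply, Set.mem_ofPred_eq]
  refine Finset.sum_congr rfl fun i _ => ?_
  split_ifs <;> simp

theorem sum_mem_eq_sum_indicator {Ω ι : Type*} [Fintype ι] (I : Ω → Finset ι) (y : Ω → ι → ℝ)
    (ω : Ω) : ∑ i ∈ I ω, y ω i = ∑ i, Set.indicator {ω | i ∈ I ω} (fun ω => y ω i) ω := by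
  classical
  simp only [Set.indicator_apply, Set.mem_ofPred_eq]
  rw [← Finset.sum_filter]
  congr 1; ext; simp

theorem measurable_sum_mem {Ω ι : Type*} [MeasurableSpace Ω] [Fintype ι] {I : Ω → Finset ι}
    (hI : ∀ i, MeasurableSet {ω | i ∈ I ω}) {y : Ω → ι → ℝ} (hy : ∀ i, Measurable fun ω => y ω i) :
    Measurable fun ω => ∑ i ∈ I ω, y ω i := by
  simp only [sum_mem_eq_sum_indicator I y]
  exact Finset.measurable_sum _ fun i _ => (hy i).indicator (hI i)

theorem measurable_card {Ω ι : Type*} [MeasurableSpace Ω] [Fintype ι] {I : Ω → Finset ι}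
    (hI : ∀ i, MeasurableSet {ω | i ∈ I ω}) : Measurable fun ω => ((I ω).card : ℝ) := by
  have := measurable_sum_mem hI (y := fun _ _ => 1) fun _ => measurable_const
  simpa using this

theorem measurable_avg {Ω ι : Type*} [MeasurableSpace Ω] [Fintype ι] {I : Ω → Finset ι}
    (hI : ∀ i, MeasurableSet {ω | i ∈ I ω}) {y : Ω → ι → ℝ} (hy : ∀ i, Measurable fun ω => y ω i) :
    Measurable fun ω => avg (I ω) (y ω) :=
  (measurable_sum_mem hI hy).div (measurable_card hI)

/-- Inversion is discontinuous at singular matrices, but its entries are the inverse of the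
determinant times continuous cofactors, and real inversion with `0⁻¹ = 0` is measurable. -/
theorem measurable_matrix_inv {Ω ι : Type*} [MeasurableSpace Ω] [Fintype ι] [DecidableEq ι]
    {A : Ω → Matrix ι ι ℝ} (hA : ∀ i j, Measurable fun ω => A ω i j) (i j : ι) :
    Measurable fun ω => (A ω)⁻¹ i j := by
  have hform : ∀ A : Matrix ι ι ℝ, A⁻¹ i j = A.det⁻¹ * A.adjugate i j := fun A => by
    rw [Matrix.inv_def, Ring.inverse_eq_inv', Matrix.smul_apply, smul_eq_mul]
  have hof : Continuous fun a : ι → ι → ℝ => Matrix.of a := continuous_id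
  have hdet : Measurable fun a : ι → ι → ℝ => (Matrix.of a).det := hof.matrix_det.measurable
  have hadj : Measurable fun a : ι → ι → ℝ => (Matrix.of a).adjugate i j :=
    (hof.matrix_adjugate.matrix_elem i j).measurable
  have hmA : Measurable fun ω => (fun i j => A ω i j : ι → ι → ℝ) :=
    measurable_pi_lambda _ fun i => measurable_pi_lambda _ fun j => hA i j
  simp only [hform]
  exact ((hdet.comp hmA).inv).mul (hadj.comp hmA)

theorem measurable_localFit {Ω ι : Type*} [MeasurableSpace Ω] [Fintype ι] {d m : ℕ}
    {I : Ω → (Fin d → Fin m) → Finset ι} (hI : ∀ α i, MeasurableSet {ω | i ∈ I ω α})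
    {u : Ω → ι → Fin d → ℝ} (hu : ∀ i, Measurable fun ω => u ω i)
    {y : Ω → ι → ℝ} (hy : ∀ i, Measurable fun ω => y ω i) (κ : Fin d → Fin m) :
    Measurable fun ω => localFit (I ω) (u ω) (y ω) κ := by
  simp only [localFit, Matrix.mulVec, dotProduct]
  refine Finset.measurable_sum _ fun α _ => Measurable.mul ?_ (measurable_avg (hI α) hy)
  refine measurable_matrix_inv (fun α κ => measurable_avg (hI α) fun i => ?_) κ α
  exact (continuous_monom κ).measurable.comp (hu i)

theorem measurable_criterion {d n : ℕ} (m : ℕ) (δ β : ℝ) (N : ℕ) :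
    Measurable fun w : Fin n → Cov d × Bool => criterion m δ β N w := by
  unfold criterion
  refine Finset.measurable_sum _ fun j _ => Finset.measurable_sum _ fun α _ => ?_
  exact (((measurable_card fun i => measurableSet_mem_treatedNear δ N _ α i).mul_const _).neg).exp

theorem measurable_level {d n : ℕ} (m : ℕ) (δ β : ℝ) :
    Measurable fun w : Fin n → Cov d × Bool => level m δ β w := by
  classical
  unfold level
  refine measurable_findGreatest fun N _ => ?_
  by_cases hN : 0 < N
  · simp only [hN, true_and]
    exact measurableSet_le (measurable_criterion m δ β N) measurable_const
  · simp [hN]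

theorem measurable_cellIndex {d : ℕ} (N : ℕ) : Measurable (cellIndex N : Cov d → Fin d → ℕ) := by
  refine measurable_pi_lambda _ fun k => ?_
  refine (measurable_of_countable fun l : ℕ => min l (N - 1)).comp (Nat.measurable_floor.comp ?_)
  fun_prop

theorem measurable_cellFit {d n : ℕ} (m : ℕ) (δ : ℝ) (N : ℕ) (j : Fin d → ℕ) :
    Measurable fun p : (Fin n → Obs d) × Cov d => cellFit m δ N j p.1 p.2 := by
  unfold cellFit
  refine Finset.measurable_sum _ fun κ _ => Measurable.mul ?_ ?_
  · refine (measurable_localFit (Ω := Fin n → Obs d)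
      (I := fun ω α => treatedNear δ N j α fun i => (ω i).1)
      (u := fun ω i => scaled N j (ω i).1.1) (y := fun ω i => (ω i).2)
      (fun α i => ?_) (fun i => ?_) (fun i => ?_) κ).comp measurable_fst
    · have : Measurable fun (ω : Fin n → Obs d) i => (ω i).1 :=
        measurable_pi_lambda _ fun i => measurable_fst.comp (measurable_pi_apply i)
      exact this (measurableSet_mem_treatedNear δ N j α i)
    · exact measurable_pi_lambda _ fun k => (measurable_scaled N j k).comp
        (measurable_fst.comp (measurable_fst.comp (measurable_pi_apply i)))
    · exact measurable_snd.comp (measurable_pi_apply i)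
  · exact (continuous_monom κ).measurable.comp ((measurable_pi_lambda _ fun k =>
      measurable_scaled N j k).comp measurable_snd)

/-- The level and the cell are data-dependent but take countably many values; this reduces the
estimator to fixed level and cell. -/
theorem measurable_of_countable_index {Ω ι : Type*} [MeasurableSpace Ω] [MeasurableSpace ι]
    [Countable ι] [MeasurableSingletonClass ι] {Y : Type*} [MeasurableSpace Y] {F : ι → Ω → Y} (hF : ∀ i, Measurable (F i))
    {idx : Ω → ι} (hidx : Measurable idx) : Measurable fun ω => F (idx ω) ω := by
  have h : Measurable fun q : ι × Ω => F q.1 q.2 := measurable_from_prod_countable_right hF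
  exact h.comp (hidx.prodMk measurable_id)

theorem measurable_cellFit_at {Ω : Type*} [MeasurableSpace Ω] {d n : ℕ} (m : ℕ) (δ : ℝ)
    {lev : Ω → ℕ} (hlev : Measurable lev) {S : Ω → Fin n → Obs d} (hS : Measurable S)
    {X : Ω → Cov d} (hX : Measurable X) :
    Measurable fun p => cellFit m δ (lev p) (cellIndex (lev p) (X p)) (S p) (X p) := by
  have hcell : Measurable fun p => cellIndex (lev p) (X p) :=
    measurable_of_countable_index (F := fun N p => (cellIndex N (X p) : Fin d → ℕ))
      (fun N => (measurable_cellIndex N).comp hX) hlev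
  exact measurable_of_countable_index
    (F := fun (q : ℕ × (Fin d → ℕ)) p => cellFit m δ q.1 q.2 (S p) (X p))
    (idx := fun p => (lev p, cellIndex (lev p) (X p)))
    (fun q => by
      simpa only [Function.comp_def] using (measurable_cellFit m δ q.1 q.2).comp (hS.prodMk hX))
    (hlev.prodMk hcell)

theorem measurable_piecewiseFit (d n m : ℕ) (δ β : ℝ) :
    Measurable (Function.uncurry (piecewiseFit m δ β : (Fin n → Obs d) → Cov d → ℝ)) :=
  measurable_cellFit_at m δ (lev := fun p : (Fin n → Obs d) × Cov d => level m δ β fun i => (p.1 i).1)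
    ((measurable_level m δ β).comp (measurable_pi_lambda _ fun i =>
      measurable_fst.comp ((measurable_pi_apply i).comp measurable_fst)))
    measurable_fst measurable_snd

/-! ### Cells and the deterministic error bound -/

theorem cellIndex_lt {d N : ℕ} (hN : 0 < N) (x : Cov d) (k : Fin d) : cellIndex N x k < N :=
  (min_le_right _ _).trans_lt (Nat.sub_lt hN one_pos)

/-- The cap at `N - 1` in `cellIndex` changes the floor only on the face `x k = 1`, where the floor
is `N`; the point then sits on the boundary of the last cell. -/
theorem abs_scaled_cellIndex_le {d N : ℕ} (hN : 0 < N) {x : Cov d} (hx : x ∈ cube d) (k : Fin d) :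
    |scaled N (cellIndex N x) x k| ≤ 1 := by
  have hN' : (0 : ℝ) < N := by exact_mod_cast hN
  obtain ⟨h1, h2⟩ := hx k
  have hy0 : 0 ≤ (x k + 1) * N / 2 := by
    have : 0 ≤ x k + 1 := by linarith
    positivity
  have hyN : (x k + 1) * N / 2 ≤ N := by nlinarith
  have hfl := Nat.floor_le hy0
  have hlt := Nat.lt_floor_add_one ((x k + 1) * N / 2)
  rw [scaled, abs_le]
  unfold cellIndex
  rcases le_total ⌊(x k + 1) * N / 2⌋₊ (N - 1) with h | h
  · rw [min_eq_left h]; constructor <;> linarith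
  · rw [min_eq_right h]
    have hc : ((N - 1 : ℕ) : ℝ) = N - 1 := by rw [Nat.cast_sub hN]; simp
    have h' : ((N - 1 : ℕ) : ℝ) ≤ ⌊(x k + 1) * N / 2⌋₊ := by exact_mod_cast h
    rw [hc] at h' ⊢
    constructor <;> linarith

theorem mem_cube_of_abs_scaled_le {d N : ℕ} (hN : 0 < N) {j : Fin d → ℕ} (hj : ∀ k, j k < N)
    {x : Cov d} (hx : ∀ k, |scaled N j x k| ≤ 1) : x ∈ cube d := fun k => by
  have hN' : (0 : ℝ) < N := by exact_mod_cast hN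
  obtain ⟨h1, h2⟩ := abs_le.mp (hx k)
  have hj' : (j k : ℝ) + 1 ≤ N := by exact_mod_cast hj k
  have hj0 : (0 : ℝ) ≤ j k := Nat.cast_nonneg _
  unfold scaled at h1 h2
  constructor
  · by_contra h
    push Not at h
    nlinarith
  · by_contra h
    push Not at h
    nlinarith

/-- Nodes lie in `[0, 1 - 1/m]`, so a window of half-width `1 / (2m)` stays within `[-1, 1]`. -/
theorem abs_le_one_of_near {m : ℕ} {δ : ℝ} (hδ : δ ≤ 1 / (2 * m)) {r : Fin m} {t : ℝ}
    (h : |t - node m r| ≤ δ) : |t| ≤ 1 := by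
  have hm : (0 : ℝ) < m := by exact_mod_cast Fin.pos r
  have hr : (r : ℝ) + 1 ≤ m := by exact_mod_cast r.2
  have hr0 : (0 : ℝ) ≤ r := Nat.cast_nonneg _
  obtain ⟨h1, h2⟩ := abs_le.mp h
  unfold node at h1 h2
  have h3 : (r : ℝ) / m ≤ 1 - 1 / m := by
    rw [div_le_iff₀ hm, sub_mul, div_mul_cancel₀ _ hm.ne']; linarith
  have h4 : (0 : ℝ) ≤ (r : ℝ) / m := by positivity
  have h5 : 1 / (2 * (m : ℝ)) = 1 / m / 2 := by field_simp
  have h6 : 1 / (m : ℝ) ≤ 1 := by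
    rw [div_le_one hm]; linarith
  have h7 : 0 < 1 / (m : ℝ) := by positivity
  rw [abs_le]
  constructor <;> linarith

theorem scaled_zero_center {d N : ℕ} (hN : 0 < N) {j : Fin d → ℕ} (hj : ∀ k, j k < N) :
    ∃ a ∈ cube d, ∀ x : Cov d, ∀ k, x k - a k = scaled N j x k / N := by
  have hN' : (0 : ℝ) < N := by exact_mod_cast hN
  have hform : ∀ x : Cov d, ∀ k, x k - (-1 + (2 * j k + 1) / N) = scaled N j x k / N :=
    fun x k => by unfold scaled; field_simp; ring
  refine ⟨WithLp.toLp 2 fun k => -1 + (2 * j k + 1) / N, ?_, hform⟩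
  refine mem_cube_of_abs_scaled_le hN hj fun k => ?_
  have h := hform (WithLp.toLp 2 fun k => -1 + (2 * j k + 1) / N) k
  rw [show (WithLp.toLp 2 fun k => -1 + (2 * (j k : ℝ) + 1) / N : Cov d) k =
    -1 + (2 * j k + 1) / N from rfl, sub_self, eq_comm, div_eq_zero_iff] at h
  rcases h with h | h
  · rw [h]; simp
  · exact absurd h hN'.ne'

/-- All summands are positive, so each is at most `exp (-1)`. In particular no window is empty,
which the fit requires. -/
theorem one_le_of_criterion_le {d n m N : ℕ} {δ β : ℝ} {w : Fin n → Cov d × Bool}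
    (h : criterion m δ β N w ≤ Real.exp (-1)) (j : Fin d → Fin N) (α : Fin d → Fin m) :
    1 ≤ (treatedNear δ N (fun k => j k) α w).card * (N : ℝ) ^ (-(2 * β)) := by
  have h1 := Finset.single_le_sum (f := fun α : Fin d → Fin m =>
    Real.exp (-((treatedNear δ N (fun k => j k) α w).card * (N : ℝ) ^ (-(2 * β)))))
    (fun _ _ => (Real.exp_pos _).le) (Finset.mem_univ α)
  have h2 := Finset.single_le_sum (f := fun j : Fin d → Fin N => ∑ α : Fin d → Fin m,
    Real.exp (-((treatedNear δ N (fun k => j k) α w).card * (N : ℝ) ^ (-(2 * β)))))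
    (fun _ _ => Finset.sum_nonneg fun _ _ => (Real.exp_pos _).le) (Finset.mem_univ j)
  have h3 := Real.exp_le_exp.mp ((h1.trans h2).trans h)
  linarith

/-- The bias is the Taylor error at scale `1 / N`, propagated by the stable fit; the noise enters
through its window averages only. No probability is involved. -/
theorem exists_fit_error_bound (d : ℕ) {β : ℝ} (hβ : 0 < β) :
    ∃ δ > (0 : ℝ), δ ≤ 1 / (2 * (strictFloor β + 1 : ℕ)) ∧ ∃ K > (0 : ℝ),
      ∀ (n : ℕ) (L : ℝ), 0 ≤ L → ∀ f ∈ HolderClass d β L, ∀ (ω : Fin n → Obs d) (N : ℕ) (T : ℝ),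
        level (strictFloor β + 1) δ β (fun i => (ω i).1) = N → 0 < N →
        (∀ (j : Fin d → Fin N) (α : Fin d → Fin (strictFloor β + 1)),
          |avg (treatedNear δ N (fun k => j k) α fun i => (ω i).1)
            (fun i => (ω i).2 - f (ω i).1.1)| ≤ T) →
        ∀ x ∈ cube d, |piecewiseFit (strictFloor β + 1) δ β ω x - f x| ≤
          K * (L * (N : ℝ) ^ (-β) + T) := by
  classical
  obtain ⟨δ, hδ, hδm, K, hK, hfit⟩ := exists_stable_fit d (Nat.succ_pos (strictFloor β))
  set C : ℝ := (d : ℝ) ^ strictFloor β * (d : ℝ) ^ (β - strictFloor β) with hC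
  have hC0 : 0 ≤ C := by positivity
  refine ⟨δ, hδ, hδm, C + K * (C + 1), by positivity, ?_⟩
  intro n L hL f hf ω N T hlev hN hT x hx
  have hN' : (0 : ℝ) < N := by exact_mod_cast hN
  have hcrit : criterion (strictFloor β + 1) δ β N (fun i => (ω i).1) ≤ Real.exp (-1) := by
    have := Nat.findGreatest_of_ne_zero (P := fun N => 0 < N ∧
      criterion (strictFloor β + 1) δ β N (fun i => (ω i).1) ≤ Real.exp (-1)) hlev hN.ne'
    exact this.2
  let j : Fin d → Fin N := fun k => ⟨cellIndex N x k, cellIndex_lt hN x k⟩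
  obtain ⟨a, ha, hscale⟩ := scaled_zero_center hN (fun k => cellIndex_lt hN x k)
  obtain ⟨θ, hθ⟩ := exists_monom_approx hβ hL hf ha (h := (N : ℝ)⁻¹) (by positivity)
  have happ : ∀ y ∈ cube d, (∀ k, |scaled N (cellIndex N x) y k| ≤ 1) →
      |f y - ∑ κ, θ κ * monom κ (scaled N (cellIndex N x) y)| ≤ C * L * (N : ℝ) ^ (-β) := by
    intro y hy hyk
    have h1 := hθ y hy fun k => by
      rw [hscale, abs_div, abs_of_pos hN', div_eq_mul_inv]
      exact mul_le_of_le_one_left (by positivity) (hyk k)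
    have h2 : (fun k => (y k - a k) / (N : ℝ)⁻¹) = scaled N (cellIndex N x) y := by
      funext k
      rw [hscale]; field_simp
    rw [h2, Real.inv_rpow hN'.le, ← Real.rpow_neg hN'.le] at h1
    exact h1
  have hxs := fun k => abs_scaled_cellIndex_le hN hx k
  have hnear : ∀ (α : Fin d → Fin (strictFloor β + 1)),
      ∀ i ∈ treatedNear δ N (cellIndex N x) α (fun i => (ω i).1),
      ∀ k, |scaled N (cellIndex N x) (ω i).1.1 k - node _ (α k)| ≤ δ := fun α i hi => by
    simp only [treatedNear, Finset.mem_filter] at hi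
    exact hi.2.2
  have hmain := hfit (fun α => treatedNear δ N (cellIndex N x) α fun i => (ω i).1)
    (fun i => scaled N (cellIndex N x) (ω i).1.1) (fun i => (ω i).2)
    (fun i => (ω i).2 - f (ω i).1.1) θ (C * L * (N : ℝ) ^ (-β)) T
    (fun α => by
      rw [← Finset.card_pos]
      have h := one_le_of_criterion_le hcrit j α
      by_contra h0
      have h0' : (treatedNear δ N (fun k => (j k : ℕ)) α fun i => (ω i).1).card = 0 := by
        have : (fun k => (j k : ℕ)) = cellIndex N x := rfl
        rw [this]; omega
      rw [h0'] at h
      norm_num at h)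
    hnear
    (fun α i hi => by
      rw [sub_sub_cancel]
      have hk := fun k => abs_le_one_of_near hδm (hnear α i hi k)
      exact happ _ (mem_cube_of_abs_scaled_le hN (fun k => cellIndex_lt hN x k) hk) hk)
    (fun α => hT j α) (scaled N (cellIndex N x) x) hxs
  have hfx := happ x hx hxs
  have hpw : piecewiseFit (strictFloor β + 1) δ β ω x =
      ∑ κ : Fin d → Fin (strictFloor β + 1), localFit (fun α => treatedNear δ N (cellIndex N x) α fun i => (ω i).1)
      (fun i => scaled N (cellIndex N x) (ω i).1.1) (fun i => (ω i).2) κ *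
      monom κ (scaled N (cellIndex N x) x) := by
    rw [piecewiseFit, hlev, cellFit]
  rw [hpw]
  -- The cell containing `x` and the node at the origin supply a window whose average is bounded by
  -- `T`.
  have hT0 : 0 ≤ T := (abs_nonneg _).trans (hT j fun _ => 0)
  have hA : 0 ≤ L * (N : ℝ) ^ (-β) := by positivity
  calc _ ≤ K * (C * L * (N : ℝ) ^ (-β) + T) + C * L * (N : ℝ) ^ (-β) := by
        refine (abs_sub_le _ (∑ κ, θ κ * monom κ (scaled N (cellIndex N x) x)) _).trans
          (add_le_add hmain ?_)
        rwa [abs_sub_comm]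
    _ ≤ _ := by
        have : (C + K * (C + 1)) * (L * (N : ℝ) ^ (-β) + T) =
          K * (C * L * (N : ℝ) ^ (-β) + T) + C * L * (N : ℝ) ^ (-β) +
            (C * T + K * (C * T + L * (N : ℝ) ^ (-β))) := by ring
        rw [this]
        have : 0 ≤ C * T + K * (C * T + L * (N : ℝ) ^ (-β)) := by positivity
        linarith

/-! ### Laplace transform of the propensity -/

theorem summable_exp_mul_rpow (g : ℝ) :
    Summable fun k : ℕ => Real.exp (-k) * ((k : ℝ) + 1) ^ g := by
  have h := (summable_nat_add_iff 1).mpr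
    (Real.summable_pow_mul_exp_neg_nat_mul ⌈g⌉₊ (zero_lt_one' ℝ))
  refine Summable.of_nonneg_of_le (fun k => by positivity) (fun k => ?_) (h.mul_left (Real.exp 1))
  have h1 : ((k : ℝ) + 1) ^ g ≤ ((k : ℝ) + 1) ^ ⌈g⌉₊ := by
    rw [← Real.rpow_natCast]
    exact Real.rpow_le_rpow_of_exponent_le (by linarith [Nat.cast_nonneg (α := ℝ) k])
      (Nat.le_ceil g)
  calc Real.exp (-k) * ((k : ℝ) + 1) ^ g ≤ Real.exp (-k) * ((k : ℝ) + 1) ^ ⌈g⌉₊ := by gcongr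
    _ = Real.exp 1 * (((k : ℝ) + 1) ^ ⌈g⌉₊ * Real.exp (-1 * ((k : ℝ) + 1))) := by
        have : Real.exp (-(k : ℝ)) = Real.exp 1 * Real.exp (-1 * ((k : ℝ) + 1)) := by
          rw [← Real.exp_add]; congr 1; ring
        rw [this]; ring
    _ = _ := by push_cast; rfl

/-- A polynomial lower tail of `e` gives polynomial decay of its Laplace transform. -/
theorem exists_laplace_bound (C : ℝ) {g : ℝ} (hg : 0 < g) :
    ∃ C' > (0 : ℝ), ∀ {Ω : Type} [MeasurableSpace Ω] (μ : Measure Ω) [IsProbabilityMeasure μ]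
      (e : Ω → ℝ), Measurable e → (∀ x, e x ∈ Set.Icc (0 : ℝ) 1) →
      (∀ π ∈ Set.Icc (0 : ℝ) 1, μ.real {x | e x ≤ π} ≤ C * π ^ g) →
      ∀ b > (0 : ℝ), ∫⁻ x, ENNReal.ofReal (Real.exp (-(b * e x))) ∂μ ≤
        ENNReal.ofReal (C' * b ^ (-g)) := by
  set S : ℝ := ∑' k : ℕ, Real.exp (-k) * ((k : ℝ) + 1) ^ g with hS
  have hsum := summable_exp_mul_rpow g
  have hS0 : 0 ≤ S := tsum_nonneg fun k => by positivity
  refine ⟨|C| * S + 1, by positivity, ?_⟩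
  intro Ω _ μ _ e he h01 htail b hb
  -- Taking `π = 1` forces `1 ≤ C`, which makes the tail bound valid, trivially, for `π > 1` as
  -- well.
  have hC : 1 ≤ C := by
    have h := htail 1 (by simp)
    have h1 : {x | e x ≤ 1} = Set.univ := Set.eq_univ_of_forall fun x => (h01 x).2
    rw [h1] at h
    simpa using h
  have htail' : ∀ π : ℝ, 0 ≤ π → μ {x | e x ≤ π} ≤ ENNReal.ofReal (C * π ^ g) := by
    intro π hπ
    rw [← ofReal_measureReal]
    refine ENNReal.ofReal_le_ofReal ?_
    rcases le_total π 1 with h | h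
    · exact htail π ⟨hπ, h⟩
    · exact measureReal_le_one.trans (by nlinarith [Real.one_le_rpow h hg.le])
  -- Layering by `k = ⌊b * e x⌋₊`: the single term with this `k` already dominates the left side.
  have hpt : ∀ x, ENNReal.ofReal (Real.exp (-(b * e x))) ≤
      ∑' k : ℕ, ENNReal.ofReal (Real.exp (-k)) *
        Set.indicator {x | e x ≤ ((k : ℝ) + 1) / b} 1 x := by
    intro x
    have hbe : 0 ≤ b * e x := mul_nonneg hb.le (h01 x).1
    have hmem : e x ≤ ((⌊b * e x⌋₊ : ℝ) + 1) / b := by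
      rw [le_div_iff₀ hb, mul_comm]
      exact (Nat.lt_floor_add_one _).le
    have hind : Set.indicator {y | e y ≤ ((⌊b * e x⌋₊ : ℝ) + 1) / b} (1 : Ω → ℝ≥0∞) x = 1 :=
      Set.indicator_of_mem (s := {y | e y ≤ ((⌊b * e x⌋₊ : ℝ) + 1) / b}) hmem 1
    calc ENNReal.ofReal (Real.exp (-(b * e x)))
        ≤ ENNReal.ofReal (Real.exp (-(⌊b * e x⌋₊ : ℝ))) *
          Set.indicator {y | e y ≤ ((⌊b * e x⌋₊ : ℝ) + 1) / b} 1 x := by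
          rw [hind, mul_one]
          exact ENNReal.ofReal_le_ofReal (Real.exp_le_exp.mpr (neg_le_neg (Nat.floor_le hbe)))
      _ ≤ _ := ENNReal.le_tsum (f := fun k : ℕ => ENNReal.ofReal (Real.exp (-k)) *
          Set.indicator {x | e x ≤ ((k : ℝ) + 1) / b} 1 x) _
  calc ∫⁻ x, ENNReal.ofReal (Real.exp (-(b * e x))) ∂μ
      ≤ ∫⁻ x, ∑' k : ℕ, ENNReal.ofReal (Real.exp (-k)) *
        Set.indicator {x | e x ≤ ((k : ℝ) + 1) / b} 1 x ∂μ := lintegral_mono hpt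
    _ = ∑' k : ℕ, ENNReal.ofReal (Real.exp (-k)) * μ {x | e x ≤ ((k : ℝ) + 1) / b} := by
        have hms : ∀ k : ℕ, MeasurableSet {x | e x ≤ ((k : ℝ) + 1) / b} := fun k =>
          measurableSet_le he measurable_const
        rw [lintegral_tsum fun k => ((measurable_one.indicator (hms k)).const_mul _).aemeasurable]
        refine tsum_congr fun k => ?_
        rw [lintegral_const_mul _ (measurable_one.indicator (hms k)), lintegral_indicator_one (hms k)]
    _ ≤ ∑' k : ℕ, ENNReal.ofReal (C * b ^ (-g) * (Real.exp (-k) * ((k : ℝ) + 1) ^ g)) := by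
        refine ENNReal.tsum_le_tsum fun k => ?_
        refine (mul_le_mul_right (htail' (((k : ℝ) + 1) / b) (by positivity)) _).trans_eq ?_
        rw [← ENNReal.ofReal_mul (by positivity), Real.div_rpow (by positivity) hb.le,
          Real.rpow_neg hb.le]
        congr 1
        field_simp
    _ = ENNReal.ofReal (C * b ^ (-g) * S) := by
        rw [← ENNReal.ofReal_tsum_of_nonneg (fun k => by positivity) (hsum.mul_left _),
          tsum_mul_left]
    _ ≤ _ := by
        refine ENNReal.ofReal_le_ofReal ?_
        have h1 : 0 < b ^ (-g) := Real.rpow_pos_of_pos hb _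
        have h2 := le_abs_self C
        have : C * S ≤ |C| * S + 1 := by nlinarith
        calc C * b ^ (-g) * S = (C * S) * b ^ (-g) := by ring
          _ ≤ _ := by gcongr

/-! ### Window counts and the expected criterion -/

theorem unifCube_box {d : ℕ} {l u : Fin d → ℝ} (hl : ∀ i, -1 ≤ l i) (hu : ∀ i, u i ≤ 1) :
    unifCube d {x | ∀ i, x i ∈ Set.Icc (l i) (u i)} = ∏ i, ENNReal.ofReal ((u i - l i) / 2) := by
  set B : Set (Cov d) := {x | ∀ i, x i ∈ Set.Icc (l i) (u i)}
  have hB : B = (MeasurableEquiv.toLp 2 (Fin d → ℝ)).symm ⁻¹'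
      (Set.univ.pi fun i => Set.Icc (l i) (u i)) := by
    ext x; simp [B, Pi.le_def, forall_and]
  have hvol : volume B = ∏ i, ENNReal.ofReal (u i - l i) := by
    rw [hB, (EuclideanSpace.volume_preserving_symm_measurableEquiv_toLp (Fin d)).measure_preimage
      (MeasurableSet.univ_pi fun _ => measurableSet_Icc).nullMeasurableSet, volume_pi_pi]
    simp [Real.volume_Icc]
  have hsub : B ⊆ cube d := fun x hx i => ⟨(hl i).trans (hx i).1, (hx i).2.trans (hu i)⟩
  rw [unifCube, cond_apply (measurableSet_cube d), Set.inter_eq_self_of_subset_right hsub, hvol,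
    volume_cube, mul_comm, ← div_eq_mul_inv]
  have h2 : ∀ i, ENNReal.ofReal ((u i - l i) / 2) = ENNReal.ofReal (u i - l i) * 2⁻¹ := fun i => by
    rw [div_eq_mul_inv, ENNReal.ofReal_mul' (by norm_num), ENNReal.ofReal_inv_of_pos (by norm_num)]
    simp
  simp only [h2, Finset.prod_mul_distrib, Finset.prod_const, Finset.card_univ, Fintype.card_fin]
  rw [div_eq_mul_inv, ENNReal.inv_pow]

/-- The region of the cube near the node `α` of the cell `j`. -/
def nearRegion {d m : ℕ} (δ : ℝ) (N : ℕ) (j : Fin d → ℕ) (α : Fin d → Fin m) : Set (Cov d) :=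
  {x | ∀ k, |scaled N j x k - node m (α k)| ≤ δ}

theorem measurableSet_nearRegion {d m : ℕ} (δ : ℝ) (N : ℕ) (j : Fin d → ℕ) (α : Fin d → Fin m) :
    MeasurableSet (nearRegion δ N j α) := measurableSet_near δ N j α

theorem unifCube_nearRegion {d m : ℕ} {δ : ℝ} (hδ : 0 < δ) (hδm : δ ≤ 1 / (2 * m)) {N : ℕ}
    (hN : 0 < N) {j : Fin d → ℕ} (hj : ∀ k, j k < N) (α : Fin d → Fin m) :
    (unifCube d).real (nearRegion δ N j α) = (δ / N) ^ d := by
  have hN' : (0 : ℝ) < N := by exact_mod_cast hN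
  have hset : nearRegion δ N j α = {x : Cov d | ∀ i, x i ∈ Set.Icc
      (-1 + (2 * j i + 1 + node m (α i) - δ) / N) (-1 + (2 * j i + 1 + node m (α i) + δ) / N)} := by
    ext x
    refine forall_congr' fun k => ?_
    unfold scaled
    have e1 : -1 + (2 * (j k : ℝ) + 1 + node m (α k) - δ) / N ≤ x k ↔
        2 * j k + 1 + node m (α k) - δ ≤ N * (x k + 1) := by
      rw [← le_sub_iff_add_le', div_le_iff₀ hN']
      constructor <;> intro h <;> linarith
    have e2 : x k ≤ -1 + (2 * (j k : ℝ) + 1 + node m (α k) + δ) / N ↔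
        N * (x k + 1) ≤ 2 * j k + 1 + node m (α k) + δ := by
      rw [← sub_le_iff_le_add', le_div_iff₀ hN']
      constructor <;> intro h <;> linarith
    rw [Set.mem_Icc, e1, e2, abs_le]
    constructor <;> rintro ⟨h1, h2⟩ <;> constructor <;> linarith
  have hle : ∀ k, |node m (α k) - δ| ≤ 1 ∧ |node m (α k) + δ| ≤ 1 := fun k =>
    ⟨abs_le_one_of_near hδm (r := α k) (by simp [abs_of_pos hδ]),
      abs_le_one_of_near hδm (r := α k) (by simp [abs_of_pos hδ])⟩
  rw [hset, measureReal_def, unifCube_box]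
  · have : ∀ i : Fin d, ((-1 + (2 * (j i : ℝ) + 1 + node m (α i) + δ) / N) -
        (-1 + (2 * j i + 1 + node m (α i) - δ) / N)) / 2 = δ / N := fun i => by
      field_simp; ring
    simp only [this, Finset.prod_const, Finset.card_univ, Fintype.card_fin]
    rw [ENNReal.toReal_pow, ENNReal.toReal_ofReal (by positivity)]
  · intro k
    have h1 := (abs_le.mp (hle k).1).1
    have : (0 : ℝ) ≤ (2 * j k + 1 + node m (α k) - δ) / N :=
      div_nonneg (by linarith [Nat.cast_nonneg (α := ℝ) (j k)]) hN'.le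
    linarith
  · intro k
    have h1 := (abs_le.mp (hle k).2).2
    have h2 : (j k : ℝ) + 1 ≤ N := by exact_mod_cast hj k
    have : (2 * (j k : ℝ) + 1 + node m (α k) + δ) / N ≤ 2 := by
      rw [div_le_iff₀ hN']; linarith
    linarith

/-- In scaled coordinates distinct cells are offset by at least 2 along some axis, more than the
width `2δ` of a window. Disjointness lets integrals over the windows of one node be added up to an
integral over the cube. -/
theorem disjoint_nearRegion {d m : ℕ} {δ : ℝ} (hδ : δ < 1) (N : ℕ) {j j' : Fin d → ℕ}
    (hj : j ≠ j') (α : Fin d → Fin m) :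
    Disjoint (nearRegion δ N j α) (nearRegion δ N j' α) := by
  refine Set.disjoint_left.mpr fun x hx hx' => ?_
  obtain ⟨k, hk⟩ := Function.ne_iff.mp hj
  obtain ⟨h1, h2⟩ := abs_le.mp (hx k)
  obtain ⟨h3, h4⟩ := abs_le.mp (hx' k)
  unfold scaled at h1 h2 h3 h4
  rcases Nat.lt_or_gt_of_ne hk with h | h
  · have : (j k : ℝ) + 1 ≤ j' k := by exact_mod_cast h
    linarith
  · have : (j' k : ℝ) + 1 ≤ j k := by exact_mod_cast h
    linarith

/-- Jensen's inequality for `t ↦ exp (-t)` on a set of positive measure. -/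
theorem exp_neg_setIntegral_le {Ω : Type*} [MeasurableSpace Ω] (μ : Measure Ω)
    [IsProbabilityMeasure μ] {e : Ω → ℝ} (he : Measurable e) (h01 : ∀ x, e x ∈ Set.Icc (0 : ℝ) 1)
    (A : Set Ω) (hv : 0 < μ.real A) {a : ℝ} (ha : 0 ≤ a) :
    Real.exp (-(a * ∫ x in A, e x ∂μ)) ≤
      (μ.real A)⁻¹ * ∫ x in A, Real.exp (-(a * μ.real A * e x)) ∂μ := by
  set v := μ.real A
  set y := a * ∫ x in A, e x ∂μ with hy
  have hint : Integrable e (μ.restrict A) := by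
    refine Integrable.of_bound he.aestronglyMeasurable 1 (.of_forall fun x => ?_)
    rw [Real.norm_eq_abs, abs_of_nonneg (h01 x).1]; exact (h01 x).2
  have hint2 : Integrable (fun x => Real.exp (-(a * v * e x))) (μ.restrict A) := by
    refine Integrable.of_bound (by fun_prop) 1 (.of_forall fun x => ?_)
    rw [Real.norm_eq_abs, abs_of_pos (Real.exp_pos _), Real.exp_le_one_iff]
    have := (h01 x).1
    have : 0 ≤ a * v * e x := by positivity
    linarith
  -- The tangent line to `exp (-·)` at `y`, which is the mean of `a * v * e` over `A`.
  have hpt : ∀ x, Real.exp (-y) * (1 + y) - Real.exp (-y) * (a * v) * e x ≤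
      Real.exp (-(a * v * e x)) := fun x => by
    have h := Real.add_one_le_exp (y - a * v * e x)
    have h2 : Real.exp (-(a * v * e x)) = Real.exp (-y) * Real.exp (y - a * v * e x) := by
      rw [← Real.exp_add]; congr 1; ring
    rw [h2]
    have := mul_le_mul_of_nonneg_left h (Real.exp_pos (-y)).le
    linarith
  have h1 := integral_mono ((integrable_const (Real.exp (-y) * (1 + y))).sub
    (hint.const_mul (Real.exp (-y) * (a * v)))) hint2 hpt
  have hc : ∫ x in A, Real.exp (-y) * (a * v) * e x ∂μ = Real.exp (-y) * v * y := by
    rw [integral_const_mul, hy]; ring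
  rw [integral_sub' (integrable_const _) (hint.const_mul _), hc, integral_const,
    measureReal_restrict_apply_univ, smul_eq_mul] at h1
  rw [le_inv_mul_iff₀ hv]
  refine le_trans (le_of_eq ?_) h1
  change v * Real.exp (-y) = v * (Real.exp (-y) * (1 + y)) - _
  ring

theorem one_sub_exp_neg_ge {t : ℝ} (h0 : 0 ≤ t) (h1 : t ≤ 1) : t / 2 ≤ 1 - Real.exp (-t) := by
  have h2 : Real.exp (-t) * (1 + t) ≤ 1 := by
    have h := mul_le_mul_of_nonneg_left (Real.add_one_le_exp t) (Real.exp_pos (-t)).le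
    rw [← Real.exp_add, neg_add_cancel, Real.exp_zero] at h
    linarith
  nlinarith [Real.exp_pos (-t)]

/-- The count is a sum of independent indicators with success probability the integral of `e` over
the window, so its exponential moment is at most `exp (-n (t/2) ∫ e)`. Jensen then moves the spatial
average outside the exponential, leaving a quantity that sees only the distribution of `e(X)`, not
its arrangement in space. -/
theorem lintegral_exp_card_le {d m n : ℕ} (P : Model d) {δ : ℝ} {N : ℕ} {j : Fin d → ℕ}
    {α : Fin d → Fin m} (hv : 0 < (unifCube d).real (nearRegion δ N j α)) {t : ℝ} (h0 : 0 ≤ t)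
    (h1 : t ≤ 1) :
    ∫⁻ w, ENNReal.ofReal (Real.exp (-((treatedNear δ N j α w).card * t)))
        ∂(Measure.pi fun _ : Fin n => P.design) ≤
      ENNReal.ofReal (((unifCube d).real (nearRegion δ N j α))⁻¹ * ∫ x in nearRegion δ N j α,
        Real.exp (-(n * (t / 2) * (unifCube d).real (nearRegion δ N j α) * P.e x)) ∂(unifCube d)) := by
  set A := nearRegion δ N j α with hA
  have hAm : MeasurableSet A := measurableSet_near δ N j α
  have he : Measurable fun x => (P.e x : ℝ) := measurable_subtype_coe.comp P.measurable_e
  set B : Set (Cov d × Bool) := {w | w.2 = true ∧ w.1 ∈ A} with hB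
  have hBm : MeasurableSet B :=
    (measurable_snd (measurableSet_singleton true)).inter (measurable_fst hAm)
  set f : Cov d × Bool → ℝ≥0∞ := fun w =>
    ENNReal.ofReal (Real.exp (-(B.indicator (fun _ => (1 : ℝ)) w * t))) with hf
  have hfm : Measurable f :=
    (((measurable_const.indicator hBm).mul_const t).neg.exp).ennreal_ofReal
  have hprod : ∀ w : Fin n → Cov d × Bool,
      ENNReal.ofReal (Real.exp (-((treatedNear δ N j α w).card * t))) = ∏ i, f (w i) := by
    intro w
    rw [card_treatedNear, Finset.sum_mul, ← Finset.sum_neg_distrib, Real.exp_sum,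
      ENNReal.ofReal_prod_of_nonneg fun i _ => (Real.exp_pos _).le]
    rfl
  have hone : ∫⁻ w, f w ∂P.design ≤
      ENNReal.ofReal (Real.exp (-(t / 2 * ∫ x in A, (P.e x : ℝ) ∂(unifCube d)))) := by
    rw [lintegral_design P hfm]
    have hint : Integrable (A.indicator fun x => (P.e x : ℝ)) (unifCube d) := by
      refine (Integrable.of_bound he.aestronglyMeasurable 1 (.of_forall fun x => ?_)).indicator hAm
      rw [Real.norm_eq_abs, abs_of_nonneg (P.e x).2.1]; exact (P.e x).2.2
    have hpt : ∀ x, ENNReal.ofReal (P.e x) * f (x, true) +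
        ENNReal.ofReal (1 - P.e x) * f (x, false) ≤
        ENNReal.ofReal (1 - t / 2 * A.indicator (fun x => (P.e x : ℝ)) x) := by
      intro x
      have hff : f (x, false) = 1 := by simp [hf, hB]
      have he0 := (P.e x).2.1
      have he1 := (P.e x).2.2
      rw [hff, mul_one]
      by_cases hx : x ∈ A
      · have hft : f (x, true) = ENNReal.ofReal (Real.exp (-t)) := by simp [hf, hB, hx]
        rw [hft, ← ENNReal.ofReal_mul he0, ← ENNReal.ofReal_add
          (mul_nonneg he0 (Real.exp_pos _).le) (by linarith), Set.indicator_of_mem hx]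
        refine ENNReal.ofReal_le_ofReal ?_
        nlinarith [mul_le_mul_of_nonneg_left (one_sub_exp_neg_ge h0 h1) he0]
      · have hft : f (x, true) = 1 := by simp [hf, hB, hx]
        rw [hft, mul_one, ← ENNReal.ofReal_add he0 (by linarith), Set.indicator_of_notMem hx]
        simp
    refine (lintegral_mono hpt).trans ?_
    have hint' : Integrable (fun x => 1 - t / 2 * A.indicator (fun x => (P.e x : ℝ)) x)
      (unifCube d) := (integrable_const _).sub (hint.const_mul _)
    rw [← ofReal_integral_eq_lintegral_ofReal hint' (.of_forall fun x => ?_)]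
    · refine ENNReal.ofReal_le_ofReal ?_
      rw [integral_sub (integrable_const _) (hint.const_mul _), integral_const_mul,
        integral_indicator hAm]
      have := Real.add_one_le_exp (-(t / 2 * ∫ x in A, (P.e x : ℝ) ∂(unifCube d)))
      simp only [integral_const, probReal_univ, smul_eq_mul, mul_one]
      linarith
    · change 0 ≤ 1 - t / 2 * A.indicator (fun x => (P.e x : ℝ)) x
      by_cases hx : x ∈ A
      · have he0 := (P.e x).2.1
        have he1 := (P.e x).2.2
        rw [Set.indicator_of_mem hx]
        nlinarith
      · rw [Set.indicator_of_notMem hx]; simp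
  simp only [hprod]
  rw [lintegral_pi_prod P.design fun _ => hfm, Finset.prod_const, Finset.card_univ,
    Fintype.card_fin]
  refine (pow_le_pow_left' hone n).trans ?_
  rw [← ENNReal.ofReal_pow (Real.exp_pos _).le, ← Real.exp_nat_mul]
  refine ENNReal.ofReal_le_ofReal ?_
  have := exp_neg_setIntegral_le (unifCube d) he (fun x => (P.e x).2) A hv
    (a := n * (t / 2)) (by positivity)
  refine le_trans (le_of_eq ?_) this
  congr 1; ring

/-- For a fixed node the windows of different cells are disjoint, so their integrals add up to at
most the Laplace transform over the cube. The sum over cells therefore costs only the inverse window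
volume `((δ / N) ^ d)⁻¹`. -/
theorem lintegral_criterion_le {d m n : ℕ} (P : Model d) {δ : ℝ} (hδ : 0 < δ)
    (hδm : δ ≤ 1 / (2 * m)) (hm : 0 < m) {N : ℕ} (hN : 0 < N) {β : ℝ} (hβ : 0 < β) {B : ℝ}
    (hB0 : 0 ≤ B)
    (hB : ∫⁻ x, ENNReal.ofReal (Real.exp (-(n * ((N : ℝ) ^ (-(2 * β)) / 2) * (δ / N) ^ d * P.e x)))
      ∂(unifCube d) ≤ ENNReal.ofReal B) :
    ∫⁻ w, ENNReal.ofReal (criterion m δ β N w) ∂(Measure.pi fun _ : Fin n => P.design) ≤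
      ENNReal.ofReal ((m : ℝ) ^ d * (((δ / N) ^ d)⁻¹ * B)) := by
  have hN' : (0 : ℝ) < N := by exact_mod_cast hN
  have ht0 : 0 ≤ (N : ℝ) ^ (-(2 * β)) := by positivity
  have ht1 : (N : ℝ) ^ (-(2 * β)) ≤ 1 :=
    Real.rpow_le_one_of_one_le_of_nonpos (by exact_mod_cast hN) (by linarith)
  have hv : 0 < (δ / N) ^ d := by positivity
  have hδ1 : δ < 1 := by
    have hm' : (1 : ℝ) ≤ m := by exact_mod_cast hm
    refine hδm.trans_lt ?_
    rw [div_lt_one (by positivity)]; linarith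
  have hvol : ∀ (j : Fin d → Fin N) (α : Fin d → Fin m),
      (unifCube d).real (nearRegion δ N (fun k => j k) α) = (δ / N) ^ d := fun j α =>
    unifCube_nearRegion hδ hδm hN (fun k => (j k).2) α
  set h : Cov d → ℝ := fun x =>
    Real.exp (-(n * ((N : ℝ) ^ (-(2 * β)) / 2) * (δ / N) ^ d * P.e x)) with hh
  have he : Measurable fun x => (P.e x : ℝ) := measurable_subtype_coe.comp P.measurable_e
  have hhm : Measurable h := (he.const_mul _).neg.exp
  have hint : Integrable h (unifCube d) := by
    refine Integrable.of_bound hhm.aestronglyMeasurable 1 (.of_forall fun x => ?_)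
    rw [Real.norm_eq_abs, abs_of_pos (Real.exp_pos _), Real.exp_le_one_iff]
    have := (P.e x).2.1
    have : 0 ≤ n * ((N : ℝ) ^ (-(2 * β)) / 2) * (δ / N) ^ d * P.e x := by positivity
    linarith
  have hIB : ∫ x, h x ∂(unifCube d) ≤ B := by
    rw [← ofReal_integral_eq_lintegral_ofReal hint (.of_forall fun x => (Real.exp_pos _).le)] at hB
    exact (ENNReal.ofReal_le_ofReal_iff hB0).mp hB
  have hterm : ∀ (j : Fin d → Fin N) (α : Fin d → Fin m),
      ∫⁻ w, ENNReal.ofReal (Real.exp (-((treatedNear δ N (fun k => j k) α w).card *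
        (N : ℝ) ^ (-(2 * β))))) ∂(Measure.pi fun _ : Fin n => P.design) ≤
      ENNReal.ofReal (((δ / N) ^ d)⁻¹ * ∫ x in nearRegion δ N (fun k => j k) α, h x
        ∂(unifCube d)) := fun j α => by
    have := lintegral_exp_card_le (n := n) P (δ := δ) (N := N) (j := fun k => j k) (α := α)
      (by rw [hvol]; exact hv) ht0 ht1
    rw [hvol] at this
    exact this
  have hmeas : ∀ (j : Fin d → Fin N) (α : Fin d → Fin m),
      Measurable fun w : Fin n → Cov d × Bool => ENNReal.ofReal (Real.exp
        (-((treatedNear δ N (fun k => j k) α w).card * (N : ℝ) ^ (-(2 * β))))) := fun j α =>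
    (((measurable_card fun i => measurableSet_mem_treatedNear δ N _ α i).mul_const _).neg.exp).ennreal_ofReal
  have hsplit : ∀ w : Fin n → Cov d × Bool, ENNReal.ofReal (criterion m δ β N w) =
      ∑ j : Fin d → Fin N, ∑ α : Fin d → Fin m, ENNReal.ofReal (Real.exp
        (-((treatedNear δ N (fun k => j k) α w).card * (N : ℝ) ^ (-(2 * β))))) := fun w => by
    rw [criterion, ENNReal.ofReal_sum_of_nonneg fun _ _ => Finset.sum_nonneg fun _ _ =>
      (Real.exp_pos _).le]
    exact Finset.sum_congr rfl fun j _ => ENNReal.ofReal_sum_of_nonneg fun _ _ => (Real.exp_pos _).le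
  simp only [hsplit]
  rw [lintegral_finsetSum _ fun j _ => Finset.measurable_sum _ fun α _ => hmeas j α]
  simp only [lintegral_finsetSum _ fun α _ => hmeas _ α]
  have hnn : ∀ (j : Fin d → Fin N) (α : Fin d → Fin m),
      0 ≤ ∫ x in nearRegion δ N (fun k => j k) α, h x ∂(unifCube d) := fun j α =>
    integral_nonneg fun x => (Real.exp_pos _).le
  have hα : ∀ α : Fin d → Fin m, ∑ j : Fin d → Fin N,
      ∫ x in nearRegion δ N (fun k => j k) α, h x ∂(unifCube d) ≤ B := fun α => by
    rw [← integral_iUnion_fintype (fun j => measurableSet_nearRegion δ N _ α)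
      (fun j j' hjj => disjoint_nearRegion hδ1 N (fun hc => hjj (funext fun k =>
        Fin.ext (congrFun hc k))) α) fun j => hint.integrableOn]
    exact (setIntegral_le_integral hint (.of_forall fun x => (Real.exp_pos _).le)).trans hIB
  calc _ ≤ ∑ j : Fin d → Fin N, ∑ α : Fin d → Fin m, ENNReal.ofReal (((δ / N) ^ d)⁻¹ *
        ∫ x in nearRegion δ N (fun k => j k) α, h x ∂(unifCube d)) :=
        Finset.sum_le_sum fun j _ => Finset.sum_le_sum fun α _ => hterm j α
    _ = ENNReal.ofReal (∑ α : Fin d → Fin m, ((δ / N) ^ d)⁻¹ * ∑ j : Fin d → Fin N,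
        ∫ x in nearRegion δ N (fun k => j k) α, h x ∂(unifCube d)) := by
        rw [Finset.sum_comm, ENNReal.ofReal_sum_of_nonneg fun α _ =>
          mul_nonneg (by positivity) (Finset.sum_nonneg fun j _ => hnn j α)]
        refine Finset.sum_congr rfl fun α _ => ?_
        rw [Finset.mul_sum, ENNReal.ofReal_sum_of_nonneg fun j _ =>
          mul_nonneg (by positivity) (hnn j α)]
    _ ≤ _ := by
        refine ENNReal.ofReal_le_ofReal ((Finset.sum_le_sum (g := fun _ => ((δ / N) ^ d)⁻¹ * B)
          fun α _ => ?_).trans_eq (by simp))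
        gcongr
        exact hα α

/-- Markov's inequality at the threshold `exp (-1)`. Since the level is the largest admissible `N`,
success at one `N` suffices, with no monotonicity of the criterion. -/
theorem measure_level_lt_le {d m n : ℕ} (P : Model d) {δ β : ℝ} {N : ℕ} (hN : 0 < N) (hn : N ≤ n)
    {B : ℝ} (hB : ∫⁻ w, ENNReal.ofReal (criterion m δ β N w)
      ∂(Measure.pi fun _ : Fin n => P.design) ≤ ENNReal.ofReal B) :
    (Measure.pi fun _ : Fin n => P.design) {w | level m δ β w < N} ≤
      ENNReal.ofReal (Real.exp 1 * B) := by
  classical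
  have hsub : {w : Fin n → Cov d × Bool | level m δ β w < N} ⊆
      {w | ENNReal.ofReal (Real.exp (-1)) ≤ ENNReal.ofReal (criterion m δ β N w)} := by
    intro w hw
    have hw' : level m δ β w < N := hw
    refine ENNReal.ofReal_le_ofReal (?_ : Real.exp (-1) ≤ criterion m δ β N w)
    by_contra hc
    push Not at hc
    have : N ≤ level m δ β w := by
      unfold level
      exact Nat.le_findGreatest hn ⟨hN, hc.le⟩
    omega
  refine (measure_mono hsub).trans ?_
  have h := mul_meas_ge_le_lintegral (μ := Measure.pi fun _ : Fin n => P.design)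
    (measurable_criterion (n := n) (d := d) m δ β N).ennreal_ofReal (ENNReal.ofReal (Real.exp (-1)))
  have h2 : ENNReal.ofReal (Real.exp 1) * ENNReal.ofReal (Real.exp (-1)) = 1 := by
    rw [← ENNReal.ofReal_mul (Real.exp_pos _).le, ← Real.exp_add]; simp
  rw [ENNReal.ofReal_mul (Real.exp_pos _).le]
  refine le_trans ?_ (mul_le_mul_right (h.trans hB) (ENNReal.ofReal (Real.exp 1)))
  rw [← mul_assoc, h2, one_mul]

/-! ### Noise at the selected level -/

/-- Write `x ≥ 1` for a window count times `N ^ (-2β)`. As `(c²/2 - 1)(x - 1) ≥ 0`, the Gaussian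
exponent satisfies `c² x / 2 ≥ x + c²/2 - 1`. Hence the union bound sums `exp (-x)`, that is, the
criterion, times a factor depending on `c` alone. -/
theorem gaussian_noise_bound {d m n : ℕ} {δ β : ℝ} {w : Fin n → Cov d × Bool} {N : ℕ}
    (hN : 0 < N) (hcrit : criterion m δ β N w ≤ Real.exp (-1)) {c : ℝ} (hc : 2 ≤ c) :
    (Measure.pi fun _ : Fin n => gaussianReal 0 1)
      {z | ∃ (j : Fin d → Fin N) (α : Fin d → Fin m),
        c * (N : ℝ) ^ (-β) < |avg (treatedNear δ N (fun k => j k) α w) z|} ≤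
      ENNReal.ofReal (2 * Real.exp (-(c ^ 2 / 2))) := by
  have hN' : (0 : ℝ) < N := by exact_mod_cast hN
  set x : (Fin d → Fin N) → (Fin d → Fin m) → ℝ := fun j α =>
    (treatedNear δ N (fun k => j k) α w).card * (N : ℝ) ^ (-(2 * β)) with hx
  have hx1 : ∀ j α, 1 ≤ x j α := fun j α => one_le_of_criterion_le hcrit j α
  have hne : ∀ (j : Fin d → Fin N) (α : Fin d → Fin m),
      (treatedNear δ N (fun k => (j k : ℕ)) α w).Nonempty := fun j α => by
      rw [← Finset.card_pos]
      by_contra h0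
      have h0' : (treatedNear δ N (fun k => (j k : ℕ)) α w).card = 0 := by omega
      have := hx1 j α
      simp only [hx, h0'] at this
      norm_num at this
  have hsq : ((N : ℝ) ^ (-β)) ^ 2 = (N : ℝ) ^ (-(2 * β)) := by
    rw [← Real.rpow_natCast, ← Real.rpow_mul hN'.le]; congr 1; push_cast; ring
  have hone : ∀ (j : Fin d → Fin N) (α : Fin d → Fin m), (Measure.pi fun _ : Fin n => gaussianReal 0 1)
      {z | c * (N : ℝ) ^ (-β) < |avg (treatedNear δ N (fun k => (j k : ℕ)) α w) z|} ≤
      ENNReal.ofReal (2 * Real.exp (1 - c ^ 2 / 2) * Real.exp (-x j α)) := fun j α => by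
      refine (gaussian_avg_tail (hne j α) (by have : 0 ≤ c := by linarith
                                              positivity)).trans (ENNReal.ofReal_le_ofReal ?_)
      rw [mul_assoc, ← Real.exp_add]
      refine mul_le_mul_of_nonneg_left (Real.exp_le_exp.mpr ?_) (by norm_num)
      rw [mul_pow, hsq]
      have h1 : ((treatedNear δ N (fun k => (j k : ℕ)) α w).card : ℝ) *
          (c ^ 2 * (N : ℝ) ^ (-(2 * β))) = c ^ 2 * x j α := by simp only [hx]; ring
      rw [h1]
      nlinarith [hx1 j α, mul_nonneg (show 0 ≤ c ^ 2 / 2 - 1 by nlinarith)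
        (sub_nonneg.mpr (hx1 j α))]
  have hsub : {z : Fin n → ℝ | ∃ (j : Fin d → Fin N) (α : Fin d → Fin m),
        c * (N : ℝ) ^ (-β) < |avg (treatedNear δ N (fun k => j k) α w) z|} =
      ⋃ j : Fin d → Fin N, ⋃ α : Fin d → Fin m,
        {z | c * (N : ℝ) ^ (-β) < |avg (treatedNear δ N (fun k => j k) α w) z|} := by
    ext z; simp
  rw [hsub]
  refine (measure_iUnion_fintype_le _ _).trans ?_
  refine (Finset.sum_le_sum fun j _ => (measure_iUnion_fintype_le _ _).trans
    (Finset.sum_le_sum fun α _ => hone j α)).trans ?_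
  have : ∑ j, ∑ α, ENNReal.ofReal (2 * Real.exp (1 - c ^ 2 / 2) * Real.exp (-x j α)) =
      ENNReal.ofReal (2 * Real.exp (1 - c ^ 2 / 2) * criterion m δ β N w) := by
    rw [criterion, Finset.mul_sum, ENNReal.ofReal_sum_of_nonneg fun _ _ => by positivity]
    refine Finset.sum_congr rfl fun j _ => ?_
    rw [Finset.mul_sum, ENNReal.ofReal_sum_of_nonneg fun _ _ => by positivity]
  rw [this]
  refine ENNReal.ofReal_le_ofReal ?_
  calc 2 * Real.exp (1 - c ^ 2 / 2) * criterion m δ β N w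
      ≤ 2 * Real.exp (1 - c ^ 2 / 2) * Real.exp (-1) := by gcongr
    _ = _ := by rw [mul_assoc, ← Real.exp_add]; congr 2; ring

/-- The event that the selected level is below `N₀` or that some group average of the noise at the
selected level is atypically large. -/
def badEvent {d n : ℕ} (m : ℕ) (δ β t : ℝ) (N₀ : ℕ) (f : Cov d → ℝ) : Set (Fin n → Obs d) :=
  {ω | level m δ β (fun i => (ω i).1) < N₀} ∪
    ⋃ N : ℕ, {ω | level m δ β (fun i => (ω i).1) = N} ∩
      ⋃ (j : Fin d → Fin N) (α : Fin d → Fin m),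
        {ω | t * (N : ℝ) ^ (-β) < |avg (treatedNear δ N (fun k => j k) α fun i => (ω i).1)
          (fun i => (ω i).2 - f (ω i).1.1)|}

theorem measurableSet_badEvent {d n : ℕ} (m : ℕ) (δ β t : ℝ) (N₀ : ℕ) {f : Cov d → ℝ}
    (hf : Measurable f) : MeasurableSet (badEvent (n := n) m δ β t N₀ f) := by
  have hw : Measurable fun (ω : Fin n → Obs d) i => (ω i).1 :=
    measurable_pi_lambda _ fun i => measurable_fst.comp (measurable_pi_apply i)
  have hlev : Measurable fun ω : Fin n → Obs d => level m δ β fun i => (ω i).1 :=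
    (measurable_level m δ β).comp hw
  refine (hlev measurableSet_Iio).union (MeasurableSet.iUnion fun N =>
    (hlev (measurableSet_singleton N)).inter (MeasurableSet.iUnion fun j =>
      MeasurableSet.iUnion fun α => measurableSet_lt measurable_const (Measurable.abs ?_)))
  refine measurable_avg (I := fun ω : Fin n → Obs d =>
    treatedNear δ N (fun k => (j k : ℕ)) α fun i => (ω i).1)
    (fun i => hw (measurableSet_mem_treatedNear δ N _ α i)) fun i => ?_
  exact (measurable_snd.comp (measurable_pi_apply i)).sub
    (hf.comp (measurable_fst.comp (measurable_fst.comp (measurable_pi_apply i))))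

/-- Conditionally on the design the level is a constant and the noise is still independent Gaussian,
so the bound for a fixed level applies at the random one without a union over levels. -/
theorem sample_badEvent_le {d m n : ℕ} (P : Model d) {σ : ℝ} (hσ : 0 < σ) {δ β c : ℝ} (hc : 2 ≤ c)
    {N₀ : ℕ} (hN₀ : 0 < N₀) :
    P.sample σ n (badEvent m δ β (c * σ) N₀ P.mu) ≤
      (Measure.pi fun _ : Fin n => P.design) {w | level m δ β w < N₀} +
        ENNReal.ofReal (2 * Real.exp (-(c ^ 2 / 2))) := by
  classical
  rw [sample_apply P σ n (measurableSet_badEvent m δ β _ N₀ P.measurable_mu)]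
  have hlt : MeasurableSet {w : Fin n → Cov d × Bool | level m δ β w < N₀} :=
    measurable_level m δ β measurableSet_Iio
  calc _ ≤ ∫⁻ w, (Set.indicator {w : Fin n → Cov d × Bool | level m δ β w < N₀} 1 w +
        ENNReal.ofReal (2 * Real.exp (-(c ^ 2 / 2)))) ∂(Measure.pi fun _ : Fin n => P.design) := by
        refine lintegral_mono fun w => ?_
        by_cases hw : level m δ β w < N₀
        · rw [Set.indicator_of_mem (s := {w : Fin n → Cov d × Bool | level m δ β w < N₀}) hw]
          exact prob_le_one.trans le_self_add
        · rw [Set.indicator_of_notMem (s := {w : Fin n → Cov d × Bool | level m δ β w < N₀}) hw,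
            zero_add]
          have hpos : 0 < level m δ β w := by omega
          have hcrit : criterion m δ β (level m δ β w) w ≤ Real.exp (-1) :=
            (Nat.findGreatest_of_ne_zero (P := fun N => 0 < N ∧
              criterion m δ β N w ≤ Real.exp (-1)) rfl hpos.ne').2
          refine (measure_mono fun z hz => ?_).trans (gaussian_noise_bound hpos hcrit hc)
          rcases hz with hz | hz
          · exact absurd hz hw
          · simp only [Set.mem_iUnion, Set.mem_inter_iff] at hz
            obtain ⟨N, hN, j, α, hz⟩ := hz
            have hN' : level m δ β w = N := hN
            subst hN'
            refine ⟨j, α, ?_⟩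
            have hz' : c * σ * (level m δ β w : ℝ) ^ (-β) <
                |avg (treatedNear δ (level m δ β w) (fun k => (j k : ℕ)) α w)
                  (fun i => P.mean (w i) + σ * z i - P.mu (w i).1)| := hz
            have havg : avg (treatedNear δ (level m δ β w) (fun k => (j k : ℕ)) α w)
                (fun i => P.mean (w i) + σ * z i - P.mu (w i).1) =
                σ * avg (treatedNear δ (level m δ β w) (fun k => (j k : ℕ)) α w) z := by
              rw [avg, avg, ← mul_div_assoc, Finset.mul_sum]
              congr 1
              refine Finset.sum_congr rfl fun i hi => ?_
              have ht : (w i).2 = true := (Finset.mem_filter.mp hi).2.1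
              rw [Model.mean, if_pos ht]; ring
            rw [havg, abs_mul, abs_of_pos hσ] at hz'
            have : σ * (c * (level m δ β w : ℝ) ^ (-β)) <
                σ * |avg (treatedNear δ (level m δ β w) (fun k => (j k : ℕ)) α w) z| := by
              linarith
            exact lt_of_mul_lt_mul_left this hσ.le
    _ = _ := by
        rw [lintegral_add_left (measurable_one.indicator hlt), lintegral_indicator_one hlt]
        simp

/-! ### The rate and achievability -/

/-- This exhibits the rate as `N ^ (-β)` for `N = n ^ (1/s)` cells per axis, with `s = 2β + d +
d/(γ₀ - 1)`. -/
theorem rate_eq {d : ℕ} {β γ₀ : ℝ} (hβ : 0 < β) (hγ : 1 < γ₀) (n : ℕ) :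
    rate d β γ₀ n = ((n : ℝ) ^ (1 / (2 * β + d + d / (γ₀ - 1)))) ^ (-β) := by
  have hg : 0 < γ₀ - 1 := by linarith
  have hγ' : 0 < γ₀ := by linarith
  have hd : (0 : ℝ) ≤ d := Nat.cast_nonneg d
  rw [rate, ← Real.rpow_mul (Nat.cast_nonneg n)]
  congr 1
  have e1 : effSmoothness β γ₀ = β * (γ₀ - 1) / γ₀ := by unfold effSmoothness; field_simp
  have e2 : 2 * effSmoothness β γ₀ + d = (2 * β * (γ₀ - 1) + d * γ₀) / γ₀ := by
    rw [e1]; field_simp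
  have e3 : 2 * β + d + d / (γ₀ - 1) = (2 * β * (γ₀ - 1) + d * γ₀) / (γ₀ - 1) := by
    field_simp; ring
  have h4 : 0 < 2 * β * (γ₀ - 1) + d * γ₀ := by positivity
  rw [e2, e3, e1]
  field_simp

/-- The factor `y ^ d` from the number of cells is absorbed into the power `-g` as `y ^ (-d/g)`;
this produces the extra term `d/g` in the exponent. -/
theorem rpow_level_identity {d : ℕ} {β g x y : ℝ} (hg : 0 < g) (hx : 0 < x) (hy : 0 < y) :
    y ^ d * (x * y ^ (-(2 * β + d))) ^ (-g) = (x * y ^ (-(2 * β + d + d / g))) ^ (-g) := by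
  have h1 : x * y ^ (-(2 * β + d + d / g)) = x * y ^ (-(2 * β + d)) * y ^ (-(d / g)) := by
    rw [mul_assoc, ← Real.rpow_add hy]; congr 2; ring
  have h2 : -(d / g) * -g = (d : ℝ) := by field_simp
  rw [h1]
  have hz : 0 < x * y ^ (-(2 * β + d)) := by positivity
  generalize x * y ^ (-(2 * β + d)) = z at hz
  rw [Real.mul_rpow hz.le (by positivity), ← Real.rpow_mul hy.le, h2, Real.rpow_natCast, mul_comm]

/-- The selected level is at least of the order `n ^ (1 / (2 β + d + d / (γ₀ - 1)))` with high
probability, uniformly over the models with the given propensity tail. -/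
theorem exists_level_lower_bound {d m : ℕ} (hm : 0 < m) {δ : ℝ} (hδ : 0 < δ)
    (hδm : δ ≤ 1 / (2 * m)) {β : ℝ} (hβ : 0 < β) (C : ℝ) {g : ℝ} (hg : 0 < g) {ε : ℝ}
    (hε : 0 < ε) :
    ∃ K ≥ (1 : ℝ), ∀ (n N : ℕ), 0 < N → N ≤ n →
      (N : ℝ) ≤ (n : ℝ) ^ (1 / (2 * β + d + d / g)) / K → ∀ P : Model d,
      (∀ π ∈ Set.Icc (0 : ℝ) 1, (unifCube d).real {x | (P.e x : ℝ) ≤ π} ≤ C * π ^ g) →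
      (Measure.pi fun _ : Fin n => P.design) {w | level m δ β w < N} ≤ ENNReal.ofReal ε := by
  obtain ⟨C', hC', hlap⟩ := exists_laplace_bound C hg
  set s : ℝ := 2 * β + d + d / g with hs
  have hs0 : 0 < s := by positivity
  -- Everything in the Markov bound that depends on neither `n` nor `N`; `K` is then taken so large
  -- that `A * K ^ (-(s * g)) ≤ ε`.
  set A : ℝ := Real.exp 1 * ((m : ℝ) ^ d * ((δ ^ d)⁻¹ * (C' * (δ ^ d / 2) ^ (-g)))) with hA
  have hA0 : 0 < A := by positivity
  have htend : Tendsto (fun K : ℝ => A * K ^ (-(s * g))) atTop (𝓝 (A * 0)) :=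
    (tendsto_rpow_neg_atTop (by positivity)).const_mul A
  rw [mul_zero] at htend
  obtain ⟨K, hK1, hK⟩ := ((eventually_ge_atTop (1 : ℝ)).and (htend.eventually_le_const hε)).exists
  refine ⟨K, hK1, fun n N hN hn hNK P htail => ?_⟩
  have hN' : (0 : ℝ) < N := by exact_mod_cast hN
  have hn' : (0 : ℝ) < n := by exact_mod_cast hN.trans_le hn
  have hK0 : 0 < K := by linarith
  set b : ℝ := n * ((N : ℝ) ^ (-(2 * β)) / 2) * (δ / N) ^ d with hb
  have hb0 : 0 < b := by positivity
  have h1 := hlap (unifCube d) (fun x => (P.e x : ℝ)) (measurable_subtype_coe.comp P.measurable_e)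
    (fun x => (P.e x).2) htail b hb0
  have h2 := lintegral_criterion_le (n := n) P hδ hδm hm hN hβ (B := C' * b ^ (-g))
    (by positivity) h1
  refine (measure_level_lt_le P hN hn h2).trans (ENNReal.ofReal_le_ofReal (le_trans ?_ hK))
  have hbf : b = δ ^ d / 2 * (n * (N : ℝ) ^ (-(2 * β + d))) := by
    have : (N : ℝ) ^ (-(2 * β + d)) = (N : ℝ) ^ (-(2 * β)) * ((N : ℝ) ^ d)⁻¹ := by
      rw [neg_add, Real.rpow_add hN', Real.rpow_neg hN'.le (d : ℝ), Real.rpow_natCast]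
    rw [hb, this, div_pow]; field_simp
  have hbg : b ^ (-g) = (δ ^ d / 2) ^ (-g) * (n * (N : ℝ) ^ (-(2 * β + d))) ^ (-g) := by
    rw [hbf, Real.mul_rpow (by positivity) (by positivity)]
  have hkey : (N : ℝ) ^ d * (n * (N : ℝ) ^ (-(2 * β + d))) ^ (-g) ≤ K ^ (-(s * g)) := by
    rw [rpow_level_identity hg hn' hN', ← hs, neg_mul_eq_mul_neg, Real.rpow_mul hK0.le]
    refine Real.rpow_le_rpow_of_nonpos (by positivity) ?_ (by linarith)
    have h3 : (N : ℝ) * K ≤ (n : ℝ) ^ (1 / s) := (le_div_iff₀ hK0).mp hNK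
    have h4 : ((N : ℝ) * K) ^ s ≤ n := by
      refine (Real.rpow_le_rpow (by positivity) h3 hs0.le).trans_eq ?_
      rw [← Real.rpow_mul hn'.le, one_div_mul_cancel hs0.ne', Real.rpow_one]
    rw [Real.mul_rpow hN'.le hK0.le] at h4
    rw [Real.rpow_neg hN'.le, ← div_eq_mul_inv, le_div_iff₀ (by positivity)]
    linarith
  calc _ = A * ((N : ℝ) ^ d * (n * (N : ℝ) ^ (-(2 * β + d))) ^ (-g)) := by
        rw [hbg, hA, div_pow]; field_simp
    _ ≤ _ := by gcongr

/-- Off the bad event the level `N'` is at least of order `n ^ (1/s)`, and bias and noise are both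
of order `N' ^ (-β)`. Half of `ε` pays for a small level and half for large noise. -/
theorem piecewiseFit_attains_rate {d : ℕ} (hd : 1 ≤ d) {β : ℝ} (hβ : 0 < β) :
    ∃ muhat : ∀ n : ℕ, Estimator d n, ∀ σ C γ₀ L : ℝ, 0 < σ → 1 < γ₀ → 0 < L →
      ∀ F : Set (Model d), (∀ P ∈ F, P.mu ∈ HolderClass d β L) →
      (∀ P ∈ F, ∀ π ∈ Set.Icc (0 : ℝ) 1,
        (unifCube d).real {x | (P.e x : ℝ) ≤ π} ≤ C * π ^ (γ₀ - 1)) →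
      ∀ ε > (0 : ℝ), ∃ c ≥ (0 : ℝ), ∀ᶠ n : ℕ in atTop, ⨆ P ∈ F, (P.sample σ n)
        {ω | ENNReal.ofReal (c * rate d β γ₀ n) < supDist ((muhat n).1 ω) P.mu} ≤
          ENNReal.ofReal ε := by
  obtain ⟨δ, hδ, hδm, Kf, hKf, hfit⟩ := exists_fit_error_bound d hβ
  set m := strictFloor β + 1 with hm
  refine ⟨fun n => ⟨piecewiseFit m δ β, measurable_piecewiseFit d n m δ β⟩, ?_⟩
  intro σ C γ₀ L hσ hγ hL F hsm htail ε hε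
  have hg : 0 < γ₀ - 1 := by linarith
  obtain ⟨K, hK1, hlev⟩ := exists_level_lower_bound (d := d) (Nat.succ_pos (strictFloor β)) hδ hδm
    hβ C hg (half_pos hε)
  have hK0 : 0 < K := by linarith
  obtain ⟨c, hc2, hc⟩ : ∃ c : ℝ, 2 ≤ c ∧ 2 * Real.exp (-(c ^ 2 / 2)) ≤ ε / 2 := by
    have ht : Tendsto (fun c : ℝ => 2 * Real.exp (-(c ^ 2 / 2))) atTop (𝓝 (2 * 0)) := by
      refine Tendsto.const_mul 2 (Real.tendsto_exp_neg_atTop_nhds_zero.comp ?_)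
      exact (tendsto_pow_atTop two_ne_zero).atTop_div_const two_pos
    rw [mul_zero] at ht
    exact ((eventually_ge_atTop (2 : ℝ)).and (ht.eventually_le_const (half_pos hε))).exists
  set s : ℝ := 2 * β + d + d / (γ₀ - 1) with hs
  have hs0 : 0 < s := by positivity
  have hc0 : 0 ≤ c := by linarith
  -- The factor `2` in `(2 * K) ^ β` comes from rounding down: a real number at least 1 is at most
  -- twice its floor.
  refine ⟨Kf * ((L + c * σ) * (2 * K) ^ β), by positivity, ?_⟩
  have htop : Tendsto (fun n : ℕ => (n : ℝ) ^ (1 / s) / K) atTop atTop :=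
    ((tendsto_rpow_atTop (by positivity)).comp tendsto_natCast_atTop_atTop).atTop_div_const hK0
  filter_upwards [htop.eventually_ge_atTop 1, eventually_ge_atTop 1] with n hn1 hn
  have hd' : (1 : ℝ) ≤ d := by exact_mod_cast hd
  -- Needed for `N ≤ n`, the search range of `level`; it holds since `s ≥ d ≥ 1`.
  have hs1 : 1 / s ≤ 1 := by
    rw [div_le_one hs0, hs]
    have : 0 ≤ (d : ℝ) / (γ₀ - 1) := by positivity
    linarith
  have hn' : (1 : ℝ) ≤ n := by exact_mod_cast hn
  set y : ℝ := (n : ℝ) ^ (1 / s) with hy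
  have hy0 : 0 < y := by positivity
  set N : ℕ := ⌊y / K⌋₊ with hN
  have hN0 : 0 < N := Nat.floor_pos.mpr hn1
  have hNle : (N : ℝ) ≤ y / K := Nat.floor_le (by positivity)
  have hNn : N ≤ n := by
    have h1 : y / K ≤ n := by
      refine (div_le_self hy0.le hK1).trans ?_
      calc y ≤ (n : ℝ) ^ (1 : ℝ) := Real.rpow_le_rpow_of_exponent_le hn' hs1
        _ = n := Real.rpow_one _
    exact_mod_cast hNle.trans h1
  have hNge : y / (2 * K) ≤ N := by
    have h1 := Nat.lt_floor_add_one (y / K)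
    have h2 : (1 : ℝ) ≤ N := by exact_mod_cast hN0
    have h3 : y / (2 * K) = y / K / 2 := by field_simp
    rw [h3]
    linarith
  have hrate : ∀ N' : ℕ, N ≤ N' → (N' : ℝ) ^ (-β) ≤ (2 * K) ^ β * rate d β γ₀ n := by
    intro N' hN'
    have h1 : y / (2 * K) ≤ N' := hNge.trans (by exact_mod_cast hN')
    refine (Real.rpow_le_rpow_of_nonpos (by positivity) h1 (by linarith)).trans_eq ?_
    rw [rate_eq hβ hγ, Real.div_rpow hy0.le (by positivity),
      Real.rpow_neg (by positivity : 0 ≤ 2 * K), div_inv_eq_mul, mul_comm, hy, hs]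
  refine iSup₂_le fun P hP => ?_
  -- The supremum runs over uncountably many points, so its event is bounded in outer measure
  -- through the measurable `badEvent`.
  have hsub : {ω | ENNReal.ofReal (Kf * ((L + c * σ) * (2 * K) ^ β) * rate d β γ₀ n) <
      supDist (piecewiseFit m δ β ω) P.mu} ⊆ badEvent (n := n) m δ β (c * σ) N P.mu := by
    intro ω hω
    by_contra hbad
    have hω' : ENNReal.ofReal (Kf * ((L + c * σ) * (2 * K) ^ β) * rate d β γ₀ n) <
      supDist (piecewiseFit m δ β ω) P.mu := hω
    refine absurd hω' (not_lt.mpr ?_)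
    have hlev : ¬ level m δ β (fun i => (ω i).1) < N := fun h => hbad (Or.inl h)
    push Not at hlev
    refine iSup₂_le fun x hx => ENNReal.ofReal_le_ofReal ?_
    have h1 := hfit n L hL.le P.mu (hsm P hP) ω _ (c * σ * ((level m δ β fun i => (ω i).1 : ℕ) : ℝ) ^ (-β))
      rfl (hN0.trans_le hlev) (fun j α => by
        by_contra h
        refine hbad (Or.inr (Set.mem_iUnion.mpr ⟨_, rfl, Set.mem_iUnion₂.mpr ⟨j, α, not_le.mp h⟩⟩)))
      x hx
    refine h1.trans ?_
    have h2 := hrate _ hlev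
    have h3 : 0 ≤ c := by linarith
    calc _ = Kf * ((L + c * σ) * ((level m δ β fun i => (ω i).1 : ℕ) : ℝ) ^ (-β)) := by ring
      _ ≤ Kf * ((L + c * σ) * ((2 * K) ^ β * rate d β γ₀ n)) := by gcongr
      _ = _ := by ring
  refine (measure_mono hsub).trans ((sample_badEvent_le P hσ hc2 hN0).trans ?_)
  calc _ ≤ ENNReal.ofReal (ε / 2) + ENNReal.ofReal (ε / 2) :=
        add_le_add (hlev n N hN0 hNn hNle P (htail P hP)) (ENNReal.ofReal_le_ofReal hc)
    _ = _ := by rw [← ENNReal.ofReal_add (by positivity) (by positivity), add_halves]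

/-! ### The least favourable propensity -/

theorem ae_mem_cube (d : ℕ) : ∀ᵐ x ∂unifCube d, x ∈ cube d := ae_cond_mem (measurableSet_cube d)

theorem unifCube_inter_cube {d : ℕ} (S : Set (Cov d)) : unifCube d (cube d ∩ S) = unifCube d S :=
  cond_inter_self (measurableSet_cube d) S volume

/-- A propensity score vanishing at the origin like a power of the supremum norm. -/
noncomputable def powerPropensity {d : ℕ} (r : ℝ) (x : Cov d) : unitInterval :=
  ⟨min 1 (‖WithLp.ofLp x‖ ^ r), le_min zero_le_one (by positivity), min_le_left _ _⟩

theorem measurable_powerPropensity {d : ℕ} (r : ℝ) :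
    Measurable (powerPropensity r : Cov d → unitInterval) := by
  refine Measurable.subtype_mk (measurable_const.min (Measurable.pow_const ?_ r))
  exact (PiLp.continuous_ofLp 2 fun _ : Fin d => ℝ).norm.measurable

theorem norm_ofLp_le_one_of_mem_cube {d : ℕ} {x : Cov d} (hx : x ∈ cube d) :
    ‖WithLp.ofLp x‖ ≤ 1 :=
  (pi_norm_le_iff_of_nonneg zero_le_one).mpr fun i => abs_le.mpr (hx i)

theorem powerPropensity_of_mem_cube {d : ℕ} {r : ℝ} (hr : 0 ≤ r) {x : Cov d} (hx : x ∈ cube d) :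
    (powerPropensity r x : ℝ) = ‖WithLp.ofLp x‖ ^ r :=
  min_eq_right (Real.rpow_le_one (norm_nonneg _) (norm_ofLp_le_one_of_mem_cube hx) hr)

theorem setOf_norm_le {d : ℕ} {t : ℝ} (ht : 0 ≤ t) :
    {x : Cov d | ‖WithLp.ofLp x‖ ≤ t} = {x | ∀ i, x i ∈ Set.Icc (-t) t} := by
  ext x
  exact (pi_norm_le_iff_of_nonneg ht).trans (forall_congr' fun i => abs_le)

theorem unifCube_norm_le {d : ℕ} {t : ℝ} (h0 : 0 ≤ t) (h1 : t ≤ 1) :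
    unifCube d {x | ‖WithLp.ofLp x‖ ≤ t} = ENNReal.ofReal (t ^ d) := by
  rw [setOf_norm_le h0, unifCube_box (fun _ => by linarith) fun _ => h1]
  simp only [sub_neg_eq_add, add_self_div_two, Finset.prod_const, Finset.card_univ,
    Fintype.card_fin]
  rw [ENNReal.ofReal_pow h0]

/-- On the cube the sublevel set is a sup-norm ball of radius `π ^ (g/d)`, of probability `π ^ g`.
Having equality, not just a bound, also yields nondegenerate overlap. -/
theorem powerPropensity_tail {d : ℕ} (hd : 1 ≤ d) {g : ℝ} (hg : 0 < g) {π : ℝ}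
    (hπ : π ∈ Set.Icc (0 : ℝ) 1) :
    (unifCube d).real {x | (powerPropensity (d / g) x : ℝ) ≤ π} = π ^ g := by
  have hd' : (0 : ℝ) < d := by exact_mod_cast hd
  have hr : 0 < d / g := by positivity
  have hset : cube d ∩ {x | (powerPropensity (d / g) x : ℝ) ≤ π} =
      cube d ∩ {x | ‖WithLp.ofLp x‖ ≤ π ^ (d / g)⁻¹} := by
    ext x
    refine and_congr_right fun hx => ?_
    change (powerPropensity (d / g) x : ℝ) ≤ π ↔ ‖WithLp.ofLp x‖ ≤ π ^ (d / g)⁻¹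
    rw [powerPropensity_of_mem_cube hr.le hx, Real.le_rpow_inv_iff_of_pos (norm_nonneg _) hπ.1 hr]
  rw [measureReal_def, ← unifCube_inter_cube, hset, unifCube_inter_cube, unifCube_norm_le
    (Real.rpow_nonneg hπ.1 _) (Real.rpow_le_one hπ.1 hπ.2 (by positivity)),
    ENNReal.toReal_ofReal (pow_nonneg (Real.rpow_nonneg hπ.1 _) _), ← Real.rpow_natCast,
    ← Real.rpow_mul hπ.1]
  congr 1
  field_simp

theorem law_treated {d : ℕ} (P : Model d) (σ : ℝ) {S : Set (Cov d)} (hS : MeasurableSet S) :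
    P.law σ {z | z.1.2 = true ∧ z.1.1 ∈ S} = ∫⁻ x in S, ENNReal.ofReal (P.e x) ∂(unifCube d) := by
  have hm : MeasurableSet {w : Cov d × Bool | w.2 = true ∧ w.1 ∈ S} :=
    (measurable_snd (measurableSet_singleton true)).inter (measurable_fst hS)
  have h1 : P.law σ {z | z.1.2 = true ∧ z.1.1 ∈ S} =
      P.design {w | w.2 = true ∧ w.1 ∈ S} := by
    change (P.design ⊗ₘ P.outcome σ) (Prod.fst ⁻¹' {w | w.2 = true ∧ w.1 ∈ S}) = _
    rw [← Measure.map_apply measurable_fst hm]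
    change (P.design ⊗ₘ P.outcome σ).fst _ = _
    rw [Measure.fst_compProd]
  rw [h1, ← lintegral_indicator_one hm, lintegral_design P (measurable_one.indicator hm),
    ← lintegral_indicator hS]
  refine lintegral_congr fun x => ?_
  by_cases hx : x ∈ S <;> simp [Set.indicator, hx]

theorem unifCube_ball_le {d : ℕ} (x₀ : Cov d) {h : ℝ} (hh : 0 < h) :
    unifCube d {x | ‖x - x₀‖ ≤ h} ≤ ENNReal.ofReal (h ^ d) := by
  rw [← unifCube_inter_cube]
  have hsub : cube d ∩ {x | ‖x - x₀‖ ≤ h} ⊆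
      {x | ∀ i, x i ∈ Set.Icc (max (-1) (x₀ i - h)) (min 1 (x₀ i + h))} := fun x hx i => by
    have h1 : |x i - x₀ i| ≤ h := (PiLp.norm_apply_le (x - x₀) i).trans hx.2
    obtain ⟨h2, h3⟩ := abs_le.mp h1
    exact ⟨max_le (hx.1 i).1 (by linarith), le_min (hx.1 i).2 (by linarith)⟩
  refine (measure_mono hsub).trans ?_
  rw [unifCube_box (fun i => le_max_left _ _) fun i => min_le_left _ _, ENNReal.ofReal_pow hh.le]
  refine (Finset.prod_le_prod' (g := fun _ => ENNReal.ofReal h) fun i _ =>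
    ENNReal.ofReal_le_ofReal ?_).trans_eq (by simp)
  have h1 := min_le_right (1 : ℝ) (x₀ i + h)
  have h2 := le_max_right (-1 : ℝ) (x₀ i - h)
  linarith

theorem le_unifCube_ball {d : ℕ} (hd : 1 ≤ d) {x₀ : Cov d} (hx₀ : x₀ ∈ cube d) {h : ℝ}
    (hh : 0 < h) (h1 : h ≤ 1) :
    ENNReal.ofReal ((h / (2 * d)) ^ d) ≤ unifCube d {x | ‖x - x₀‖ ≤ h} := by
  have hd' : (1 : ℝ) ≤ d := by exact_mod_cast hd
  set b := h / d with hb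
  have hb0 : 0 < b := by positivity
  have hb1 : b ≤ 1 := (div_le_self hh.le hd').trans h1
  -- The box of side `h / d` has a corner at `x₀` and points inward in every coordinate, so it stays
  -- in the cube even when `x₀` is on the boundary.
  set l : Fin d → ℝ := fun i => if x₀ i ≤ 0 then x₀ i else x₀ i - b with hl
  have hll : ∀ i, -1 ≤ l i ∧ l i + b ≤ 1 ∧ l i ≤ x₀ i ∧ x₀ i ≤ l i + b := fun i => by
    have h2 := hx₀ i
    simp only [hl]
    split_ifs with hc
    · exact ⟨h2.1, by linarith, le_rfl, by linarith⟩
    · push Not at hc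
      exact ⟨by linarith, by linarith [h2.2], by linarith, by linarith⟩
  have hsub : {x : Cov d | ∀ i, x i ∈ Set.Icc (l i) (l i + b)} ⊆ {x | ‖x - x₀‖ ≤ h} := by
    intro x hx
    have hsum : x - x₀ = ∑ i, (x - x₀) i • EuclideanSpace.single i (1 : ℝ) := by
      ext j
      simp [Finset.sum_apply, Pi.single_apply]
    change ‖x - x₀‖ ≤ h
    rw [hsum]
    refine (norm_sum_le _ _).trans ((Finset.sum_le_sum (g := fun _ => b) fun i _ => ?_).trans_eq ?_)
    · rw [norm_smul]
      have h3 := hx i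
      have h4 := hll i
      have : |x i - x₀ i| ≤ b := abs_le.mpr ⟨by linarith [h3.1], by linarith [h3.2]⟩
      simpa using this
    · simp only [Finset.sum_const, Finset.card_univ, Fintype.card_fin, nsmul_eq_mul, hb]
      field_simp
  refine le_trans (le_of_eq ?_) (measure_mono hsub)
  rw [unifCube_box (fun i => (hll i).1) fun i => (hll i).2.1]
  simp only [add_sub_cancel_left, Finset.prod_const, Finset.card_univ, Fintype.card_fin]
  rw [← ENNReal.ofReal_pow (by positivity), hb, div_div, mul_comm (d : ℝ) 2]

/-- If `x₀` is at sup-norm distance at least `2h` from the origin, the whole ball qualifies.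
Otherwise it suffices to remove the sup-norm ball of radius `h / (4d)`, whose mass is at most half
of the lower bound `(h / (2d)) ^ d`; the constant `12 d` arises from `3h / (12 d) = h / (4d)`. -/
theorem measure_ball_far_from_zero {d : ℕ} (hd : 1 ≤ d) {x₀ : Cov d} (hx₀ : x₀ ∈ cube d) {h : ℝ}
    (hh : 0 < h) (h1 : h ≤ 1) :
    ENNReal.ofReal (1 / 2 * (1 / (2 * d)) ^ d) * unifCube d {x | ‖x - x₀‖ ≤ h} ≤
      unifCube d ({x | ‖x - x₀‖ ≤ h} ∩
        {x | 1 / (12 * d) * (‖WithLp.ofLp x₀‖ + h) ≤ ‖WithLp.ofLp x‖}) := by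
  have hd' : (1 : ℝ) ≤ d := by exact_mod_cast hd
  have hd0 : (0 : ℝ) < d := by linarith
  set B : Set (Cov d) := {x | ‖x - x₀‖ ≤ h} with hB
  set t : ℝ := 1 / (12 * d) with ht
  have ht0 : 0 < t := by positivity
  have ht1 : t ≤ 1 / 12 := by
    rw [ht]; exact one_div_le_one_div_of_le (by norm_num) (by linarith)
  rcases le_or_gt (2 * h) ‖WithLp.ofLp x₀‖ with hc | hc
  · have hsub : B ⊆ B ∩ {x | t * (‖WithLp.ofLp x₀‖ + h) ≤ ‖WithLp.ofLp x‖} := fun x hx => by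
      refine ⟨hx, ?_⟩
      change t * (‖WithLp.ofLp x₀‖ + h) ≤ ‖WithLp.ofLp x‖
      have h2 : ‖WithLp.ofLp x₀ - WithLp.ofLp x‖ ≤ h :=
        (pi_norm_le_iff_of_nonneg hh.le).mpr fun i => by
          have h3 : ‖(x - x₀) i‖ ≤ h := (PiLp.norm_apply_le (x - x₀) i).trans hx
          rw [Pi.sub_apply, norm_sub_rev]
          exact h3
      have h4 := norm_sub_norm_le (WithLp.ofLp x₀) (WithLp.ofLp x)
      nlinarith [norm_nonneg (WithLp.ofLp x₀)]
    refine le_trans ?_ (measure_mono hsub)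
    refine mul_le_of_le_one_left zero_le ?_
    rw [← ENNReal.ofReal_one]
    refine ENNReal.ofReal_le_ofReal ?_
    have : (1 / (2 * (d : ℝ))) ^ d ≤ 1 := pow_le_one₀ (by positivity) (by
      rw [div_le_one (by positivity)]; linarith)
    linarith
  · set T : Set (Cov d) := {x | ‖WithLp.ofLp x‖ ≤ h / (4 * d)} with hT
    have hTm : unifCube d T = ENNReal.ofReal ((h / (4 * d)) ^ d) :=
      unifCube_norm_le (by positivity) (by
        rw [div_le_one (by positivity)]; linarith)
    have hsub : B ⊆ (B ∩ {x | t * (‖WithLp.ofLp x₀‖ + h) ≤ ‖WithLp.ofLp x‖}) ∪ T := fun x hx => by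
      by_cases hxT : x ∈ T
      · exact Or.inr hxT
      · refine Or.inl ⟨hx, ?_⟩
        have hxT' : h / (4 * d) < ‖WithLp.ofLp x‖ := not_le.mp hxT
        refine le_trans ?_ hxT'.le
        calc t * (‖WithLp.ofLp x₀‖ + h) ≤ t * (3 * h) := by gcongr; linarith
          _ = h / (4 * d) := by rw [ht]; field_simp; norm_num
    have h2 := (le_unifCube_ball hd hx₀ hh h1).trans
      ((measure_mono hsub).trans (measure_union_le _ _))
    rw [hTm] at h2
    have h3 : (h / (4 * d)) ^ d ≤ 1 / 2 * (h / (2 * d)) ^ d := by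
      have : h / (4 * d) = 1 / 2 * (h / (2 * d)) := by field_simp; norm_num
      rw [this, mul_pow]
      gcongr
      exact pow_le_of_le_one (by norm_num) (by norm_num) (by omega)
    have h4 := tsub_le_iff_right.mpr h2
    rw [← ENNReal.ofReal_sub _ (by positivity)] at h4
    refine le_trans ?_ h4
    refine (mul_le_mul_right (unifCube_ball_le x₀ hh) _).trans ?_
    rw [← ENNReal.ofReal_mul (by positivity)]
    refine ENNReal.ofReal_le_ofReal ?_
    have h5 : (1 / (2 * (d : ℝ))) ^ d * h ^ d = (h / (2 * d)) ^ d := by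
      rw [← mul_pow]; congr 1; ring
    linarith

/-- On a fixed fraction `c` of the ball, the propensity is at least `ρ` times its supremum `s`
there. Conditioning on treatment weights points by `e`, which is at least `ρ s` on that part and at
most `s` everywhere, so the conditional probability is at least `ρ c`; the choice `ρ c / 2` makes
the inequality strict. -/
theorem concentration_powerPropensity {d : ℕ} (hd : 1 ≤ d) (σ : ℝ) {g : ℝ} (hg : 0 < g)
    {F : Set (Model d)} (hF : ∀ P ∈ F, P.e = powerPropensity (d / g)) :
    NontrivialConcentration σ F := by
  have hd' : (0 : ℝ) < d := by exact_mod_cast hd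
  have hr : 0 < d / g := by positivity
  set c : ℝ := 1 / 2 * (1 / (2 * d)) ^ d with hc
  have hc0 : 0 < c := by positivity
  set ρ : ℝ := (1 / (12 * d)) ^ (d / g) with hρ
  have hρ0 : 0 < ρ := by positivity
  refine ⟨ρ, hρ0, ρ * c / 2, by positivity, 1, one_pos, ?_⟩
  rintro h ⟨hh, h1⟩ P hP x₀ hx₀
  have hPe := hF P hP
  set B : Set (Cov d) := {x | ‖x - x₀‖ ≤ h} with hB
  set s : ℝ := sSup ((fun x => (P.e x : ℝ)) '' {x | x ∈ cube d ∧ ‖x - x₀‖ ≤ h}) with hs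
  have hbdd : BddAbove ((fun x => (P.e x : ℝ)) '' {x | x ∈ cube d ∧ ‖x - x₀‖ ≤ h}) :=
    ⟨1, by rintro _ ⟨x, -, rfl⟩; exact (P.e x).2.2⟩
  have hles : ∀ x ∈ cube d, x ∈ B → (P.e x : ℝ) ≤ s := fun x hx hxB =>
    le_csSup hbdd ⟨x, ⟨hx, hxB⟩, rfl⟩
  have hs0 : 0 ≤ s := (P.e x₀).2.1.trans (hles x₀ hx₀ (by simp [hB, hh.le]))
  have hsT : s ≤ (‖WithLp.ofLp x₀‖ + h) ^ (d / g) := by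
    refine csSup_le ⟨_, ⟨x₀, ⟨hx₀, by simp [hh.le]⟩, rfl⟩⟩ ?_
    rintro _ ⟨x, ⟨hx, hxB⟩, rfl⟩
    change (P.e x : ℝ) ≤ _
    rw [hPe, powerPropensity_of_mem_cube hr.le hx]
    refine Real.rpow_le_rpow (norm_nonneg _) ?_ hr.le
    have h2 : ‖WithLp.ofLp x - WithLp.ofLp x₀‖ ≤ h :=
      (pi_norm_le_iff_of_nonneg hh.le).mpr fun i => (PiLp.norm_apply_le (x - x₀) i).trans hxB
    have h4 := norm_sub_norm_le (WithLp.ofLp x) (WithLp.ofLp x₀)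
    linarith
  have hem : Measurable fun x => (P.e x : ℝ) := measurable_subtype_coe.comp P.measurable_e
  have hBm : MeasurableSet B := measurableSet_le (by fun_prop) measurable_const
  set A : Set (Cov d) := {x | ρ * s ≤ (P.e x : ℝ)} with hA
  have hAm : MeasurableSet A := measurableSet_le measurable_const hem
  have hup : ∫⁻ x in B, ENNReal.ofReal (P.e x) ∂(unifCube d) ≤ ENNReal.ofReal s * unifCube d B := by
    rw [← setLIntegral_const]
    refine lintegral_mono_ae ?_
    filter_upwards [ae_restrict_of_ae (ae_mem_cube d), ae_restrict_mem hBm] with x hx hxB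
    exact ENNReal.ofReal_le_ofReal (hles x hx hxB)
  have hlow : ENNReal.ofReal (ρ * s) * unifCube d (B ∩ A) ≤
      ∫⁻ x in B ∩ A, ENNReal.ofReal (P.e x) ∂(unifCube d) := by
    rw [← setLIntegral_const]
    refine setLIntegral_mono_ae' (hBm.inter hAm) (.of_forall fun x hx => ?_)
    exact ENNReal.ofReal_le_ofReal hx.2
  have hfar : ENNReal.ofReal c * unifCube d B ≤ unifCube d (B ∩ A) := by
    refine (measure_ball_far_from_zero hd hx₀ hh h1).trans ?_
    rw [← unifCube_inter_cube]
    refine measure_mono fun x hx => ⟨hx.2.1, ?_⟩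
    change ρ * s ≤ (P.e x : ℝ)
    rw [hPe, powerPropensity_of_mem_cube hr.le hx.1]
    calc ρ * s ≤ ρ * (‖WithLp.ofLp x₀‖ + h) ^ (d / g) := by gcongr
      _ = (1 / (12 * d) * (‖WithLp.ofLp x₀‖ + h)) ^ (d / g) := by
        rw [hρ, Real.mul_rpow (by positivity) (by positivity)]
      _ ≤ _ := Real.rpow_le_rpow (by positivity) hx.2.2 hr.le
  have hBpos : 0 < unifCube d B :=
    (ENNReal.ofReal_pos.mpr (by positivity)).trans_le (le_unifCube_ball hd hx₀ hh h1)
  -- The conditioning event has positive probability because the propensity vanishes only on a null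
  -- set.
  have hIpos : ∫⁻ x in B, ENNReal.ofReal (P.e x) ∂(unifCube d) ≠ 0 := by
    have hz : unifCube d {x | (P.e x : ℝ) ≤ 0} = 0 := by
      have := powerPropensity_tail hd hg (π := 0) (by simp)
      rw [Real.zero_rpow hg.ne', measureReal_eq_zero_iff, ← hPe] at this
      exact this
    intro h0
    rw [lintegral_eq_zero_iff hem.ennreal_ofReal] at h0
    have h2 : ∀ᵐ x ∂(unifCube d).restrict B, False := by
      filter_upwards [h0, ae_restrict_of_ae (measure_eq_zero_iff_ae_notMem.mp hz)] with x hx hx'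
      exact hx' (ENNReal.ofReal_eq_zero.mp hx)
    rw [ae_restrict_iff' hBm] at h2
    exact hBpos.ne' (measure_eq_zero_iff_ae_notMem.mpr (h2.mono fun x hx hxB => hx hxB))
  have hIfin : ∫⁻ x in B, ENNReal.ofReal (P.e x) ∂(unifCube d) ≠ ⊤ :=
    (hup.trans_lt (ENNReal.mul_lt_top ENNReal.ofReal_lt_top (measure_lt_top _ _))).ne
  have hkey : ENNReal.ofReal (ρ * c) * ∫⁻ x in B, ENNReal.ofReal (P.e x) ∂(unifCube d) ≤
      ∫⁻ x in B ∩ A, ENNReal.ofReal (P.e x) ∂(unifCube d) := by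
    calc _ ≤ ENNReal.ofReal (ρ * c) * (ENNReal.ofReal s * unifCube d B) :=
          mul_le_mul_right hup _
      _ = ENNReal.ofReal (ρ * s) * (ENNReal.ofReal c * unifCube d B) := by
          rw [ENNReal.ofReal_mul hρ0.le, ENNReal.ofReal_mul hρ0.le]; ring
      _ ≤ _ := (mul_le_mul_right hfar _).trans hlow
  have hEm : MeasurableSet {z : Obs d | z.1.2 = true ∧ ‖z.1.1 - x₀‖ ≤ h} :=
    ((measurable_snd.comp measurable_fst) (measurableSet_singleton true)).inter
      ((measurable_fst.comp measurable_fst) hBm)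
  have hE : P.law σ {z | z.1.2 = true ∧ ‖z.1.1 - x₀‖ ≤ h} =
      ∫⁻ x in B, ENNReal.ofReal (P.e x) ∂(unifCube d) := law_treated P σ hBm
  have hEA : P.law σ ({z | z.1.2 = true ∧ ‖z.1.1 - x₀‖ ≤ h} ∩ {z | ρ * s ≤ (P.e z.1.1 : ℝ)}) =
      ∫⁻ x in B ∩ A, ENNReal.ofReal (P.e x) ∂(unifCube d) := by
    rw [← law_treated P σ (hBm.inter hAm)]
    congr 1
    ext z
    exact and_assoc
  rw [cond_apply hEm, hE, hEA]
  refine lt_of_lt_of_le ?_ (mul_le_mul_right hkey _)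
  rw [mul_left_comm _ (ENNReal.ofReal (ρ * c)), ENNReal.inv_mul_cancel hIpos hIfin, mul_one]
  exact (ENNReal.ofReal_lt_ofReal_iff (by positivity)).mpr (half_lt_self (by positivity))

/-! ### Bumps and admissibility of the family -/

theorem zero_mem_holderClass (d : ℕ) {β L : ℝ} (hL : 0 ≤ L) : (fun _ => 0) ∈ HolderClass d β L := by
  refine ⟨contDiffOn_const, fun s x _ y _ => ?_⟩
  have h : iteratedFDerivWithin ℝ (strictFloor β) (fun _ : Cov d => (0 : ℝ)) (cube d) = 0 :=
    iteratedFDerivWithin_fun_zero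
  rw [h]
  simp only [Pi.zero_apply, zero_apply, sub_self, abs_zero]
  positivity

/-- Rescaled bumps of height `a * h ^ β` and width `h` belong to a common Hölder class. -/
theorem exists_scaled_bump (d : ℕ) {β L M : ℝ} (hβ : 0 < β) (hL : 0 < L) (hM : 0 < M) :
    ∃ a > (0 : ℝ), a ^ 2 ≤ M ∧ ∃ φ : Cov d → ℝ, Continuous φ ∧ φ 0 = 1 ∧
      (∀ x, φ x ∈ Set.Icc (0 : ℝ) 1) ∧ (∀ x, 1 ≤ ‖x‖ → φ x = 0) ∧
      ∀ h ∈ Set.Ioc (0 : ℝ) 1, (fun x => a * h ^ β * φ (h⁻¹ • x)) ∈ HolderClass d β L := by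
  set l := strictFloor β with hl
  have hθ0 : 0 < β - l := sub_pos.mpr (strictFloor_lt hβ)
  have hθ1 : β - l ≤ 1 := by linarith [le_strictFloor_add_one β]
  let φ : ContDiffBump (0 : Cov d) := ⟨1 / 2, 1, by norm_num, by norm_num⟩
  have hφ : ∀ n : ℕ, ContDiff ℝ n (φ : Cov d → ℝ) := fun n => φ.contDiff
  set Ψ := iteratedFDeriv ℝ l (φ : Cov d → ℝ) with hΨ
  have hΨs : HasCompactSupport Ψ := φ.hasCompactSupport.iteratedFDeriv l
  have hΨ1 : ContDiff ℝ 1 Ψ := by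
    refine ContDiff.iteratedFDeriv_right (hφ (l + 1)) ?_
    push_cast
    rw [add_comm]
  obtain ⟨K, hK⟩ := hΨ1.lipschitzWith_of_hasCompactSupport hΨs one_ne_zero
  obtain ⟨D, hD⟩ := hΨs.exists_bound_of_continuous hΨ1.continuous
  have hD0 : 0 ≤ D := (norm_nonneg _).trans (hD 0)
  set G : ℝ := 2 * D + K with hG
  have hG0 : 0 ≤ G := by positivity
  -- Since `0 < β - l ≤ 1`, the Lipschitz bound serves at distance at most 1 and boundedness beyond.
  have hΨdiff : ∀ x y, ‖Ψ x - Ψ y‖ ≤ G * ‖x - y‖ ^ (β - l) := fun x y => by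
    rcases le_total ‖x - y‖ 1 with h | h
    · have h1 : ‖Ψ x - Ψ y‖ ≤ K * ‖x - y‖ := hK.norm_sub_le x y
      have h2 : ‖x - y‖ ≤ ‖x - y‖ ^ (β - l) := by
        conv_lhs => rw [← Real.rpow_one ‖x - y‖]
        rcases (norm_nonneg (x - y)).eq_or_lt with h0 | h0
        · rw [← h0, Real.zero_rpow one_ne_zero]; positivity
        · exact Real.rpow_le_rpow_of_exponent_ge h0 h hθ1
      have h3 : (K : ℝ) ≤ G := by rw [hG]; linarith
      exact h1.trans (mul_le_mul h3 h2 (norm_nonneg _) hG0)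
    · have h1 : ‖Ψ x - Ψ y‖ ≤ 2 * D := (norm_sub_le _ _).trans (by linarith [hD x, hD y])
      have h2 : 1 ≤ ‖x - y‖ ^ (β - l) := Real.one_le_rpow h hθ0.le
      have h3 : 2 * D ≤ G := by rw [hG]; linarith [K.coe_nonneg]
      exact h1.trans (h3.trans (le_mul_of_one_le_right hG0 h2))
  -- The first bound keeps the squared height below `M`, hence the variance; the second keeps the
  -- Hölder constant below `L`.
  set a : ℝ := min (Real.sqrt M) (L / (G + 1)) with ha
  have ha0 : 0 < a := lt_min (Real.sqrt_pos.mpr hM) (by positivity)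
  refine ⟨a, ha0, ?_, φ, φ.continuous, ?_, fun x => ⟨φ.nonneg, φ.le_one⟩, fun x hx => ?_, ?_⟩
  · calc a ^ 2 ≤ Real.sqrt M ^ 2 := pow_le_pow_left₀ ha0.le (min_le_left _ _) 2
      _ = M := Real.sq_sqrt hM.le
  · exact φ.one_of_mem_closedBall (by simp [φ])
  · refine φ.zero_of_le_dist ?_
    simpa [φ] using hx
  rintro h ⟨hh, -⟩
  have hcomp : ContDiff ℝ l fun x : Cov d => φ (h⁻¹ • x) := (hφ l).comp (contDiff_const_smul _)
  have hf : ContDiff ℝ l fun x : Cov d => a * h ^ β * φ (h⁻¹ • x) := contDiff_const.mul hcomp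
  have hder : ∀ x : Cov d, iteratedFDeriv ℝ l (fun x : Cov d => a * h ^ β * φ (h⁻¹ • x)) x =
      (a * h ^ β * h⁻¹ ^ l) • Ψ (h⁻¹ • x) := fun x => by
    have h1 : (fun x : Cov d => a * h ^ β * φ (h⁻¹ • x)) =
        (a * h ^ β) • fun x : Cov d => φ (h⁻¹ • x) := rfl
    rw [h1, iteratedFDeriv_const_smul_apply hcomp.contDiffAt,
      iteratedFDeriv_comp_const_smul _ (hφ l), smul_smul]
  refine ⟨hf.contDiffOn, fun s x hx y hy => ?_⟩
  rw [iteratedFDerivWithin_eq_iteratedFDeriv (uniqueDiffOn_cube d) hf.contDiffAt hx,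
    iteratedFDerivWithin_eq_iteratedFDeriv (uniqueDiffOn_cube d) hf.contDiffAt hy, hder, hder,
    ← sub_apply, ← smul_sub, ← Real.norm_eq_abs]
  refine (ContinuousMultilinearMap.le_opNorm _ _).trans ?_
  have hone : ∏ i : Fin l, ‖(EuclideanSpace.single (s i) 1 : Cov d)‖ = 1 :=
    Finset.prod_eq_one fun i _ => by simp
  rw [hone, mul_one, norm_smul, Real.norm_eq_abs, abs_of_pos (by positivity)]
  have h2 := hΨdiff (h⁻¹ • x) (h⁻¹ • y)
  rw [← smul_sub, norm_smul, Real.norm_eq_abs, abs_of_pos (by positivity),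
    Real.mul_rpow (by positivity) (norm_nonneg _)] at h2
  have h3 : h ^ β * h⁻¹ ^ l * h⁻¹ ^ (β - l) = 1 := by
    rw [← Real.rpow_natCast, mul_assoc, ← Real.rpow_add (by positivity), Real.inv_rpow hh.le]
    rw [show (l : ℝ) + (β - l) = β by ring]
    exact mul_inv_cancel₀ (by positivity)
  calc a * h ^ β * h⁻¹ ^ l * ‖Ψ (h⁻¹ • x) - Ψ (h⁻¹ • y)‖
      ≤ a * h ^ β * h⁻¹ ^ l * (G * (h⁻¹ ^ (β - l) * ‖x - y‖ ^ (β - l))) := by gcongr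
    _ = (h ^ β * h⁻¹ ^ l * h⁻¹ ^ (β - l)) * (a * G) * ‖x - y‖ ^ (β - l) := by ring
    _ = a * G * ‖x - y‖ ^ (β - l) := by rw [h3, one_mul]
    _ ≤ L * ‖x - y‖ ^ (β - l) := by
        refine mul_le_mul_of_nonneg_right ?_ (by positivity)
        calc a * G ≤ L / (G + 1) * (G + 1) := by
              refine mul_le_mul (min_le_right _ _) (by linarith) hG0 (by positivity)
          _ = L := by field_simp

/-- The model with propensity vanishing at the origin, treated mean `f` and untreated mean zero. -/
noncomputable def vanishingModel {d : ℕ} (r : ℝ) (f : Cov d → ℝ) (hf : Measurable f) : Model d where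
  e := powerPropensity r
  mu := f
  mu0 := fun _ => 0
  measurable_e := measurable_powerPropensity r
  measurable_mu := hf
  measurable_mu0 := measurable_const

/-- The models with propensity vanishing at the origin and bounded, smooth treated mean. -/
def vanishingFamily (d : ℕ) (r β L M : ℝ) : Set (Model d) :=
  {P | P.e = powerPropensity r ∧ P.mu0 = (fun _ => 0) ∧ P.mu ∈ HolderClass d β L ∧
    ∀ x, P.mu x ^ 2 ≤ M}

theorem evariance_le_of_sq_le {Ω : Type*} [MeasurableSpace Ω] (μ : Measure Ω)
    [IsProbabilityMeasure μ] {f : Ω → ℝ} (hf : Measurable f) {M : ℝ} (hM : ∀ x, f x ^ 2 ≤ M) :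
    evariance f μ ≤ ENNReal.ofReal M := by
  have hb : ∀ x, ‖f x‖ ≤ Real.sqrt M := fun x => Real.abs_le_sqrt (hM x)
  have hmem : MemLp f 2 μ := MemLp.of_bound hf.aestronglyMeasurable _ (.of_forall hb)
  rw [← hmem.ofReal_variance_eq]
  refine ENNReal.ofReal_le_ofReal ((variance_le_expectation_sq hf.aestronglyMeasurable).trans ?_)
  have h1 : Integrable (fun x => f x ^ 2) μ := hmem.integrable_sq
  calc ∫ x, (f ^ 2) x ∂μ ≤ ∫ _, M ∂μ := integral_mono h1 (integrable_const M) hM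
    _ = M := by simp

theorem holderModel_vanishingFamily {d : ℕ} (hd : 1 ≤ d) {q M σ C γ₀ β L : ℝ} (hM : 0 < M)
    (hC : 1 ≤ C) (hγ : 1 < γ₀) (hL : 0 < L)
    (hmom : ∫⁻ z, ENNReal.ofReal (|z| ^ q) ∂(gaussianReal 0 (σ ^ 2).toNNReal) ≤
      ENNReal.ofReal (M ^ q)) :
    HolderModel β L q M σ C γ₀ (vanishingFamily d (d / (γ₀ - 1)) β L M) := by
  have hg : 0 < γ₀ - 1 := by linarith
  refine ⟨⟨?_, ?_, ?_, ?_, ?_⟩, ?_, fun P hP => hP.2.2.1, fun P hP => ?_⟩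
  · exact ⟨vanishingModel _ (fun _ => 0) measurable_const, rfl, rfl, zero_mem_holderClass d hL.le,
      fun x => by simpa [vanishingModel] using hM.le⟩
  · refine fun P hP => .of_forall fun x => ?_
    have hker : P.outcome σ (x, true) = gaussianReal (P.mu x) (σ ^ 2).toNNReal := by
      change gaussianReal (P.mean (x, true)) _ = _
      simp [Model.mean]
    have hshift : gaussianReal (P.mu x) (σ ^ 2).toNNReal =
        (gaussianReal 0 (σ ^ 2).toNNReal).map fun z => P.mu x + z := by
      rw [gaussianReal_map_const_add, zero_add]
    rw [hker, hshift, lintegral_map (by fun_prop) (by fun_prop)]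
    simpa using hmom
  · exact fun P hP => evariance_le_of_sq_le _ P.measurable_mu hP.2.2.2
  · refine fun P hP => .of_forall fun w => ?_
    change _ ≤ evariance id (gaussianReal (P.mean w) (σ ^ 2).toNNReal)
    rw [← (memLp_id_gaussianReal 2).ofReal_variance_eq, variance_id_gaussianReal,
      Real.coe_toNNReal _ (sq_nonneg σ)]
  · intro P hP π hπ
    rw [hP.1, powerPropensity_tail hd hg hπ]
    exact le_mul_of_one_le_left (Real.rpow_nonneg hπ.1 _) hC
  -- Halving `π` multiplies the exact tail by `(1 / 2) ^ (γ₀ - 1)`.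
  · refine ⟨1 - (1 / 2) ^ (γ₀ - 1), ?_, fun P hP π hπ => ?_⟩
    · have := Real.rpow_lt_one (by norm_num : (0 : ℝ) ≤ 1 / 2) (by norm_num) hg
      linarith
    · rw [hP.1, powerPropensity_tail hd hg hπ, powerPropensity_tail hd hg
        ⟨by linarith [hπ.1], by linarith [hπ.2, hπ.1]⟩, div_eq_mul_one_div π 2,
        Real.mul_rpow hπ.1 (by norm_num)]
      linarith
  · rw [hP.2.1]; exact zero_mem_holderClass d hL.le

/-! ### Likelihood ratios -/

theorem gaussianReal_eq_withDensity (μ : ℝ) {v : ℝ≥0} (hv : v ≠ 0) :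
    gaussianReal μ v = (gaussianReal 0 v).withDensity fun y =>
      ENNReal.ofReal (Real.exp (μ * y / v - μ ^ 2 / (2 * v))) := by
  have hv' : (v : ℝ) ≠ 0 := by exact_mod_cast hv
  rw [gaussianReal_of_var_ne_zero μ hv, gaussianReal_of_var_ne_zero 0 hv,
    ← withDensity_mul _ (measurable_gaussianPDF 0 v) (by fun_prop)]
  congr 1
  funext y
  rw [Pi.mul_apply, gaussianPDF, gaussianPDF, ← ENNReal.ofReal_mul (gaussianPDFReal_nonneg 0 v y)]
  congr 1
  simp only [gaussianPDFReal]
  rw [mul_assoc _ (Real.exp _), ← Real.exp_add]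
  congr 2
  field_simp
  ring

theorem lintegral_exp_gaussianReal (t : ℝ) (v : ℝ≥0) :
    ∫⁻ y, ENNReal.ofReal (Real.exp (t * y)) ∂(gaussianReal 0 v) =
      ENNReal.ofReal (Real.exp (v * t ^ 2 / 2)) := by
  rw [← ofReal_integral_eq_lintegral_ofReal (integrable_exp_mul_gaussianReal t)
    (.of_forall fun _ => (Real.exp_pos _).le)]
  congr 1
  have := congrFun (mgf_id_gaussianReal (μ := 0) (v := v)) t
  simpa [mgf] using this

/-- The likelihood ratio of one observation between treated means `f` and `0`. -/
noncomputable def likelihoodRatio {d : ℕ} (f : Cov d → ℝ) (v : ℝ≥0) (z : Obs d) : ℝ≥0∞ :=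
  if z.1.2 = true then ENNReal.ofReal (Real.exp (f z.1.1 * z.2 / v - f z.1.1 ^ 2 / (2 * v))) else 1

theorem measurable_likelihoodRatio {d : ℕ} {f : Cov d → ℝ} (hf : Measurable f) (v : ℝ≥0) :
    Measurable (likelihoodRatio f v) := by
  have h1 : Measurable fun z : Obs d => f z.1.1 := hf.comp (measurable_fst.comp measurable_fst)
  refine Measurable.ite ((measurable_snd.comp measurable_fst) (measurableSet_singleton true)) ?_
    measurable_const
  fun_prop

theorem law_eq_withDensity {d : ℕ} (r : ℝ) {f : Cov d → ℝ} (hf : Measurable f) {σ : ℝ}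
    (hσ : 0 < σ) :
    (vanishingModel r f hf).law σ = ((vanishingModel r (fun _ => 0) measurable_const).law σ).withDensity
      (likelihoodRatio f (σ ^ 2).toNNReal) := by
  have hv : (σ ^ 2).toNNReal ≠ 0 := by
    have : 0 < σ ^ 2 := by positivity
    exact (Real.toNNReal_pos.mpr this).ne'
  ext s hs
  have hmeas := measurable_likelihoodRatio hf (σ ^ 2).toNNReal
  rw [withDensity_apply _ hs, ← lintegral_indicator hs, Model.law, Measure.compProd_apply hs,
    Model.law, Measure.lintegral_compProd (hmeas.indicator hs)]
  change ∫⁻ w, _ ∂(vanishingModel r f hf).design = ∫⁻ w, _ ∂(vanishingModel r f hf).design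
  refine lintegral_congr fun w => ?_
  have hsec : MeasurableSet (Prod.mk w ⁻¹' s) := measurable_prodMk_left hs
  have hind : ∀ y, s.indicator (likelihoodRatio f (σ ^ 2).toNNReal) (w, y) =
      (Prod.mk w ⁻¹' s).indicator (fun y => likelihoodRatio f (σ ^ 2).toNNReal (w, y)) y :=
    fun y => rfl
  simp only [hind]
  rw [lintegral_indicator hsec, ← withDensity_apply _ hsec]
  congr 1
  change gaussianReal ((vanishingModel r f hf).mean w) _ =
    (gaussianReal ((vanishingModel r (fun _ => 0) measurable_const).mean w) _).withDensity _
  by_cases hw : w.2 = true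
  · simp only [Model.mean, vanishingModel, likelihoodRatio, hw, if_true]
    exact gaussianReal_eq_withDensity _ hv
  · simp only [Model.mean, vanishingModel, likelihoodRatio, hw]
    simp

theorem sample_eq_withDensity {d : ℕ} (r : ℝ) {f : Cov d → ℝ} (hf : Measurable f) {σ : ℝ}
    (hσ : 0 < σ) (n : ℕ) :
    (vanishingModel r f hf).sample σ n =
      ((vanishingModel r (fun _ => 0) measurable_const).sample σ n).withDensity
        fun ω => ∏ i, likelihoodRatio f (σ ^ 2).toNNReal (ω i) := by
  refine Measure.pi_eq fun s hs => ?_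
  have hmeas := measurable_likelihoodRatio hf (σ ^ 2).toNNReal
  have hind : ∀ ω : Fin n → Obs d, (Set.univ.pi s).indicator
      (fun ω => ∏ i, likelihoodRatio f (σ ^ 2).toNNReal (ω i)) ω =
      ∏ i, (s i).indicator (likelihoodRatio f (σ ^ 2).toNNReal) (ω i) := fun ω => by
    by_cases hω : ω ∈ Set.univ.pi s
    · rw [Set.indicator_of_mem hω]
      exact Finset.prod_congr rfl fun i _ => (Set.indicator_of_mem (hω i (Set.mem_univ i)) _).symm
    · rw [Set.indicator_of_notMem hω]
      simp only [Set.mem_univ_pi, not_forall] at hω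
      obtain ⟨i, hi⟩ := hω
      exact (Finset.prod_eq_zero (Finset.mem_univ i) (Set.indicator_of_notMem hi _)).symm
  rw [withDensity_apply _ (MeasurableSet.univ_pi hs),
    ← lintegral_indicator (MeasurableSet.univ_pi hs)]
  simp only [hind]
  rw [Model.sample, lintegral_pi_prod _ fun i => hmeas.indicator (hs i)]
  refine Finset.prod_congr rfl fun i _ => ?_
  rw [lintegral_indicator (hs i), ← withDensity_apply _ (hs i), ← law_eq_withDensity r hf hσ]

/-- A Gaussian shift by `f x` has likelihood ratio of second moment `exp (f x ^ 2 / σ ^ 2)`, and an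
untreated unit carries no information; the information is thus weighted by the propensity. -/
theorem lintegral_likelihoodRatio_sq {d : ℕ} (r : ℝ) {f : Cov d → ℝ} (hf : Measurable f) {σ : ℝ}
    (hσ : 0 < σ) :
    ∫⁻ z, likelihoodRatio f (σ ^ 2).toNNReal z ^ 2
        ∂((vanishingModel r (fun _ => 0) measurable_const).law σ) =
      ∫⁻ x, ENNReal.ofReal (1 + powerPropensity r x * (Real.exp (f x ^ 2 / σ ^ 2) - 1))
        ∂(unifCube d) := by
  have hvr : ((σ ^ 2).toNNReal : ℝ) = σ ^ 2 := Real.coe_toNNReal _ (sq_nonneg σ)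
  have hσ2 : σ ^ 2 ≠ 0 := by positivity
  have hmeas := (measurable_likelihoodRatio hf (σ ^ 2).toNNReal).pow_const 2
  rw [Model.law, Measure.lintegral_compProd hmeas]
  have hinner : ∀ w : Cov d × Bool, ∫⁻ y, likelihoodRatio f (σ ^ 2).toNNReal (w, y) ^ 2
      ∂((vanishingModel r (fun _ => 0) measurable_const).outcome σ w) =
      if w.2 = true then ENNReal.ofReal (Real.exp (f w.1 ^ 2 / σ ^ 2)) else 1 := fun w => by
    change ∫⁻ y, _ ∂(gaussianReal ((vanishingModel r (fun _ => 0) measurable_const).mean w) _) = _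
    by_cases hw : w.2 = true
    · simp only [Model.mean, vanishingModel, likelihoodRatio, hw, if_true]
      have hsq : ∀ y : ℝ, ENNReal.ofReal (Real.exp (f w.1 * y / (σ ^ 2).toNNReal -
          f w.1 ^ 2 / (2 * (σ ^ 2).toNNReal))) ^ 2 = ENNReal.ofReal (Real.exp (-(f w.1 ^ 2 / σ ^ 2))) *
          ENNReal.ofReal (Real.exp (2 * f w.1 / σ ^ 2 * y)) := fun y => by
        rw [← ENNReal.ofReal_pow (Real.exp_pos _).le, ← ENNReal.ofReal_mul (Real.exp_pos _).le,
          ← Real.exp_nat_mul, ← Real.exp_add, hvr]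
        congr 2
        field_simp
        push_cast
        ring
      simp only [hsq]
      rw [lintegral_const_mul _ (by fun_prop), lintegral_exp_gaussianReal,
        ← ENNReal.ofReal_mul (Real.exp_pos _).le, ← Real.exp_add, hvr]
      congr 2
      field_simp
      ring
    · simp only [Model.mean, vanishingModel, likelihoodRatio, hw]
      simp
  simp only [hinner]
  change ∫⁻ w, _ ∂(vanishingModel r (fun _ => 0) measurable_const).design = _
  rw [lintegral_design]
  · refine lintegral_congr fun x => ?_
    have he0 := (powerPropensity r x).2.1
    have he1 := (powerPropensity r x).2.2
    simp only [if_true, Bool.false_eq_true, if_false, mul_one, vanishingModel]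
    rw [← ENNReal.ofReal_mul he0, ← ENNReal.ofReal_add (mul_nonneg he0 (Real.exp_pos _).le)
      (by linarith)]
    congr 1; ring
  · refine Measurable.ite (measurable_snd (measurableSet_singleton true)) ?_ measurable_const
    have h1 : Measurable fun w : Cov d × Bool => f w.1 := hf.comp measurable_fst
    fun_prop

/-- Pointwise `Λ ≤ K + Λ ^ 2 / K`: below `K` trivially, above `K` because `Λ / K ≥ 1`. Integrating
over `A` transfers probabilities from the bump model to the null model. -/
theorem sample_le_of_second_moment {d n : ℕ} (r : ℝ) {f : Cov d → ℝ} (hf : Measurable f) {σ : ℝ}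
    (hσ : 0 < σ) {V K : ℝ≥0∞} (hK0 : K ≠ 0) (hKt : K ≠ ⊤)
    (hV : (∫⁻ z, likelihoodRatio f (σ ^ 2).toNNReal z ^ 2
        ∂((vanishingModel r (fun _ => 0) measurable_const).law σ)) ^ n ≤ V)
    {A : Set (Fin n → Obs d)} (hA : MeasurableSet A) :
    (vanishingModel r f hf).sample σ n A ≤
      K * (vanishingModel r (fun _ => 0) measurable_const).sample σ n A + V / K := by
  set Q := (vanishingModel r (fun _ => 0) measurable_const).sample (d := d) σ n
  set Λ : (Fin n → Obs d) → ℝ≥0∞ := fun ω => ∏ i, likelihoodRatio f (σ ^ 2).toNNReal (ω i) with hΛ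
  have hm := measurable_likelihoodRatio hf (σ ^ 2).toNNReal
  have hΛm : Measurable Λ := Finset.measurable_prod _ fun i _ => hm.comp (measurable_pi_apply i)
  have hΛ2 : ∫⁻ ω, Λ ω ^ 2 ∂Q ≤ V := by
    have : ∀ ω, Λ ω ^ 2 = ∏ i, likelihoodRatio f (σ ^ 2).toNNReal (ω i) ^ 2 := fun ω => by
      rw [hΛ, Finset.prod_pow]
    simp only [this]
    refine le_trans (le_of_eq ?_) hV
    change ∫⁻ ω, _ ∂(Measure.pi fun _ => _) = _
    rw [lintegral_pi_prod _ fun i => hm.pow_const 2, Finset.prod_const, Finset.card_univ,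
      Fintype.card_fin]
  rw [sample_eq_withDensity r hf hσ n, withDensity_apply _ hA]
  have hpt : ∀ ω, Λ ω ≤ K + Λ ω ^ 2 / K := fun ω => by
    rcases le_total (Λ ω) K with h | h
    · exact h.trans le_self_add
    · refine le_trans ?_ le_add_self
      rw [ENNReal.le_div_iff_mul_le (Or.inl hK0) (Or.inl hKt), pow_two]
      gcongr
  calc ∫⁻ ω in A, Λ ω ∂Q ≤ ∫⁻ ω in A, (K + Λ ω ^ 2 / K) ∂Q := lintegral_mono hpt
    _ = K * Q A + (∫⁻ ω in A, Λ ω ^ 2 ∂Q) / K := by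
        rw [lintegral_add_left measurable_const, setLIntegral_const]
        simp only [div_eq_mul_inv]
        rw [lintegral_mul_const _ (hΛm.pow_const 2)]
    _ ≤ K * Q A + V / K := by
        gcongr
        exact (setLIntegral_le_lintegral _ _).trans hΛ2

/-- Three effects multiply on the support: squared height of order `h ^ (2β)`, volume of order `h ^
d`, and propensity at most `h ^ r`. -/
theorem second_moment_bump_le {d : ℕ} {r a β σ h : ℝ} (hr : 0 ≤ r) (hβ : 0 < β) (ha : 0 < a)
    (hσ : 0 < σ) (hh : 0 < h) (hh1 : h ≤ 1) {φ : Cov d → ℝ} (h01 : ∀ x, φ x ∈ Set.Icc (0 : ℝ) 1)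
    (hsupp : ∀ x, 1 ≤ ‖x‖ → φ x = 0) :
    ∫⁻ x, ENNReal.ofReal (1 + powerPropensity r x *
        (Real.exp ((a * h ^ β * φ (h⁻¹ • x)) ^ 2 / σ ^ 2) - 1)) ∂(unifCube d) ≤
      ENNReal.ofReal (1 + Real.exp (a ^ 2 / σ ^ 2) * (a ^ 2 / σ ^ 2) * h ^ (2 * β + d + r)) := by
  set D : ℝ := Real.exp (a ^ 2 / σ ^ 2) * (a ^ 2 / σ ^ 2) with hD
  have hD0 : 0 ≤ D := by positivity
  set T : Set (Cov d) := {x | ‖WithLp.ofLp x‖ ≤ h} with hT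
  have hTm : MeasurableSet T :=
    measurableSet_le (PiLp.continuous_ofLp 2 fun _ : Fin d => ℝ).norm.measurable measurable_const
  have hpt : ∀ x ∈ cube d, ENNReal.ofReal (1 + powerPropensity r x *
      (Real.exp ((a * h ^ β * φ (h⁻¹ • x)) ^ 2 / σ ^ 2) - 1)) ≤
      1 + T.indicator (fun _ => ENNReal.ofReal (D * h ^ (2 * β + r))) x := by
    intro x hx
    by_cases hxT : x ∈ T
    · rw [Set.indicator_of_mem hxT, ← ENNReal.ofReal_one, ← ENNReal.ofReal_add zero_le_one
        (by positivity)]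
      refine ENNReal.ofReal_le_ofReal (add_le_add le_rfl ?_)
      have he : (powerPropensity r x : ℝ) ≤ h ^ r := by
        rw [powerPropensity_of_mem_cube hr hx]
        exact Real.rpow_le_rpow (norm_nonneg _) hxT hr
      set u : ℝ := (a * h ^ β * φ (h⁻¹ • x)) ^ 2 / σ ^ 2 with hu
      have hu0 : 0 ≤ u := by positivity
      have hub : u ≤ a ^ 2 / σ ^ 2 * h ^ (2 * β) := by
        have h1 : φ (h⁻¹ • x) ^ 2 ≤ 1 := pow_le_one₀ (h01 _).1 (h01 _).2
        have h2 : h ^ (2 * β) = (h ^ β) ^ 2 := by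
          rw [← Real.rpow_natCast, ← Real.rpow_mul hh.le]; congr 1; push_cast; ring
        rw [hu, h2, div_mul_eq_mul_div]
        gcongr
        calc (a * h ^ β * φ (h⁻¹ • x)) ^ 2 = a ^ 2 * (h ^ β) ^ 2 * φ (h⁻¹ • x) ^ 2 := by ring
          _ ≤ a ^ 2 * (h ^ β) ^ 2 * 1 := by gcongr
          _ = _ := mul_one _
      have hub' : u ≤ a ^ 2 / σ ^ 2 := hub.trans (mul_le_of_le_one_right (by positivity)
        (Real.rpow_le_one hh.le hh1 (by positivity)))
      have hexp : Real.exp u - 1 ≤ u * Real.exp (a ^ 2 / σ ^ 2) := by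
        have h3 := mul_le_mul_of_nonneg_left (Real.add_one_le_exp (-u)) (Real.exp_pos u).le
        rw [← Real.exp_add, add_neg_cancel, Real.exp_zero] at h3
        have h4 : u * Real.exp u ≤ u * Real.exp (a ^ 2 / σ ^ 2) := by gcongr
        linarith
      have hexp0 : 0 ≤ Real.exp u - 1 := by linarith [Real.add_one_le_exp u]
      calc (powerPropensity r x : ℝ) * (Real.exp u - 1)
          ≤ h ^ r * (a ^ 2 / σ ^ 2 * h ^ (2 * β) * Real.exp (a ^ 2 / σ ^ 2)) := by
            refine mul_le_mul he (hexp.trans ?_) hexp0 (by positivity)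
            gcongr
        _ = D * h ^ (2 * β + r) := by rw [hD, Real.rpow_add hh]; ring
    · have hφ : φ (h⁻¹ • x) = 0 := by
        refine hsupp _ ?_
        have h1 : h < ‖WithLp.ofLp x‖ := not_le.mp hxT
        have h2 : ‖WithLp.ofLp x‖ ≤ ‖x‖ :=
          (pi_norm_le_iff_of_nonneg (norm_nonneg x)).mpr fun i => PiLp.norm_apply_le x i
        rw [norm_smul, norm_inv, Real.norm_eq_abs, abs_of_pos hh, inv_mul_eq_div, le_div_iff₀ hh]
        linarith
      rw [Set.indicator_of_notMem hxT, hφ]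
      simp
  refine (lintegral_mono_ae ((ae_mem_cube d).mono hpt)).trans ?_
  rw [lintegral_add_left measurable_const, lintegral_indicator hTm, setLIntegral_const,
    unifCube_norm_le hh.le hh1, ← ENNReal.ofReal_mul (by positivity), lintegral_const, measure_univ,
    one_mul, ENNReal.ofReal_add zero_le_one (by positivity), ENNReal.ofReal_one]
  refine add_le_add le_rfl (ENNReal.ofReal_le_ofReal (le_of_eq ?_))
  rw [mul_assoc, ← Real.rpow_natCast, ← Real.rpow_add hh]
  congr 2; ring

/-! ### The two-point argument and conclusion -/

theorem pointwise_lower_bound {d : ℕ} (hd : 1 ≤ d) {β γ₀ σ L M : ℝ} (hβ : 0 < β) (hγ : 1 < γ₀)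
    (hσ : 0 < σ) (hL : 0 < L) (hM : 0 < M) :
    ∃ c > (0 : ℝ), ∃ η > (0 : ℝ≥0∞), ∀ n : ℕ, 1 ≤ n → ∀ muhat : Estimator d n,
      η ≤ ⨆ P ∈ vanishingFamily d (d / (γ₀ - 1)) β L M,
        (P.sample σ n) {ω | c * rate d β γ₀ n < |muhat.1 ω 0 - P.mu 0|} := by
  have hg : 0 < γ₀ - 1 := by linarith
  obtain ⟨a, ha, haM, φ, hφc, hφ0, hφ01, hφs, hφH⟩ := exists_scaled_bump d hβ hL hM
  set r : ℝ := d / (γ₀ - 1) with hr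
  have hr0 : 0 ≤ r := by positivity
  set s : ℝ := 2 * β + d + r with hs
  have hs0 : 0 < s := by positivity
  set D : ℝ := Real.exp (a ^ 2 / σ ^ 2) * (a ^ 2 / σ ^ 2) with hD
  have hD0 : 0 ≤ D := by positivity
  set V : ℝ := Real.exp D with hV
  have hV0 : 0 < V := Real.exp_pos _
  -- A quarter of the separation `a * h ^ β` makes the two accuracy events disjoint. The value of
  -- `η` is chosen to contradict `1 ≤ 4 V S + 1/4 + S`, which follows from the second moment bound
  -- with `K = 4 V`.
  refine ⟨a / 4, by positivity, ENNReal.ofReal (1 / (2 * (4 * V + 1))),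
    ENNReal.ofReal_pos.mpr (by positivity), fun n hn muhat => ?_⟩
  have hn' : (1 : ℝ) ≤ n := by exact_mod_cast hn
  have hn0 : (0 : ℝ) < n := by linarith
  set h : ℝ := (n : ℝ) ^ (-(1 / s)) with hh
  have hh0 : 0 < h := by positivity
  have hh1 : h ≤ 1 := Real.rpow_le_one_of_one_le_of_nonpos hn' (by
    have : 0 < 1 / s := by positivity
    linarith)
  -- The width `h = n ^ (-1/s)` gives both `h ^ β` equal to the rate and `n * h ^ s = 1`, so the
  -- second moment of the full likelihood ratio stays below `exp D`.
  have hrate : rate d β γ₀ n = h ^ β := by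
    rw [rate_eq hβ hγ, ← hr, ← hs, hh, ← Real.rpow_mul hn0.le, ← Real.rpow_mul hn0.le]
    congr 1; ring
  have hhs : n * h ^ s = 1 := by
    rw [hh, ← Real.rpow_mul hn0.le, neg_mul, one_div_mul_cancel hs0.ne', Real.rpow_neg hn0.le,
      Real.rpow_one, mul_inv_cancel₀ hn0.ne']
  set f : Cov d → ℝ := fun x => a * h ^ β * φ (h⁻¹ • x) with hf
  have hfm : Measurable f := by
    have : Measurable φ := hφc.measurable
    fun_prop
  have hf0 : f 0 = a * h ^ β := by simp [hf, hφ0]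
  set P₀ : Model d := vanishingModel r (fun _ => 0) measurable_const with hP₀
  set P₁ : Model d := vanishingModel r f hfm with hP₁
  have hmem₀ : P₀ ∈ vanishingFamily d r β L M :=
    ⟨rfl, rfl, zero_mem_holderClass d hL.le, fun x => by simpa [hP₀, vanishingModel] using hM.le⟩
  have hmem₁ : P₁ ∈ vanishingFamily d r β L M := by
    refine ⟨rfl, rfl, hφH h ⟨hh0, hh1⟩, fun x => ?_⟩
    change (a * h ^ β * φ (h⁻¹ • x)) ^ 2 ≤ M
    refine le_trans ?_ haM
    have h1 : 0 ≤ h ^ β * φ (h⁻¹ • x) := mul_nonneg (by positivity) (hφ01 _).1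
    have h2 : h ^ β * φ (h⁻¹ • x) ≤ 1 :=
      mul_le_one₀ (Real.rpow_le_one hh0.le hh1 hβ.le) (hφ01 _).1 (hφ01 _).2
    rw [mul_assoc, mul_pow]
    exact mul_le_of_le_one_right (by positivity) (pow_le_one₀ h1 h2)
  set S := ⨆ P ∈ vanishingFamily d r β L M,
    (P.sample σ n) {ω | a / 4 * rate d β γ₀ n < |muhat.1 ω 0 - P.mu 0|} with hS
  set A₀ : Set (Fin n → Obs d) := {ω | a / 4 * rate d β γ₀ n < |muhat.1 ω 0 - P₀.mu 0|} with hA₀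
  set A₁ : Set (Fin n → Obs d) := {ω | a / 4 * rate d β γ₀ n < |muhat.1 ω 0 - P₁.mu 0|} with hA₁
  have hS₀ : P₀.sample σ n A₀ ≤ S := le_iSup₂_of_le P₀ hmem₀ le_rfl
  have hS₁ : P₁.sample σ n A₁ ≤ S := le_iSup₂_of_le P₁ hmem₁ le_rfl
  have hmuhat : Measurable fun ω => muhat.1 ω 0 := by
    exact muhat.2.comp (measurable_id.prodMk (measurable_const (a := (0 : Cov d))))
  have hA₀m : MeasurableSet A₀ :=
    measurableSet_lt measurable_const (hmuhat.sub_const _).abs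
  -- No single value is close to both `0` and `a * h ^ β`, so the estimator errs under at least one
  -- of the two models.
  have hcover : A₀ ∪ A₁ = Set.univ := by
    refine Set.eq_univ_of_forall fun ω => ?_
    by_contra hc
    rw [Set.mem_union, not_or] at hc
    have h1 : |muhat.1 ω 0 - 0| ≤ a / 4 * h ^ β := by
      have : |muhat.1 ω 0 - 0| ≤ a / 4 * rate d β γ₀ n := not_lt.mp fun h => hc.1 h
      rwa [hrate] at this
    have h2 : |muhat.1 ω 0 - a * h ^ β| ≤ a / 4 * h ^ β := by
      have : |muhat.1 ω 0 - f 0| ≤ a / 4 * rate d β γ₀ n := not_lt.mp fun h => hc.2 h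
      rwa [hrate, hf0] at this
    obtain ⟨h3, h4⟩ := abs_le.mp h1
    obtain ⟨h5, h6⟩ := abs_le.mp h2
    have h7 : 0 < a * h ^ β := by positivity
    linarith
  have hsecond : (∫⁻ z, likelihoodRatio f (σ ^ 2).toNNReal z ^ 2 ∂(P₀.law σ)) ^ n ≤
      ENNReal.ofReal V := by
    rw [hP₀, lintegral_likelihoodRatio_sq r hfm hσ]
    refine (pow_le_pow_left' (second_moment_bump_le hr0 hβ ha hσ hh0 hh1 hφ01 hφs) n).trans ?_
    rw [← ENNReal.ofReal_pow (by positivity)]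
    refine ENNReal.ofReal_le_ofReal ?_
    calc (1 + D * h ^ s) ^ n ≤ Real.exp (D * h ^ s) ^ n := by
          gcongr
          linarith [Real.add_one_le_exp (D * h ^ s)]
      _ = Real.exp (D * (n * h ^ s)) := by rw [← Real.exp_nat_mul]; congr 1; ring
      _ = V := by rw [hhs, mul_one]
  have hCS := sample_le_of_second_moment (n := n) r hfm hσ (K := ENNReal.ofReal (4 * V))
    (ENNReal.ofReal_pos.mpr (by positivity)).ne' ENNReal.ofReal_ne_top hsecond hA₀m
  have hquarter : ENNReal.ofReal V / ENNReal.ofReal (4 * V) = ENNReal.ofReal (1 / 4) := by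
    rw [← ENNReal.ofReal_div_of_pos (by positivity)]
    congr 1; field_simp
  rw [hquarter] at hCS
  have htotal : (1 : ℝ≥0∞) ≤ ENNReal.ofReal (4 * V) * S + ENNReal.ofReal (1 / 4) + S := by
    have hprob : P₁.sample σ n Set.univ = 1 := by
      change Measure.pi (fun _ => P₁.law σ) Set.univ = 1
      exact measure_univ
    rw [← hprob, ← hcover]
    refine (measure_union_le _ _).trans (add_le_add (hCS.trans ?_) hS₁)
    gcongr
  by_contra hlt
  push Not at hlt
  have : ENNReal.ofReal (4 * V) * S + ENNReal.ofReal (1 / 4) + S < 1 := by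
    have hle : ENNReal.ofReal (4 * V) * S + ENNReal.ofReal (1 / 4) + S ≤
        ENNReal.ofReal (4 * V) * ENNReal.ofReal (1 / (2 * (4 * V + 1))) + ENNReal.ofReal (1 / 4) +
          ENNReal.ofReal (1 / (2 * (4 * V + 1))) := by gcongr
    refine hle.trans_lt ?_
    rw [← ENNReal.ofReal_mul (by positivity), ← ENNReal.ofReal_add (by positivity) (by positivity),
      ← ENNReal.ofReal_add (by positivity) (by positivity), ← ENNReal.ofReal_one]
    refine (ENNReal.ofReal_lt_ofReal_iff zero_lt_one).mpr ?_
    have : 4 * V * (1 / (2 * (4 * V + 1))) + 1 / 4 + 1 / (2 * (4 * V + 1)) = 3 / 4 := by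
      field_simp; ring
    rw [this]; norm_num
  exact absurd htotal (not_le.mpr this)

theorem ofReal_abs_sub_le_supDist {d : ℕ} {f g : Cov d → ℝ} {x : Cov d} (hx : x ∈ cube d) :
    ENNReal.ofReal |f x - g x| ≤ supDist f g :=
  le_iSup₂_of_le (f := fun y (_ : y ∈ cube d) => ENNReal.ofReal |f y - g y|) x hx le_rfl

theorem setOf_lt_abs_sub_subset {Ω : Type*} {d : ℕ} {t : ℝ} (ht : 0 ≤ t) (f : Ω → Cov d → ℝ)
    (g : Cov d → ℝ) {x : Cov d} (hx : x ∈ cube d) :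
    {ω | t < |f ω x - g x|} ⊆ {ω | ENNReal.ofReal t < supDist (f ω) g} := fun _ hω =>
  ((ENNReal.ofReal_lt_ofReal_iff_of_nonneg ht).mpr hω).trans_le (ofReal_abs_sub_le_supDist hx)

theorem rate_nonneg (d : ℕ) (β γ₀ : ℝ) (n : ℕ) : 0 ≤ rate d β γ₀ n :=
  Real.rpow_nonneg n.cast_nonneg _

theorem zero_mem_cube (d : ℕ) : (0 : Cov d) ∈ cube d := fun i => by simp

end WeakOverlap

theorem theorem2 (d : ℕ) (hd : 1 ≤ d) (β : ℝ) (hβ : 0 < β) :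
    -- lower bound, pointwise at `0` and in sup norm
    (∀ q M σ C γ₀ L : ℝ, 3 < q → 0 < M → 0 < σ → 1 ≤ C → 1 < γ₀ → 0 < L →
      ∫⁻ z, ENNReal.ofReal (|z| ^ q) ∂(gaussianReal 0 (σ ^ 2).toNNReal) ≤ ENNReal.ofReal (M ^ q) →
      ∃ c > (0 : ℝ), ∃ F : Set (Model d),
        HolderModel β L q M σ C γ₀ F ∧ NontrivialConcentration σ F ∧
        0 < liminf (fun n : ℕ => ⨅ muhat : Estimator d n, ⨆ P ∈ F,
          (P.sample σ n) {ω | c * rate d β γ₀ n < |muhat.1 ω 0 - P.mu 0|}) atTop ∧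
        0 < liminf (fun n : ℕ => ⨅ muhat : Estimator d n, ⨆ P ∈ F,
          (P.sample σ n) {ω | ENNReal.ofReal (c * rate d β γ₀ n) <
            supDist (muhat.1 ω) P.mu}) atTop) ∧
    -- one estimator, chosen before `γ₀` and the family, attains the rate in sup norm
    (∃ muhat : ∀ n : ℕ, Estimator d n,
      ∀ q M σ C γ₀ L : ℝ, 3 < q → 0 < M → 0 < σ → 0 < C → 1 < γ₀ → 0 < L →
      ∀ F : Set (Model d),
        HolderModel β L q M σ C γ₀ F → NontrivialConcentration σ F →
        ∀ ε > (0 : ℝ), ∃ c : ℝ,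
          limsup (fun n : ℕ => ⨆ P ∈ F,
            (P.sample σ n) {ω | ENNReal.ofReal (c * rate d β γ₀ n) <
              supDist ((muhat n).1 ω) P.mu}) atTop ≤ ENNReal.ofReal ε ∧
          ∀ x ∈ cube d,
            limsup (fun n : ℕ => ⨆ P ∈ F,
              (P.sample σ n) {ω | c * rate d β γ₀ n <
                |(muhat n).1 ω x - P.mu x|}) atTop ≤ ENNReal.ofReal ε) := by
  refine ⟨fun q M σ C γ₀ L _ hM hσ hC hγ hL hmom => ?_, ?_⟩
  · obtain ⟨c, hc, η, hη, hlow⟩ := pointwise_lower_bound hd hβ hγ hσ hL hM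
    refine ⟨c, hc, vanishingFamily d (d / (γ₀ - 1)) β L M,
      holderModel_vanishingFamily hd hM hC hγ hL hmom,
      concentration_powerPropensity hd σ (sub_pos.mpr hγ) fun P hP => hP.1, ?_, ?_⟩
    · refine hη.trans_le (le_liminf_of_le (by isBoundedDefault) ?_)
      filter_upwards [eventually_ge_atTop 1] with n hn
      exact le_iInf fun muhat => hlow n hn muhat
    · refine hη.trans_le (le_liminf_of_le (by isBoundedDefault) ?_)
      filter_upwards [eventually_ge_atTop 1] with n hn
      refine le_iInf fun muhat => (hlow n hn muhat).trans (iSup₂_mono fun P _ => measure_mono ?_)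
      exact setOf_lt_abs_sub_subset (mul_nonneg hc.le (rate_nonneg d β γ₀ n)) _ _ (zero_mem_cube d)
  · obtain ⟨muhat, hmuhat⟩ := piecewiseFit_attains_rate hd hβ
    refine ⟨muhat, fun q M σ C γ₀ L _ _ hσ _ hγ hL F hF _ ε hε => ?_⟩
    obtain ⟨c, hc, hup⟩ := hmuhat σ C γ₀ L hσ hγ hL F hF.smooth hF.basic.propensity_tail ε hε
    refine ⟨c, limsup_le_of_le (by isBoundedDefault) hup, fun x hx =>
      limsup_le_of_le (by isBoundedDefault) (hup.mono fun n hn => le_trans ?_ hn)⟩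
    refine iSup₂_mono fun P _ => measure_mono ?_
    exact setOf_lt_abs_sub_subset (mul_nonneg hc (rate_nonneg d β γ₀ n)) _ _ hx
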